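/- Let $Y,U,Z$ be separable complex Hilbert spaces. Let $A:\mathcal D(A)\subseteq Y\to Y$ generate a strongly continuous semigroup $e^{At}$ on $Y$ with $\|e^{At}\|_{\mathcal L(Y)}\le Me^{-\omega t}$ for all $t\ge 0$ and some $M\ge 1$, $\omega>0$. Give $\mathcal D(A^*)$ the graph norm, let $[\mathcal D(A^*)]'\supseteq Y$ be its dual with respect to the pivot space $Y$, let $B:U\to[\mathcal D(A^*)]'$ and $R:Y\to Z$ be bounded linear operators, and let $B^*:\mathcal D(A^*)\to U$ be the adjoint of $B$. For $\alpha>0$ write $A^{\alpha}$ for the fractional power $(-A)^{\alpha}$, i.e. the inverse of the bounded injective operator $A^{-\alpha}=\frac1{\Gamma(\alpha)}\int_0^\infty t^{\alpha-1}e^{At}\,dt$, and similarly for $A^{*\alpha}$, with $e^{A^*t}$ in place of $e^{At}$. Assume that $$B^*e^{A^*t}x=F(t)x+G(t)x,\qquad t>0,\ x\in\mathcal D(A^*),$$ with bounded linear operators $F(t):Y\to U$ and $G(t):\mathcal D(A^*)\to U$ such that, for some $\gamma\in(0,1)$ and $\epsilon>0$ (and up to extension of operators that are initially defined on a subspace of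 $Y$): (i) there are $\eta,N>0$ with $\|F(t)\|_{\mathcal L(Y,U)}\le Nt^{-\gamma}e^{-\eta t}$ for all $t>0$; (ii) there is $T>0$ such that $G(\cdot)\in\mathcal L(Y,L^p(0,T;U))$ for all $p\in[1,\infty)$; (iii) there are $T>0$ and $q\in(1,2)$ such that $G(\cdot)A^{*-\epsilon}\in\mathcal L(Y,C([0,T];U))$, the operator $A^{*\epsilon}R^*RA^{-\epsilon}$ is defined on all of $Y$ and belongs to $\mathcal L(Y)$, and $B^*e^{A^*\cdot}A^{*\epsilon}$, defined on $\mathcal D(A^{*\,1+\epsilon})$, extends to an element of $\mathcal L(Y,L^q(0,T;U))$. For $x\in Y$ and $u\in L^2(0,\infty;U)$ let $y(t;x,u)=e^{At}x+\int_0^te^{A(t-s)}Bu(s)\,ds\in[\mathcal D(A^*)]'$ be the mild solution of $y'=Ay+Bu$, $y(0)=x$, and consider the problem of minimizing $$\int_0^\infty\big(\|Ry(t;x,u)\|_Z^2+\|u(t)\|_U^2\big)\,dt$$ over all $u\in L^2(0,\infty;U)$. If $\epsilon<1-\gamma$, then: for every $x\in Y$ there is a unique optimal control $\hat u(\cdot;x)$;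 the formula $\Phi(t)x=y(t;x,\hat u(\cdot;x))$, $t\ge 0$, defines a strongly continuous semigroup $\Phi$ on $Y$; and its infinitesimal generator $A_P$ satisfies $$\mathcal D(A_P)\subseteq\mathcal D(A^{\epsilon}),\qquad \mathcal D(A_P^*)\subseteq\mathcal D(A^{*\epsilon}).$$ -/

import Mathlib

open MeasureTheory Set Filter Topology
open scoped NNReal ENNReal LinearPMap

/-- A strongly continuous (`C₀`-) semigroup of bounded operators `S t`, `t ≥ 0`. -/
structure C0Semigroup (Y : Type*) [NormedAddCommGroup Y] [NormedSpace ℂ Y] where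
  toFun : ℝ≥0 → Y →L[ℂ] Y
  map_zero : toFun 0 = ContinuousLinearMap.id ℂ Y
  map_add : ∀ s t, toFun (s + t) = (toFun s).comp (toFun t)
  cont : ∀ x, Continuous fun t => toFun t x

namespace C0Semigroup

noncomputable section

section Generator

variable {Y : Type*} [NormedAddCommGroup Y] [NormedSpace ℂ Y]

instance : CoeFun (C0Semigroup Y) (fun _ => ℝ≥0 → Y →L[ℂ] Y) := ⟨toFun⟩

/-- Exponential stability: `‖S t‖ ≤ M e^{-ω t}` with `M ≥ 1`, `ω > 0`. -/
def ExpStable (S : C0Semigroup Y) : Prop :=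
  ∃ M ω : ℝ, 1 ≤ M ∧ 0 < ω ∧ ∀ t : ℝ≥0, ‖S t‖ ≤ M * Real.exp (-ω * t)

/-- `y` is the limit of the difference quotients `(S t x - x) / t` as `t → 0⁺`. -/
def HasGen (S : C0Semigroup Y) (x y : Y) : Prop :=
  Tendsto (fun t : ℝ≥0 => (t : ℝ)⁻¹ • (S t x - x)) (𝓝[>] 0) (𝓝 y)

theorem HasGen.add {S : C0Semigroup Y} {x x' y y' : Y} (h : S.HasGen x y) (h' : S.HasGen x' y') :
    S.HasGen (x + x') (y + y') := by
  refine (Tendsto.add h h').congr fun t => ?_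
  rw [← smul_add, _root_.map_add]
  congr 1
  abel

theorem HasGen.smul {S : C0Semigroup Y} (c : ℂ) {x y : Y} (h : S.HasGen x y) :
    S.HasGen (c • x) (c • y) := by
  refine (Tendsto.const_smul h c).congr fun t => ?_
  rw [map_smul, ← smul_sub, smul_comm]

theorem HasGen.unique {S : C0Semigroup Y} {x y y' : Y} (h : S.HasGen x y) (h' : S.HasGen x y') :
    y = y' :=
  tendsto_nhds_unique h h'

/-- The infinitesimal generator: `A x = lim_{t → 0⁺} (S t x - x) / t`, defined for exactly those
`x` for which the limit exists. -/
def generator (S : C0Semigroup Y) : Y →ₗ.[ℂ] Y where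
  domain :=
    { carrier := {x | ∃ y, S.HasGen x y}
      add_mem' := by
        rintro a b ⟨y, hy⟩ ⟨z, hz⟩
        exact ⟨y + z, hy.add hz⟩
      zero_mem' := ⟨0, by simp [HasGen]⟩
      smul_mem' := by
        rintro c x ⟨y, hy⟩
        exact ⟨c • y, hy.smul c⟩ }
  toFun :=
    { toFun := fun x => x.2.choose
      map_add' := fun x x' =>
        (x + x').2.choose_spec.unique (x.2.choose_spec.add x'.2.choose_spec)
      map_smul' := fun c x => (c • x).2.choose_spec.unique (x.2.choose_spec.smul c) }

theorem mem_generator_domain {S : C0Semigroup Y} {x : Y} :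
    x ∈ S.generator.domain ↔ ∃ y, S.HasGen x y := Iff.rfl

theorem hasGen_generator (S : C0Semigroup Y) (x : S.generator.domain) :
    S.HasGen x (S.generator x) :=
  x.2.choose_spec

theorem HasGen.map {S : C0Semigroup Y} {x y : Y} (h : S.HasGen x y) (s : ℝ≥0) :
    S.HasGen (S s x) (S s y) := by
  refine (((S s).continuous.tendsto y).comp h).congr fun t => ?_
  have hc : S s (S t x) = S t (S s x) := by
    have h1 := congrArg (fun f => f x) (S.map_add s t)
    have h2 := congrArg (fun f => f x) (S.map_add t s)
    simp only [ContinuousLinearMap.comp_apply] at h1 h2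
    rw [← h1, ← h2, add_comm]
  simp only [Function.comp_apply]
  rw [← hc, ← map_sub, ← Complex.coe_smul, ← Complex.coe_smul, map_smul]

theorem hasGen_integral [CompleteSpace Y] (S : C0Semigroup Y) (x : Y) (h : ℝ≥0) :
    S.HasGen (∫ s in (0 : ℝ)..h, S s.toNNReal x) (S h x - x) := by
  set f : ℝ → Y := fun s => S s.toNNReal x with hf
  have hfc : Continuous f := (S.cont x).comp continuous_real_toNNReal
  have hint : ∀ a b : ℝ, IntervalIntegrable f volume a b := fun a b =>
    hfc.intervalIntegrable a b
  have hder : ∀ a : ℝ, HasDerivAt (fun b : ℝ => ∫ s in (0 : ℝ)..b, f s) (f a) a := fun a =>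
    intervalIntegral.integral_hasDerivAt_right (hint _ _)
      hfc.stronglyMeasurable.stronglyMeasurableAtFilter hfc.continuousAt
  have h1 := (hasDerivAt_iff_tendsto_slope_zero.1 (hder h)).sub
    (hasDerivAt_iff_tendsto_slope_zero.1 (hder 0))
  have hcoe : Tendsto (fun t : ℝ≥0 => (t : ℝ)) (𝓝[>] 0) (𝓝[≠] 0) := by
    refine tendsto_nhdsWithin_iff.2 ⟨?_, ?_⟩
    · exact (NNReal.continuous_coe.tendsto 0).mono_left nhdsWithin_le_nhds
    · filter_upwards [self_mem_nhdsWithin] with t ht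
      have : (0 : ℝ≥0) < t := ht
      simpa using this.ne'
  have h2 := h1.comp hcoe
  have e1 : f (h : ℝ) = S h x := by simp [hf]
  have e0 : f 0 = x := by simp [hf, S.map_zero]
  rw [e1, e0] at h2
  refine h2.congr fun t => ?_
  simp only [Function.comp_apply, zero_add]
  rw [← smul_sub]
  congr 1
  have hS : S t (∫ s in (0 : ℝ)..h, f s) = ∫ s in (t : ℝ)..(h + t : ℝ), f s := by
    rw [← ContinuousLinearMap.intervalIntegral_comp_comm _ (hint _ _)]
    have := intervalIntegral.integral_comp_add_right (a := 0) (b := (h : ℝ)) f (t : ℝ)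
    rw [zero_add] at this
    rw [← this]
    refine intervalIntegral.integral_congr fun s hs => ?_
    have hs0 : 0 ≤ s := by
      rw [uIcc_of_le (NNReal.coe_nonneg h)] at hs
      exact hs.1
    have h3 := congrArg (fun g => g x) (S.map_add t s.toNNReal)
    simp only [ContinuousLinearMap.comp_apply] at h3
    simp only [hf]
    rw [← h3, Real.toNNReal_add hs0 (NNReal.coe_nonneg t), Real.toNNReal_coe, add_comm]
  rw [hS]
  have a1 := intervalIntegral.integral_add_adjacent_intervals (hint 0 t) (hint t (h + t))
  rw [← a1, intervalIntegral.integral_same]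
  abel

/-- The generator of a `C₀`-semigroup is densely defined. -/
theorem dense_generator_domain [CompleteSpace Y] (S : C0Semigroup Y) :
    Dense (S.generator.domain : Set Y) := by
  intro x
  set f : ℝ → Y := fun s => S s.toNNReal x with hf
  have hfc : Continuous f := (S.cont x).comp continuous_real_toNNReal
  have hder : HasDerivAt (fun b : ℝ => ∫ s in (0 : ℝ)..b, f s) (f 0) 0 :=
    intervalIntegral.integral_hasDerivAt_right (hfc.intervalIntegrable _ _)
      hfc.stronglyMeasurable.stronglyMeasurableAtFilter hfc.continuousAt
  have h1 := hasDerivAt_iff_tendsto_slope_zero.1 hder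
  have e0 : f 0 = x := by simp [hf, S.map_zero]
  simp only [zero_add, intervalIntegral.integral_same, sub_zero, e0] at h1
  have h2 : Tendsto (fun t : ℝ => t⁻¹ • ∫ s in (0 : ℝ)..t, f s) (𝓝[>] 0) (𝓝 x) :=
    h1.mono_left (nhdsWithin_mono _ fun t ht => ne_of_gt ht)
  refine mem_closure_of_tendsto h2 ?_
  filter_upwards [self_mem_nhdsWithin] with t ht
  have ht0 : 0 ≤ t := le_of_lt ht
  have := (S.hasGen_integral x ⟨t, ht0⟩).smul ((t⁻¹ : ℝ) : ℂ)
  rw [Complex.coe_smul] at this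
  exact ⟨_, this⟩

end Generator

section Adjoint

variable {Y : Type*} [NormedAddCommGroup Y] [InnerProductSpace ℂ Y] [CompleteSpace Y]

/-- The adjoint semigroup `e^{A* t} = (e^{A t})*`. -/
def adj (S : C0Semigroup Y) (t : ℝ≥0) : Y →L[ℂ] Y := ContinuousLinearMap.adjoint (S t)

/-- The domain `D(A*)` of the adjoint of the generator, with the graph norm: it is realized as the
graph of `A*`, so that an element is a pair `(x, A* x)` with `x ∈ D(A*)`. -/
abbrev AdjDom (S : C0Semigroup Y) : Type _ := S.generator†.graph

/-- The inclusion `D(A*) → Y`. -/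
def AdjDom.toY {S : C0Semigroup Y} (z : S.AdjDom) : Y := z.1.1

/-- The extrapolation space `[D(A*)]'`: bounded conjugate-linear functionals on `D(A*)`. The space
`Y` is embedded in it as the pivot space, `y ↦ (z ↦ ⟪z, y⟫)`. -/
abbrev Extrap (S : C0Semigroup Y) : Type _ := S.AdjDom →L⋆[ℂ] ℂ

theorem adj_mem_graph (S : C0Semigroup Y) (t : ℝ≥0) (z : S.AdjDom) :
    (S.adj t z.1.1, S.adj t z.1.2) ∈ S.generator†.graph := by
  have hd := S.dense_generator_domain
  obtain ⟨⟨z₁, z₂⟩, hz⟩ := z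
  dsimp only
  rw [LinearPMap.adjoint_graph_eq_graph_adjoint hd, Submodule.mem_adjoint_iff] at hz ⊢
  intro a b hab
  rw [LinearPMap.mem_graph_iff] at hab
  obtain ⟨w, rfl, rfl⟩ := hab
  have hw := (S.hasGen_generator w).map t
  have hmem : (S t w, S t (S.generator w)) ∈ S.generator.graph := by
    rw [LinearPMap.mem_graph_iff]
    exact ⟨⟨S t w, _, hw⟩, rfl, (S.hasGen_generator ⟨S t w, _, hw⟩).unique hw⟩
  have := hz _ _ hmem
  simpa [adj, ContinuousLinearMap.adjoint_inner_right] using this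

/-- The operator `e^{A* t}` on `D(A*)`. -/
def adjEvolve (S : C0Semigroup Y) (t : ℝ≥0) (z : S.AdjDom) : S.AdjDom :=
  ⟨(S.adj t z.1.1, S.adj t z.1.2), S.adj_mem_graph t z⟩

end Adjoint

end

end C0Semigroup

section FractionalPowers

variable {Y : Type*} [NormedAddCommGroup Y] [NormedSpace ℂ Y]

/-- For an exponentially stable semigroup `T` with generator `C` and `α > 0`, this is the bounded
injective operator `(-C)^{-α} = Γ(α)⁻¹ ∫₀^∞ t^{α-1} T(t) dt`. -/
noncomputable def negFracPow (T : ℝ≥0 → Y →L[ℂ] Y) (α : ℝ) (x : Y) : Y :=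
  (Real.Gamma α)⁻¹ • ∫ t in Ioi (0 : ℝ), t ^ (α - 1) • T t.toNNReal x

/-- The domain `D((-C)^α)` of the fractional power `(-C)^α = ((-C)^{-α})⁻¹`, that is, the range of
`(-C)^{-α}`. -/
def fracDomain (T : ℝ≥0 → Y →L[ℂ] Y) (α : ℝ) : Set Y := range (negFracPow T α)

end FractionalPowers

noncomputable section ControlProblem

variable {Y U Z : Type*}
  [NormedAddCommGroup Y] [InnerProductSpace ℂ Y] [CompleteSpace Y]
  [NormedAddCommGroup U] [InnerProductSpace ℂ U] [CompleteSpace U]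
  [NormedAddCommGroup Z] [InnerProductSpace ℂ Z] [CompleteSpace Z]

/-- The adjoint `B* : D(A*) → U` of a bounded operator `B : U → [D(A*)]'`. -/
def ctrlAdj (S : C0Semigroup Y) (B : U →L[ℂ] S.Extrap) (z : S.AdjDom) : U :=
  (InnerProductSpace.toDual ℂ U).symm (B.flip z)

/-- The defining property of `B*`: the pairing of `z` with `B u` is `⟪B* z, u⟫`. -/
theorem inner_ctrlAdj (S : C0Semigroup Y) (B : U →L[ℂ] S.Extrap) (z : S.AdjDom) (u : U) :
    inner ℂ (ctrlAdj S B z) u = B u z := by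
  simp [ctrlAdj]

/-- Lebesgue measure on `(0, ∞)`. -/
abbrev halfLine : Measure ℝ := volume.restrict (Ioi 0)

/-- Lebesgue measure on `(0, T)`. -/
abbrev onInterval (T : ℝ) : Measure ℝ := volume.restrict (Ioo 0 T)

/-- The vector `y ∈ Y` is the state at time `t` of `y' = A y + B u`, `y(0) = x`. The mild solution
`e^{A t} x + ∫₀ᵗ e^{A (t - s)} B u(s) ds` takes its values in `[D(A*)]'`; the identity is tested
against all `z ∈ D(A*)`, the operator `e^{A t}` on `[D(A*)]'` being the dual of `e^{A* t}`. -/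
def IsStateAt (S : C0Semigroup Y) (B : U →L[ℂ] S.Extrap) (x : Y) (u : Lp U 2 halfLine)
    (t : ℝ≥0) (y : Y) : Prop :=
  ∀ z : S.AdjDom, inner ℂ z.toY y =
    inner ℂ z.toY (S t x) + ∫ s in (0 : ℝ)..t, B (u s) (S.adjEvolve (t - s).toNNReal z)

/-- `y` is the trajectory of the control `u` with initial state `x`. -/
def IsTrajectory (S : C0Semigroup Y) (B : U →L[ℂ] S.Extrap) (x : Y) (u : Lp U 2 halfLine)
    (y : ℝ → Y) : Prop :=
  ∀ᵐ t ∂halfLine, IsStateAt S B x u t.toNNReal (y t)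

/-- The cost functional `∫₀^∞ (‖R y(t)‖² + ‖u(t)‖²) dt`. -/
def cost (R : Y →L[ℂ] Z) (u : Lp U 2 halfLine) (y : ℝ → Y) : ℝ≥0∞ :=
  ∫⁻ t, (‖R (y t)‖ₑ ^ 2 + ‖u t‖ₑ ^ 2) ∂halfLine

/-- `u` minimizes the cost functional over `L²(0, ∞; U)` for the initial state `x`. -/
def IsOptimalControl (S : C0Semigroup Y) (B : U →L[ℂ] S.Extrap) (R : Y →L[ℂ] Z) (x : Y)
    (u : Lp U 2 halfLine) : Prop :=
  ∃ y, IsTrajectory S B x u y ∧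
    ∀ v z, IsTrajectory S B x v z → cost R u y ≤ cost R v z

/-- `Φ` is the optimal state semigroup: `Φ(t) x` is, at every time `t ≥ 0`, the state
that corresponds to the initial state `x` and to the optimal control for `x`. -/
def IsOptimalStateSemigroup (S : C0Semigroup Y) (B : U →L[ℂ] S.Extrap) (R : Y →L[ℂ] Z)
    (Φ : C0Semigroup Y) : Prop :=
  ∀ x, ∃ u, IsOptimalControl S B R x u ∧ ∀ t, IsStateAt S B x u t (Φ t x)

/-- The standing assumptions on the decomposition `B* e^{A* t} = F(t) + G(t)` on `D(A*)`, `t > 0`,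
and on the observation operator `R`. A statement that an operator which is defined on a subspace of
`Y` "belongs to `ℒ(Y, X)`" means that it has an extension `K ∈ ℒ(Y, X)`. -/
structure DecompositionHypotheses (S : C0Semigroup Y) (B : U →L[ℂ] S.Extrap) (R : Y →L[ℂ] Z)
    (F : ℝ → Y →L[ℂ] U) (G : ℝ → S.AdjDom →L[ℂ] U) (γ ε : ℝ) : Prop where
  decomposition : ∀ t : ℝ, 0 < t → ∀ z : S.AdjDom,
    ctrlAdj S B (S.adjEvolve t.toNNReal z) = F t z.toY + G t z
  gamma_mem : γ ∈ Ioo (0 : ℝ) 1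
  singular_estimate : ∃ η N : ℝ, 0 < η ∧ 0 < N ∧
    ∀ t : ℝ, 0 < t → ‖F t‖ ≤ N * t ^ (-γ) * Real.exp (-η * t)
  /-- `G(·) ∈ ℒ(Y, L^p(0, T; U))` for all finite `p ≥ 1`. -/
  integrability : ∃ T : ℝ, 0 < T ∧ ∀ (p : ℝ≥0∞) [Fact (1 ≤ p)], p ≠ ∞ →
    ∃ K : Y →L[ℂ] Lp U p (onInterval T), ∀ z : S.AdjDom,
      K z.toY =ᵐ[onInterval T] fun t => G t z
  eps_pos : 0 < ε
  /-- `A*^ε R* R A^{-ε} ∈ ℒ(Y)`. -/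
  observation : ∃ c : ℝ, ∀ x : Y, ∃ w : Y, ‖w‖ ≤ c * ‖x‖ ∧
    negFracPow S.adj ε w = ContinuousLinearMap.adjoint R (R (negFracPow S ε x))
  /-- `G(·) A*^{-ε} ∈ ℒ(Y, C([0, T]; U))`, and `B* e^{A* ·} A*^ε`, which is defined on
  `D(A*^{1+ε}) = {A*^{-ε} z : z ∈ D(A*)}`, extends to an element of `ℒ(Y, L^q(0, T; U))`. -/
  regularity : ∃ T : ℝ, 0 < T ∧
    (∃ K : Y →L[ℂ] C(Icc (0 : ℝ) T, U), ∀ (x : Y) (z : S.AdjDom),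
      z.toY = negFracPow S.adj ε x → ∀ t : Icc (0 : ℝ) T, 0 < (t : ℝ) → K x t = G t z) ∧
    (∃ (q : ℝ≥0∞) (_ : Fact (1 ≤ q)), 1 < q ∧ q < 2 ∧
      ∃ K : Y →L[ℂ] Lp U q (onInterval T), ∀ z : S.AdjDom,
        K (negFracPow S.adj ε z.toY) =ᵐ[onInterval T]
          fun t => ctrlAdj S B (S.adjEvolve t.toNNReal z))

end ControlProblem

/-!
The control enters the state through the kernel `B* e^{A* t}`: the state at time `t` is `e^{At} x`
plus the convolution of the control with the adjoint of this kernel, tested against `z ∈ D(A*)`.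
Call `L` the resulting input-to-state map on `L²(0, ∞)` and `E x` the free evolution `e^{A ·} x`.

*Splitting.* Near `t = 0` the kernel `F` is dominated by `t ^ (-γ)`, which is integrable, so its
restriction to `(0, δ)` gives a convolution operator of small norm on every `L^p`. What remains of
the kernel is `G` on `(0, δ)`, and the full kernel after that; it belongs strongly to every `L^q`,
with an exponential weight, because `e^{A* t}` propagates a bound on one block of time to all
later blocks. It therefore maps `L^p` to `L^p ∩ L^∞`. This is the property `SplitsSmall`, proved
in `DecompositionHypotheses.exists_split`.

*Optimal control.* Completing the square shows that the only minimizer is `û = K (-R* R E x)`,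
where `f = K v` is the solution of `f + L* R* R L f = L* v` (`isOptimalControl_iff`). By the
splitting, the small part of `L` can be absorbed and the other part improves integrability, so `K`
maps `L² ∩ L^P` to `L^P` (`SplitsSmall.exists_bound`, `SplitsSmall.exists_feedback`). Here `P ≥ 2`
is chosen such that the conjugate exponent `r` satisfies `γ r < 1` and `r ≤ q`. In particular `û`
belongs to `L^P`.

*Semigroup.* As `γ r < 1`, the kernel belongs strongly to `L^r`, and by the inequality of Hölder a
control in `L^P` has a state in `Y` at every time. The Euler equation, tested with delayed
functions, yields the principle of Bellman and hence the semigroup law of the optimal states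
(`PointwiseConvBound.advance_eq_feedback`, `PointwiseConvBound.exists_optimalSemigroup`).

*Domain of the generator.* As `r ≤ q`, the norm of `B* e^{A* ·} z` in `L^r` is also dominated by
`‖A*^{-ε} z‖`, so the pairing of `z` with `Φ(t) x - e^{At} x` has this bound, uniformly in `t`.
The same then holds for the difference of the resolvents of `A_P` and `A`, and duality places that
difference in `D(A^ε)` (`domain_subset_fracDomain`).

*Domain of the adjoint.* One has to dominate the pairing of a vector `v` with the difference of
the resolvents applied to `w` by `‖A^{-ε} w‖`. With `ψ(t) = e^{-t} v`, this is `⟪ψ, L û⟫` for the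
initial state `w`. For `f = K ψ`, the Euler equation turns it into `-⟪L f, R* R E w⟫`. As `f`
belongs to `L^P`, the values of `L f` are bounded in `D(A^ε)`, and `‖A*^{-ε} R* R x‖ ≤ c ‖A^{-ε}
x‖` gives the claim (`norm_integral_inner_le`, `adjoint_domain_subset_fracDomain`).
-/


/-! ### Semigroups, resolvents and adjoint semigroups -/

namespace C0Semigroup

section Banach

variable {Y : Type*} [NormedAddCommGroup Y] [NormedSpace ℂ Y]

theorem add_apply (S : C0Semigroup Y) (s t : ℝ≥0) (x : Y) : S (s + t) x = S s (S t x) := by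
  rw [S.map_add, ContinuousLinearMap.comp_apply]

theorem comm_apply (S : C0Semigroup Y) (s t : ℝ≥0) (x : Y) : S s (S t x) = S t (S s x) := by
  rw [← S.add_apply, add_comm, S.add_apply]

theorem zero_apply (S : C0Semigroup Y) (x : Y) : S 0 x = x := by
  rw [S.map_zero, ContinuousLinearMap.id_apply]

theorem continuous_orbit (S : C0Semigroup Y) (x : Y) :
    Continuous fun s : ℝ => S s.toNNReal x :=
  (S.cont x).comp continuous_real_toNNReal

/-- The rescaled semigroup `e^{-l t} S(t)`, whose generator is `A - l`. -/
noncomputable def rescale (S : C0Semigroup Y) (l : ℝ) : C0Semigroup Y where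
  toFun t := (Real.exp (-l * t) : ℂ) • S t
  map_zero := by simp [S.map_zero]
  map_add s t := by
    ext x
    simp only [_root_.smul_apply, ContinuousLinearMap.comp_apply, S.add_apply,
      map_smul, smul_smul]
    congr 1
    rw [← Complex.ofReal_mul, ← Real.exp_add]
    congr 2
    push_cast
    ring
  cont x := by
    simp only [_root_.smul_apply]
    have := S.cont x
    fun_prop

theorem rescale_apply (S : C0Semigroup Y) (l : ℝ) (t : ℝ≥0) (x : Y) :
    S.rescale l t x = Real.exp (-l * t) • S t x := by
  rw [← Complex.coe_smul]
  rfl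

theorem rescale_rescale_neg (S : C0Semigroup Y) (l : ℝ) : (S.rescale l).rescale (-l) = S := by
  have : ((S.rescale l).rescale (-l)).toFun = S.toFun := by
    ext t y
    rw [rescale_apply, rescale_apply, smul_smul, ← Real.exp_add]
    simp
  cases S
  simp only [rescale] at this ⊢
  congr

theorem rescale_expStable {S : C0Semigroup Y} {C l : ℝ} (hl : 0 < l) (hS : ∀ t, ‖S t‖ ≤ C) :
    (S.rescale l).ExpStable := by
  refine ⟨max 1 C, l, le_max_left _ _, hl, fun t => ?_⟩
  change ‖(Real.exp (-l * t) : ℂ) • S t‖ ≤ _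
  rw [norm_smul, Complex.norm_real, Real.norm_of_nonneg (Real.exp_nonneg _), mul_comm]
  gcongr
  exact (hS t).trans (le_max_right _ _)

theorem HasGen.rescale {S : C0Semigroup Y} {x y : Y} (h : S.HasGen x y) (l : ℝ) :
    (S.rescale l).HasGen x (y - l • x) := by
  have hcoe : Tendsto (fun t : ℝ≥0 => (t : ℝ)) (𝓝[>] 0) (𝓝[≠] 0) := by
    refine tendsto_nhdsWithin_iff.2 ⟨?_, ?_⟩
    · exact (NNReal.continuous_coe.tendsto 0).mono_left nhdsWithin_le_nhds
    · filter_upwards [self_mem_nhdsWithin] with t ht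
      have : (0 : ℝ≥0) < t := ht
      simpa using this.ne'
  have hd : HasDerivAt (fun t : ℝ => Real.exp (-l * t)) (-l) 0 := by
    have h0 : HasDerivAt (fun t : ℝ => -l * t) (-l) 0 := by
      simpa using (hasDerivAt_id (0 : ℝ)).const_mul (-l)
    simpa using h0.exp
  have h1 := ((hasDerivAt_iff_tendsto_slope_zero.1 hd).comp hcoe).smul_const x
  have h2 : Tendsto (fun t : ℝ≥0 => Real.exp (-l * t)) (𝓝[>] 0) (𝓝 1) := by
    have : Continuous fun t : ℝ≥0 => Real.exp (-l * t) := by fun_prop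
    simpa using (this.tendsto 0).mono_left (nhdsWithin_le_nhds (s := Ioi 0))
  have h3 := (h2.smul h).add h1
  rw [one_smul, neg_smul, ← sub_eq_add_neg] at h3
  refine h3.congr fun t => ?_
  simp only [Function.comp_apply, zero_add, mul_zero, Real.exp_zero, rescale_apply, smul_eq_mul,
    mul_smul, sub_smul, one_smul, smul_sub]
  rw [smul_comm (Real.exp _), smul_comm (Real.exp _)]
  abel

/-- A weighted average `∫₀^∞ w(s) S(s) x ds` converges as soon as the weight is integrable against
the exponential that bounds the semigroup. -/
theorem integrableOn_smul_orbit (S : C0Semigroup Y) {M ω : ℝ}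
    (hM : ∀ t : ℝ≥0, ‖S t‖ ≤ M * Real.exp (-ω * t)) {w : ℝ → ℝ}
    (hwm : AEStronglyMeasurable w (volume.restrict (Ioi 0)))
    (hw : IntegrableOn (fun s => |w s| * Real.exp (-ω * s)) (Ioi 0)) (x : Y) :
    IntegrableOn (fun s : ℝ => w s • S s.toNNReal x) (Ioi 0) ∧
      ‖∫ s in Ioi (0 : ℝ), w s • S s.toNNReal x‖ ≤
        (∫ s in Ioi (0 : ℝ), |w s| * Real.exp (-ω * s)) * M * ‖x‖ := by
  have hb : ∀ᵐ s : ℝ ∂(volume.restrict (Ioi 0)), ‖w s • S s.toNNReal x‖ ≤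
      (|w s| * Real.exp (-ω * s)) * M * ‖x‖ := by
    filter_upwards [ae_restrict_mem measurableSet_Ioi] with s hs
    rw [norm_smul, Real.norm_eq_abs]
    have h1 := (S s.toNNReal).le_opNorm x
    have h2 := hM s.toNNReal
    rw [Real.coe_toNNReal _ (le_of_lt hs)] at h2
    calc |w s| * ‖S s.toNNReal x‖ ≤ |w s| * (M * Real.exp (-ω * s) * ‖x‖) := by
          gcongr
          exact h1.trans (by gcongr)
      _ = _ := by ring
  have hi := (hw.mul_const M).mul_const ‖x‖
  constructor
  · exact hi.mono' (hwm.smul (S.continuous_orbit x).aestronglyMeasurable) hb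
  · refine (norm_integral_le_of_norm_le hi hb).trans_eq ?_
    rw [integral_mul_const, integral_mul_const]

theorem exists_average [CompleteSpace Y] (S : C0Semigroup Y) {M ω : ℝ}
    (hM : ∀ t : ℝ≥0, ‖S t‖ ≤ M * Real.exp (-ω * t)) {w : ℝ → ℝ}
    (hwm : AEStronglyMeasurable w (volume.restrict (Ioi 0)))
    (hw : IntegrableOn (fun s => |w s| * Real.exp (-ω * s)) (Ioi 0)) :
    ∃ K : Y →L[ℂ] Y, ∀ x, K x = ∫ s in Ioi (0 : ℝ), w s • S s.toNNReal x := by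
  refine ⟨LinearMap.mkContinuous
    { toFun := fun x => ∫ s in Ioi (0 : ℝ), w s • S s.toNNReal x
      map_add' := fun x y => ?_
      map_smul' := fun c x => ?_ } _
    fun x => (S.integrableOn_smul_orbit hM hwm hw x).2, fun x => rfl⟩
  · simp only [_root_.map_add, smul_add]
    exact integral_add (S.integrableOn_smul_orbit hM hwm hw x).1
      (S.integrableOn_smul_orbit hM hwm hw y).1
  · simp only [map_smul, RingHom.id_apply]
    rw [← integral_smul]
    exact integral_congr_ae (ae_of_all _ fun s => smul_comm _ _ _)

theorem ExpStable.exists_bound {S : C0Semigroup Y} (hS : S.ExpStable) : ∃ M, ∀ t, ‖S t‖ ≤ M := by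
  obtain ⟨M, ω, hM1, hω, hM⟩ := hS
  refine ⟨M, fun t => (hM t).trans ?_⟩
  have : Real.exp (-ω * t) ≤ 1 := Real.exp_le_one_iff.2 (by
    have : (0 : ℝ) ≤ t := t.2
    nlinarith)
  nlinarith

theorem integrableOn_exp_weight {ω : ℝ} (hω : 0 < ω) :
    IntegrableOn (fun s : ℝ => |(1 : ℝ)| * Real.exp (-ω * s)) (Ioi 0) := by
  simpa using exp_neg_integrableOn_Ioi 0 hω

theorem exists_potential [CompleteSpace Y] (S : C0Semigroup Y) (hS : S.ExpStable) :
    ∃ V : Y →L[ℂ] Y, ∀ x, V x = ∫ s in Ioi (0 : ℝ), S s.toNNReal x := by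
  obtain ⟨M, ω, -, hω, hM⟩ := hS
  obtain ⟨V, hV⟩ := S.exists_average hM (w := fun _ => 1) aestronglyMeasurable_const
    (integrableOn_exp_weight hω)
  exact ⟨V, fun x => by simp [hV]⟩

/-- The potential operator `∫₀^∞ S(s) ds = (-A)⁻¹` of an exponentially stable semigroup. -/
noncomputable def potential [CompleteSpace Y] (S : C0Semigroup Y) (hS : S.ExpStable) :
    Y →L[ℂ] Y :=
  (S.exists_potential hS).choose

theorem potential_apply [CompleteSpace Y] (S : C0Semigroup Y) (hS : S.ExpStable) (x : Y) :
    S.potential hS x = ∫ s in Ioi (0 : ℝ), S s.toNNReal x :=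
  (S.exists_potential hS).choose_spec x

theorem integrableOn_orbit (S : C0Semigroup Y) (hS : S.ExpStable) (x : Y) :
    IntegrableOn (fun s : ℝ => S s.toNNReal x) (Ioi 0) := by
  obtain ⟨M, ω, -, hω, hM⟩ := hS
  simpa using (S.integrableOn_smul_orbit hM (w := fun _ => 1) aestronglyMeasurable_const
    (integrableOn_exp_weight hω) x).1

variable [CompleteSpace Y]

theorem potential_comm (S : C0Semigroup Y) (hS : S.ExpStable) (t : ℝ≥0) (x : Y) :
    S t (S.potential hS x) = S.potential hS (S t x) := by
  rw [potential_apply, potential_apply,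
    ← ContinuousLinearMap.integral_comp_comm _ (S.integrableOn_orbit hS x)]
  exact integral_congr_ae (ae_of_all _ fun s => S.comm_apply _ _ _)

/-- Differentiating this identity at `t = 0` identifies the generator on the range of the potential
operator. -/
theorem potential_map_sub (S : C0Semigroup Y) (hS : S.ExpStable) (t : ℝ≥0) (x : Y) :
    S.potential hS (S t x) - S.potential hS x = -∫ s in (0 : ℝ)..t, S s.toNNReal x := by
  have h1 : S.potential hS (S t x) = ∫ s in Ioi (t : ℝ), S s.toNNReal x := by
    rw [potential_apply]
    have := (measurePreserving_add_right volume (t : ℝ)).setIntegral_preimage_emb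
      (measurableEmbedding_addRight (t : ℝ)) (fun s => S s.toNNReal x) (Ioi (t : ℝ))
    rw [← this]
    rw [preimage_add_const_Ioi, sub_self]
    refine setIntegral_congr_fun measurableSet_Ioi fun s hs => ?_
    rw [← S.add_apply, Real.toNNReal_add (le_of_lt hs) (NNReal.coe_nonneg t), Real.toNNReal_coe]
  have hi := S.integrableOn_orbit hS x
  have h0 : (0 : ℝ) ≤ t := NNReal.coe_nonneg t
  rw [h1, potential_apply, intervalIntegral.integral_of_le h0, ← Ioc_union_Ioi_eq_Ioi h0,
    setIntegral_union (Ioc_disjoint_Ioi le_rfl) measurableSet_Ioi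
      (hi.mono_set Ioc_subset_Ioi_self) (hi.mono_set (Ioi_subset_Ioi h0))]
  abel

theorem tendsto_average (S : C0Semigroup Y) (x : Y) :
    Tendsto (fun t : ℝ≥0 => (t : ℝ)⁻¹ • ∫ s in (0 : ℝ)..t, S s.toNNReal x) (𝓝[>] 0) (𝓝 x) := by
  have hfc := S.continuous_orbit x
  have hder : HasDerivAt (fun b : ℝ => ∫ s in (0 : ℝ)..b, S s.toNNReal x)
      (S (0 : ℝ).toNNReal x) 0 :=
    intervalIntegral.integral_hasDerivAt_right (hfc.intervalIntegrable _ _)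
      hfc.stronglyMeasurable.stronglyMeasurableAtFilter hfc.continuousAt
  have h1 := hasDerivAt_iff_tendsto_slope_zero.1 hder
  simp only [zero_add, intervalIntegral.integral_same, sub_zero, Real.toNNReal_zero,
    S.zero_apply] at h1
  refine h1.comp (tendsto_nhdsWithin_iff.2 ⟨?_, ?_⟩)
  · exact (NNReal.continuous_coe.tendsto 0).mono_left nhdsWithin_le_nhds
  · filter_upwards [self_mem_nhdsWithin] with t ht
    have : (0 : ℝ≥0) < t := ht
    simpa using this.ne'

theorem hasGen_potential (S : C0Semigroup Y) (hS : S.ExpStable) (x : Y) :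
    S.HasGen (S.potential hS x) (-x) := by
  refine (S.tendsto_average x).neg.congr fun t => ?_
  rw [S.potential_comm hS, S.potential_map_sub hS, smul_neg]

/-- The operator `(-A)⁻¹` is a left inverse of `-A`. -/
theorem HasGen.eq_neg_potential {S : C0Semigroup Y} (hS : S.ExpStable) {x y : Y}
    (h : S.HasGen x y) : x = -S.potential hS y := by
  have h1 := ((S.potential hS).continuous.tendsto y).comp h
  have h2 := (S.tendsto_average x).neg
  have h3 : S.potential hS y = -x := by
    refine tendsto_nhds_unique (h1.congr fun t => ?_) h2
    simp only [Function.comp_apply]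
    rw [← Complex.coe_smul, map_smul, map_sub, S.potential_map_sub hS, Complex.coe_smul, smul_neg]
  rw [h3, neg_neg]

/-- The operator `(l - A)⁻¹` is a right inverse of `l - A`. -/
theorem hasGen_potential_rescale (S : C0Semigroup Y) (l : ℝ) (hl : (S.rescale l).ExpStable)
    (x : Y) : S.HasGen ((S.rescale l).potential hl x) (l • (S.rescale l).potential hl x - x) := by
  have h1 := (hasGen_potential _ hl x).rescale (-l)
  rw [S.rescale_rescale_neg l, neg_smul] at h1
  convert h1 using 1
  abel

/-- The resolvent identity relating `(l - A)⁻¹` and `(-A)⁻¹`, in the two orders of the factors. -/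
theorem potential_rescale (S : C0Semigroup Y) (hS : S.ExpStable) (l : ℝ)
    (hl : (S.rescale l).ExpStable) (x : Y) :
    (S.rescale l).potential hl x =
      S.potential hS (x - l • (S.rescale l).potential hl x) ∧
    (S.rescale l).potential hl x =
      S.potential hS x - l • (S.rescale l).potential hl (S.potential hS x) := by
  constructor
  · conv_lhs => rw [(S.hasGen_potential_rescale l hl x).eq_neg_potential hS]
    rw [← map_neg, neg_sub]
  · have h1 := ((S.hasGen_potential hS x).rescale l).eq_neg_potential hl
    have h2 : -(-x - l • S.potential hS x) = x + l • S.potential hS x := by abel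
    rw [← map_neg, h2, _root_.map_add, ← Complex.coe_smul, map_smul, Complex.coe_smul] at h1
    exact eq_sub_of_add_eq h1.symm

end Banach

section Hilbert

variable {Y : Type*} [NormedAddCommGroup Y] [InnerProductSpace ℂ Y] [CompleteSpace Y]

/-- Membership in the graph of `A*`, expressed through difference quotients. -/
theorem mem_adjDom_iff (S : C0Semigroup Y) (z w : Y) :
    (z, w) ∈ S.generator†.graph ↔ ∀ x y, S.HasGen x y → inner ℂ z y = inner ℂ w x := by
  rw [LinearPMap.adjoint_graph_eq_graph_adjoint S.dense_generator_domain, Submodule.mem_adjoint_iff]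
  constructor
  · intro h x y hxy
    have hm : (x, y) ∈ S.generator.graph := by
      rw [LinearPMap.mem_graph_iff]
      exact ⟨⟨x, y, hxy⟩, rfl, (S.hasGen_generator ⟨x, y, hxy⟩).unique hxy⟩
    have := h x y hm
    rw [sub_eq_zero] at this
    rw [← inner_conj_symm, this, inner_conj_symm]
  · intro h a b hab
    rw [LinearPMap.mem_graph_iff] at hab
    obtain ⟨v, rfl, rfl⟩ := hab
    have := h _ _ (S.hasGen_generator v)
    rw [sub_eq_zero, ← inner_conj_symm, this, inner_conj_symm]

theorem AdjDom.inner_eq {S : C0Semigroup Y} (z : S.AdjDom) {x y : Y} (h : S.HasGen x y) :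
    inner ℂ z.toY y = inner ℂ z.1.2 x :=
  (S.mem_adjDom_iff z.1.1 z.1.2).1 z.2 x y h

theorem adjoint_potential_mem (S : C0Semigroup Y) (hS : S.ExpStable) (z : Y) :
    (ContinuousLinearMap.adjoint (S.potential hS) z, -z) ∈ S.generator†.graph := by
  rw [mem_adjDom_iff]
  intro x y hxy
  rw [ContinuousLinearMap.adjoint_inner_left]
  conv_rhs => rw [hxy.eq_neg_potential hS]
  simp

/-- `D(A*)` is dense: it contains the range of the adjoint of the injective operator `(-A)⁻¹`. -/
theorem dense_adjDom (S : C0Semigroup Y) (hS : S.ExpStable) :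
    DenseRange (AdjDom.toY : S.AdjDom → Y) := by
  have h1 : (LinearMap.range (ContinuousLinearMap.adjoint (S.potential hS)).toLinearMap)ᗮ = ⊥ := by
    rw [Submodule.eq_bot_iff]
    intro x hx
    have h0 : S.potential hS x = 0 := by
      refine ext_inner_left ℂ fun z => ?_
      rw [inner_zero_right, ← ContinuousLinearMap.adjoint_inner_left]
      exact hx _ ⟨z, rfl⟩
    have h2 := S.hasGen_potential hS x
    rw [h0] at h2
    have h3 : S.HasGen 0 0 := by simp [HasGen]
    simpa using h2.unique h3
  have h2 := (Submodule.dense_iff_topologicalClosure_eq_top).2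
    (Submodule.topologicalClosure_eq_top_iff.2 h1)
  refine h2.mono ?_
  rintro _ ⟨z, rfl⟩
  exact ⟨⟨_, S.adjoint_potential_mem hS z⟩, rfl⟩

theorem norm_adj (S : C0Semigroup Y) (t : ℝ≥0) : ‖S.adj t‖ = ‖S t‖ :=
  LinearIsometryEquiv.norm_map ContinuousLinearMap.adjoint (S t)

/-- On `D(A*)` the adjoint semigroup is continuous in norm at `0`, since `⟪e^{A* t} z - z, x⟫` is
the pairing of `A* z` with `∫₀ᵗ S(s) x ds`. -/
theorem adj_sub_bound (S : C0Semigroup Y) {M : ℝ} (hM : ∀ t, ‖S t‖ ≤ M) (z : S.AdjDom) (t : ℝ≥0) :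
    ‖S.adj t z.toY - z.toY‖ ≤ M * t * ‖z.1.2‖ := by
  have hM0 : 0 ≤ M := (norm_nonneg _).trans (hM 0)
  refine ContinuousLinearMap.opNorm_le_bound (innerSL ℂ _) (by positivity) (fun x => ?_) |>.trans'
    (innerSL_apply_norm ℂ _).ge
  rw [innerSL_apply_apply, inner_sub_left, adj, ContinuousLinearMap.adjoint_inner_left,
    ← inner_sub_right, z.inner_eq (S.hasGen_integral x t)]
  refine (norm_inner_le_norm _ _).trans ?_
  have h1 : ‖∫ s in (0 : ℝ)..t, S s.toNNReal x‖ ≤ M * ‖x‖ * |(t : ℝ) - 0| :=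
    intervalIntegral.norm_integral_le_of_norm_le_const fun s _ =>
      ((S _).le_opNorm x).trans (by gcongr; exact hM _)
  rw [sub_zero, abs_of_nonneg (NNReal.coe_nonneg t)] at h1
  calc ‖z.1.2‖ * ‖∫ s in (0 : ℝ)..t, S s.toNNReal x‖ ≤ ‖z.1.2‖ * (M * ‖x‖ * t) := by
        gcongr
    _ = _ := by ring

/-- A bounded one-parameter semigroup that is strongly right-continuous at `0` on a dense subset is
strongly continuous. -/
theorem continuous_of_tendsto_zero {X : Type*} [NormedAddCommGroup X] [NormedSpace ℂ X]
    {T : ℝ≥0 → X →L[ℂ] X} {M : ℝ} (hM : ∀ t, ‖T t‖ ≤ M) (hadd : ∀ s t x, T (s + t) x = T s (T t x))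
    {D : Set X} (hD : Dense D) (h0 : ∀ x ∈ D, Tendsto (fun t => ‖T t x - x‖) (𝓝 0) (𝓝 0)) (x : X) :
    Continuous fun t => T t x := by
  have hM0 : 0 ≤ M := (norm_nonneg _).trans (hM 0)
  have h1 : Tendsto (fun t => ‖T t x - x‖) (𝓝 0) (𝓝 0) := by
    rw [Metric.tendsto_nhds]
    intro e he
    obtain ⟨y, hyD, hy⟩ := hD.exists_dist_lt x (ε := e / (2 * (M + 1))) (by positivity)
    filter_upwards [Metric.tendsto_nhds.1 (h0 y hyD) (e / 2) (by positivity)] with t ht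
    rw [Real.dist_0_eq_abs, abs_norm] at ht ⊢
    rw [dist_eq_norm] at hy
    have e1 : T t x - x = T t (x - y) + (T t y - y) - (x - y) := by
      rw [map_sub]; abel
    have e2 : ‖T t (x - y)‖ ≤ M * ‖x - y‖ := ((T t).le_opNorm _).trans (by gcongr; exact hM t)
    have e3 : ‖T t x - x‖ ≤ ‖T t (x - y)‖ + ‖T t y - y‖ + ‖x - y‖ := by
      rw [e1]
      exact (norm_sub_le _ _).trans (by gcongr; exact norm_add_le _ _)
    have e4 : (M + 1) * ‖x - y‖ < e / 2 := by
      rw [lt_div_iff₀ (by positivity)] at hy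
      linarith
    linarith
  refine continuous_iff_continuousAt.2 fun t => ?_
  rw [ContinuousAt, tendsto_iff_norm_sub_tendsto_zero]
  have h2 : Tendsto (fun s : ℝ≥0 => M * ‖T ((s - t) + (t - s)) x - x‖) (𝓝 t) (𝓝 0) := by
    have hc : Continuous fun s : ℝ≥0 => (s - t) + (t - s) := by fun_prop
    have := (h1.comp (by simpa using hc.tendsto t)).const_mul M
    simpa using this
  refine squeeze_zero (fun s => norm_nonneg _) (fun s => ?_) h2
  rcases le_total s t with h | h
  · rw [tsub_eq_zero_of_le h, zero_add, norm_sub_rev]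
    have : T t x = T s (T (t - s) x) := by rw [← hadd, add_tsub_cancel_of_le h]
    rw [this, ← map_sub]
    exact ((T s).le_opNorm _).trans (by gcongr; exact hM s)
  · rw [tsub_eq_zero_of_le h, add_zero]
    have : T s x = T t (T (s - t) x) := by rw [← hadd, add_tsub_cancel_of_le h]
    rw [this, ← map_sub]
    exact ((T t).le_opNorm _).trans (by gcongr; exact hM t)

theorem adj_add_apply (S : C0Semigroup Y) (s t : ℝ≥0) (x : Y) :
    S.adj (s + t) x = S.adj s (S.adj t x) := by
  rw [add_comm]
  simp only [adj]
  rw [S.map_add, ContinuousLinearMap.adjoint_comp, ContinuousLinearMap.comp_apply]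

/-- The adjoint semigroup, as a `C₀`-semigroup. -/
noncomputable def adjSemigroup (S : C0Semigroup Y) (hS : S.ExpStable) : C0Semigroup Y where
  toFun := S.adj
  map_zero := by rw [adj, S.map_zero, ContinuousLinearMap.adjoint_id]
  map_add s t := by
    ext x
    exact S.adj_add_apply s t x
  cont x := by
    obtain ⟨M, hM⟩ := hS.exists_bound
    refine continuous_of_tendsto_zero (M := M) (fun t => (S.norm_adj t).trans_le (hM t))
      (S.adj_add_apply) (S.dense_adjDom hS) ?_ x
    rintro _ ⟨z, rfl⟩
    have h2 : Tendsto (fun t : ℝ≥0 => M * t * ‖z.1.2‖) (𝓝 0) (𝓝 0) := by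
      have : Continuous fun t : ℝ≥0 => M * t * ‖z.1.2‖ := by fun_prop
      simpa using this.tendsto 0
    exact squeeze_zero (fun _ => norm_nonneg _) (fun t => S.adj_sub_bound hM z t) h2

theorem adjSemigroup_expStable (S : C0Semigroup Y) (hS : S.ExpStable) :
    (S.adjSemigroup hS).ExpStable := by
  obtain ⟨M, ω, hM1, hω, hM⟩ := hS
  exact ⟨M, ω, hM1, hω, fun t => (S.norm_adj t).trans_le (hM t)⟩

end Hilbert

end C0Semigroup

/-! ### Fractional powers and duality -/

/-- A linear functional that is dominated by the norm of a linear image factors through that image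
and is represented there by a vector. -/
theorem exists_inner_eq_of_norm_le {X Y : Type*} [AddCommGroup X] [Module ℂ X]
    [NormedAddCommGroup Y] [InnerProductSpace ℂ Y] [CompleteSpace Y] (e : X →ₗ[ℂ] Y)
    (φ : X →ₗ[ℂ] ℂ) {c : ℝ} (hc : 0 ≤ c) (h : ∀ z, ‖φ z‖ ≤ c * ‖e z‖) :
    ∃ w, ‖w‖ ≤ c ∧ ∀ z, inner ℂ w (e z) = φ z := by
  obtain ⟨g, hg⟩ := e.rangeRestrict.exists_rightInverse_of_surjective
    (LinearMap.range_eq_top.2 e.surjective_rangeRestrict)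
  have hg' (r : LinearMap.range e) : e (g r) = r :=
    congrArg Subtype.val (LinearMap.congr_fun hg r)
  let f : StrongDual ℂ (LinearMap.range e) :=
    LinearMap.mkContinuous (φ ∘ₗ g) c fun r => by
      have := h (g r)
      rwa [hg'] at this
  have hf : ‖f‖ ≤ c := LinearMap.mkContinuous_norm_le _ hc _
  obtain ⟨F, hF, hFn⟩ := exists_extension_norm_eq _ f
  refine ⟨(InnerProductSpace.toDual ℂ Y).symm F, ?_, fun z => ?_⟩
  · rw [LinearIsometryEquiv.norm_map, hFn]
    exact hf
  · rw [InnerProductSpace.toDual_symm_apply]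
    refine (hF ⟨e z, z, rfl⟩).trans ?_
    change φ (g _) = φ z
    rw [← sub_eq_zero, ← map_sub, ← norm_eq_zero]
    refine le_antisymm ((h _).trans ?_) (norm_nonneg _)
    rw [map_sub, hg']
    simp

/-- The range of `K` consists of the vectors `y` for which `⟪z, y⟫` is dominated by `‖K* z‖`. -/
theorem ContinuousLinearMap.exists_preimage_of_inner_le {Y : Type*} [NormedAddCommGroup Y]
    [InnerProductSpace ℂ Y] [CompleteSpace Y] (K : Y →L[ℂ] Y) {y : Y} {c : ℝ} (hc : 0 ≤ c)
    (h : ∀ z, ‖inner ℂ z y‖ ≤ c * ‖ContinuousLinearMap.adjoint K z‖) :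
    ∃ w, K w = y ∧ ‖w‖ ≤ c := by
  obtain ⟨w, hw, hwe⟩ := exists_inner_eq_of_norm_le
    (ContinuousLinearMap.adjoint K).toLinearMap (innerSL ℂ y).toLinearMap hc fun z => by
      simpa [norm_inner_symm] using h z
  refine ⟨w, ext_inner_right ℂ fun z => ?_, hw⟩
  rw [← ContinuousLinearMap.adjoint_inner_right]
  exact hwe z

namespace C0Semigroup

section Banach

variable {Y : Type*} [NormedAddCommGroup Y] [NormedSpace ℂ Y]

theorem integrableOn_rpow_weight {α ω : ℝ} (hα : 0 < α) (hω : 0 < ω) :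
    IntegrableOn (fun s : ℝ => |s ^ (α - 1)| * Real.exp (-ω * s)) (Ioi 0) := by
  have := integrableOn_rpow_mul_exp_neg_mul_rpow (s := α - 1) (p := 1) (by linarith) one_pos hω
  refine this.congr_fun (fun s hs => ?_) measurableSet_Ioi
  simp only [Real.rpow_one]
  rw [abs_of_nonneg (Real.rpow_nonneg (le_of_lt hs) _)]

theorem aestronglyMeasurable_rpow (α : ℝ) (μ : Measure ℝ) :
    AEStronglyMeasurable (fun s : ℝ => s ^ α) μ :=
  (measurable_id.pow_const α).aestronglyMeasurable

theorem integrableOn_rpow_smul_orbit (S : C0Semigroup Y) (hS : S.ExpStable) {α : ℝ} (hα : 0 < α)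
    (x : Y) : IntegrableOn (fun s : ℝ => s ^ (α - 1) • S s.toNNReal x) (Ioi 0) := by
  obtain ⟨M, ω, -, hω, hM⟩ := hS
  exact (S.integrableOn_smul_orbit hM (aestronglyMeasurable_rpow _ _)
    (integrableOn_rpow_weight hα hω) x).1

variable [CompleteSpace Y]

theorem exists_fracPow (S : C0Semigroup Y) (hS : S.ExpStable) {α : ℝ} (hα : 0 < α) :
    ∃ K : Y →L[ℂ] Y, ∀ x, K x = negFracPow S α x := by
  obtain ⟨M, ω, -, hω, hM⟩ := hS
  obtain ⟨K, hK⟩ := S.exists_average hM (aestronglyMeasurable_rpow (α - 1) _)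
    (integrableOn_rpow_weight hα hω)
  refine ⟨(((Real.Gamma α)⁻¹ : ℝ) : ℂ) • K, fun x => ?_⟩
  rw [_root_.smul_apply, hK, Complex.coe_smul]
  rfl

/-- The fractional power `(-A)^{-α}`, as a bounded operator. -/
noncomputable def fracPow (S : C0Semigroup Y) (hS : S.ExpStable) {α : ℝ} (hα : 0 < α) :
    Y →L[ℂ] Y :=
  (S.exists_fracPow hS hα).choose

theorem fracPow_apply (S : C0Semigroup Y) (hS : S.ExpStable) {α : ℝ} (hα : 0 < α) (x : Y) :
    S.fracPow hS hα x = negFracPow S α x :=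
  (S.exists_fracPow hS hα).choose_spec x

theorem fracPow_comm (S : C0Semigroup Y) (hS : S.ExpStable) {α : ℝ} (hα : 0 < α) (t : ℝ≥0)
    (x : Y) : S t (S.fracPow hS hα x) = S.fracPow hS hα (S t x) := by
  rw [fracPow_apply, fracPow_apply, negFracPow, negFracPow, ← Complex.coe_smul, map_smul,
    Complex.coe_smul, ← ContinuousLinearMap.integral_comp_comm _
      (S.integrableOn_rpow_smul_orbit hS hα x)]
  congr 1
  refine integral_congr_ae (ae_of_all _ fun s => ?_)
  simp only
  rw [← Complex.coe_smul, map_smul, Complex.coe_smul, S.comm_apply]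

theorem integrableOn_rpow_neg_mul_inv {α : ℝ} (h0 : 0 < α) (h1 : α < 1) :
    IntegrableOn (fun τ : ℝ => τ ^ (-α) * (1 + τ)⁻¹) (Ioi 0) := by
  have hm : AEStronglyMeasurable (fun τ : ℝ => τ ^ (-α) * (1 + τ)⁻¹) (volume.restrict (Ioi 0)) :=
    ((measurable_id.pow_const _).mul (by fun_prop)).aestronglyMeasurable
  rw [← Ioc_union_Ioi_eq_Ioi zero_le_one]
  refine IntegrableOn.union ?_ ?_
  · have : IntegrableOn (fun τ : ℝ => τ ^ (-α)) (Ioc 0 1) := by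
      have := intervalIntegral.intervalIntegrable_rpow' (a := 0) (b := 1) (r := -α) (by linarith)
      rwa [intervalIntegrable_iff_integrableOn_Ioc_of_le zero_le_one] at this
    refine this.mono' (hm.mono_measure (Measure.restrict_mono Ioc_subset_Ioi_self le_rfl)) ?_
    filter_upwards [ae_restrict_mem measurableSet_Ioc] with τ hτ
    have hp : 0 ≤ τ ^ (-α) := Real.rpow_nonneg hτ.1.le _
    have hq : (1 + τ)⁻¹ ≤ 1 := inv_le_one_of_one_le₀ (by linarith [hτ.1])
    have hq0 : 0 ≤ (1 + τ)⁻¹ := inv_nonneg.2 (by linarith [hτ.1])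
    rw [Real.norm_of_nonneg (mul_nonneg hp hq0)]
    exact mul_le_of_le_one_right hp hq
  · have := integrableOn_Ioi_rpow_of_lt (a := -α + -1) (by linarith) one_pos
    refine this.mono' (hm.mono_measure
      (Measure.restrict_mono (Ioi_subset_Ioi zero_le_one) le_rfl)) ?_
    filter_upwards [ae_restrict_mem measurableSet_Ioi] with τ hτ
    have hτ0 : 0 < τ := zero_lt_one.trans hτ
    have hp : 0 ≤ τ ^ (-α) := Real.rpow_nonneg hτ0.le _
    have hq : (1 + τ)⁻¹ ≤ τ⁻¹ := inv_anti₀ hτ0 (by linarith)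
    have hq0 : 0 ≤ (1 + τ)⁻¹ := inv_nonneg.2 (by linarith)
    rw [Real.norm_of_nonneg (mul_nonneg hp hq0), Real.rpow_add hτ0, Real.rpow_neg_one]
    gcongr

theorem integral_rpow_neg_mul_inv_pos {α : ℝ} (h0 : 0 < α) (h1 : α < 1) :
    0 < ∫ τ in Ioi (0 : ℝ), τ ^ (-α) * (1 + τ)⁻¹ := by
  have hpos : ∀ τ ∈ Ioi (0 : ℝ), 0 < τ ^ (-α) * (1 + τ)⁻¹ := fun τ hτ =>
    mul_pos (Real.rpow_pos_of_pos hτ _) (inv_pos.2 (by linarith [mem_Ioi.1 hτ]))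
  rw [setIntegral_pos_iff_support_of_nonneg_ae _ (integrableOn_rpow_neg_mul_inv h0 h1)]
  · have : Function.support (fun τ : ℝ => τ ^ (-α) * (1 + τ)⁻¹) ∩ Ioi 0 = Ioi 0 :=
      inter_eq_right.2 fun τ hτ => (hpos τ hτ).ne'
    rw [this]
    simp
  · filter_upwards [ae_restrict_mem measurableSet_Ioi] with τ hτ
    exact (hpos τ hτ).le

/-- The semigroup law `(-A)^{-α} (-A)^{-(1-α)} = (-A)⁻¹` of the fractional powers, up to a factor
that need not be evaluated. The substitution `t = s τ` turns the double integral over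
`S(s + t)` into a product. -/
theorem exists_potential_eq_fracPow (S : C0Semigroup Y) (hS : S.ExpStable) {α : ℝ} (h0 : 0 < α)
    (h1 : α < 1) : ∃ c : ℝ, ∀ x, S.potential hS x =
      c • S.fracPow hS h0 (S.fracPow hS (sub_pos.2 h1) x) := by
  obtain ⟨M, ω, hM1, hω, hM⟩ := id hS
  set b : ℝ := ∫ τ in Ioi (0 : ℝ), τ ^ (-α) * (1 + τ)⁻¹ with hb
  have hbpos : 0 < b := integral_rpow_neg_mul_inv_pos h0 h1
  refine ⟨b⁻¹ * Real.Gamma α * Real.Gamma (1 - α), fun x => ?_⟩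
  -- integrating over `s` first gives a multiple of the potential
  have key : ∫ s in Ioi (0 : ℝ), ∫ τ in Ioi (0 : ℝ), τ ^ (-α) • S (s * (1 + τ)).toNNReal x =
      b • S.potential hS x := by
    rw [integral_integral_swap]
    · rw [hb, ← integral_smul_const]
      refine setIntegral_congr_fun measurableSet_Ioi fun τ hτ => ?_
      have hτ' : (0 : ℝ) < 1 + τ := by linarith [mem_Ioi.1 hτ]
      rw [integral_smul, integral_comp_mul_right_Ioi (fun s => S s.toNNReal x) 0 hτ', zero_mul,
        potential_apply, mul_smul]
    · have hint : IntegrableOn (fun τ : ℝ => τ ^ (-α) * (M * ‖x‖ * ω⁻¹ * (1 + τ)⁻¹)) (Ioi 0) := by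
        refine ((integrableOn_rpow_neg_mul_inv h0 h1).mul_const (M * ‖x‖ * ω⁻¹)).congr
          (ae_of_all _ fun τ => ?_)
        simp only
        ring
      have hsm : AEStronglyMeasurable (fun p : ℝ × ℝ => p.2 ^ (-α) • S (p.1 * (1 + p.2)).toNNReal x)
          ((volume.restrict (Ioi 0)).prod (volume.restrict (Ioi 0))) := by
        refine (measurable_snd.pow_const (-α)).aestronglyMeasurable.smul ?_
        exact ((S.continuous_orbit x).comp (by fun_prop)).aestronglyMeasurable
      have hsint (τ : ℝ) (hτ : τ ∈ Ioi (0 : ℝ)) :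
          IntegrableOn (fun s => M * ‖x‖ * Real.exp (-(ω * (1 + τ)) * s)) (Ioi 0) :=
        (exp_neg_integrableOn_Ioi 0 (mul_pos hω (by linarith [mem_Ioi.1 hτ]))).const_mul _
      have hbd (τ : ℝ) (hτ : τ ∈ Ioi (0 : ℝ)) (s : ℝ) (hs : s ∈ Ioi (0 : ℝ)) :
          ‖S (s * (1 + τ)).toNNReal x‖ ≤ M * ‖x‖ * Real.exp (-(ω * (1 + τ)) * s) := by
        have h2 := hM (s * (1 + τ)).toNNReal
        rw [Real.coe_toNNReal _ (mul_nonneg (le_of_lt hs) (by linarith [mem_Ioi.1 hτ]))] at h2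
        refine ((S _).le_opNorm x).trans
          ((mul_le_mul_of_nonneg_right h2 (norm_nonneg x)).trans_eq ?_)
        rw [mul_right_comm]
        ring_nf
      refine (integrable_prod_iff' hsm).2 ⟨?_, ?_⟩
      · filter_upwards [ae_restrict_mem measurableSet_Ioi] with τ hτ
        refine Integrable.smul _ ?_
        refine (hsint τ hτ).mono'
          ((S.continuous_orbit x).comp (by fun_prop)).aestronglyMeasurable ?_
        filter_upwards [ae_restrict_mem measurableSet_Ioi] with s hs
        exact hbd τ hτ s hs
      · refine hint.mono' hsm.norm.prod_swap.integral_prod_right' ?_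
        filter_upwards [ae_restrict_mem measurableSet_Ioi] with τ hτ
        have hτ' : (0 : ℝ) < 1 + τ := by linarith [mem_Ioi.1 hτ]
        have hp : 0 ≤ τ ^ (-α) := Real.rpow_nonneg (le_of_lt hτ) _
        rw [Real.norm_of_nonneg (integral_nonneg fun _ => norm_nonneg _)]
        simp only [norm_smul, Real.norm_of_nonneg hp]
        rw [integral_const_mul]
        refine mul_le_mul_of_nonneg_left ?_ hp
        refine (integral_mono_of_nonneg (ae_of_all _ fun _ => norm_nonneg _)
          (hsint τ hτ) ?_).trans_eq ?_
        · filter_upwards [ae_restrict_mem measurableSet_Ioi] with s hs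
          exact hbd τ hτ s hs
        · rw [integral_const_mul, integral_exp_mul_Ioi (by nlinarith)]
          have : ω * (1 + τ) ≠ 0 := (mul_pos hω hτ').ne'
          simp only [mul_zero, Real.exp_zero]
          field_simp
  -- integrating over `τ` first and substituting `t = s τ` gives the product
  have key2 : ∫ s in Ioi (0 : ℝ), ∫ τ in Ioi (0 : ℝ), τ ^ (-α) • S (s * (1 + τ)).toNNReal x =
      (Real.Gamma α * Real.Gamma (1 - α)) • S.fracPow hS h0 (S.fracPow hS (sub_pos.2 h1) x) := by
    have hg1 : Real.Gamma α ≠ 0 := (Real.Gamma_pos_of_pos h0).ne'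
    have hg2 : Real.Gamma (1 - α) ≠ 0 := (Real.Gamma_pos_of_pos (sub_pos.2 h1)).ne'
    rw [fracPow_apply, negFracPow, smul_smul, mul_right_comm, mul_inv_cancel₀ hg1, one_mul,
      ← integral_smul]
    refine setIntegral_congr_fun measurableSet_Ioi fun s hs => ?_
    have hs0 : (0 : ℝ) < s := hs
    rw [fracPow_apply, negFracPow, ← Complex.coe_smul, ← Complex.coe_smul, ← Complex.coe_smul,
      map_smul, ← ContinuousLinearMap.integral_comp_comm _
        (S.integrableOn_rpow_smul_orbit hS (sub_pos.2 h1) x),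
      smul_comm ((s ^ (α - 1) : ℝ) : ℂ), smul_smul, Complex.coe_smul, ← Complex.ofReal_mul,
      mul_inv_cancel₀ hg2, Complex.ofReal_one, one_smul]
    have h3 := integral_comp_mul_left_Ioi
      (fun t => S s.toNNReal (t ^ (1 - α - 1) • S t.toNNReal x)) 0 hs0
    rw [mul_zero] at h3
    have h4 : ∫ t in Ioi (0 : ℝ), S s.toNNReal (t ^ (1 - α - 1) • S t.toNNReal x) =
        s • ∫ t in Ioi (0 : ℝ), S s.toNNReal ((s * t) ^ (1 - α - 1) • S (s * t).toNNReal x) := by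
      rw [h3, smul_smul, mul_inv_cancel₀ hs0.ne', one_smul]
    rw [h4, smul_smul, ← integral_smul]
    refine setIntegral_congr_fun measurableSet_Ioi fun τ hτ => ?_
    have hτ0 : (0 : ℝ) < τ := hτ
    rw [← Complex.coe_smul ((s * τ) ^ _), map_smul, Complex.coe_smul, smul_smul, ← S.add_apply,
      ← Real.toNNReal_add hs0.le (mul_pos hs0 hτ0).le]
    congr 2
    · rw [Real.mul_rpow hs0.le hτ0.le, show (1 - α - 1) = -α by ring, Real.rpow_sub_one hs0.ne',
        Real.rpow_neg hs0.le]
      have := (Real.rpow_pos_of_pos hs0 α).ne'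
      field_simp
    · ring_nf
  rw [mul_assoc, mul_smul, ← key2, key, smul_smul, inv_mul_cancel₀ hbpos.ne', one_smul]

end Banach

section Hilbert

variable {Y : Type*} [NormedAddCommGroup Y] [InnerProductSpace ℂ Y] [CompleteSpace Y]

/-- The adjoint of `(-A)^{-α}` is the fractional power `(-A*)^{-α}` of the adjoint semigroup. -/
theorem adjoint_fracPow (S : C0Semigroup Y) (hS : S.ExpStable) {α : ℝ} (hα : 0 < α) :
    ContinuousLinearMap.adjoint (S.fracPow hS hα) =
      (S.adjSemigroup hS).fracPow (S.adjSemigroup_expStable hS) hα := by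
  symm
  rw [ContinuousLinearMap.eq_adjoint_iff]
  intro z x
  rw [fracPow_apply, fracPow_apply, negFracPow, negFracPow, ← Complex.coe_smul, ← Complex.coe_smul,
    inner_smul_left, inner_smul_right, Complex.conj_ofReal]
  congr 1
  rw [← integral_inner (S.integrableOn_rpow_smul_orbit hS hα x), ← inner_conj_symm,
    ← integral_inner ((S.adjSemigroup hS).integrableOn_rpow_smul_orbit
      (S.adjSemigroup_expStable hS) hα z), ← integral_conj]
  refine integral_congr_ae (ae_of_all _ fun s => ?_)
  simp only
  rw [inner_conj_symm, ← Complex.coe_smul, ← Complex.coe_smul, inner_smul_left, inner_smul_right,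
    Complex.conj_ofReal]
  congr 1
  exact ContinuousLinearMap.adjoint_inner_left _ _ _

theorem fracPow_adjSemigroup_apply (S : C0Semigroup Y) (hS : S.ExpStable) {α : ℝ} (hα : 0 < α)
    (x : Y) : ContinuousLinearMap.adjoint (S.fracPow hS hα) x = negFracPow S.adj α x := by
  rw [adjoint_fracPow, fracPow_apply]
  rfl

/-- Duality criterion for membership in `D((-A)^α)`: it suffices to test with a dense set, such as
`D(A*)`. -/
theorem mem_fracDomain_of_inner_le (S : C0Semigroup Y) (hS : S.ExpStable) {α : ℝ} (hα : 0 < α)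
    {D : Set Y} (hD : Dense D) {y : Y} {c : ℝ} (hc : 0 ≤ c)
    (h : ∀ z ∈ D, ‖inner ℂ z y‖ ≤ c * ‖negFracPow S.adj α z‖) :
    ∃ w, negFracPow S α w = y ∧ ‖w‖ ≤ c := by
  simp_rw [← S.fracPow_apply hS hα]
  refine (S.fracPow hS hα).exists_preimage_of_inner_le hc fun z => ?_
  have hcl : IsClosed {z : Y | ‖inner ℂ z y‖ ≤
      c * ‖ContinuousLinearMap.adjoint (S.fracPow hS hα) z‖} :=
    isClosed_le (by fun_prop) (by fun_prop)
  refine hcl.closure_subset_iff.2 (fun z hz => ?_) (hD z)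
  rw [mem_ofPred_eq, fracPow_adjSemigroup_apply]
  exact h z hz

/-- Duality criterion for membership in `D((-A*)^α)`. -/
theorem mem_adj_fracDomain_of_inner_le (S : C0Semigroup Y) (hS : S.ExpStable) {α : ℝ} (hα : 0 < α)
    {y : Y} {c : ℝ} (hc : 0 ≤ c) (h : ∀ z, ‖inner ℂ z y‖ ≤ c * ‖negFracPow S α z‖) :
    y ∈ fracDomain S.adj α := by
  obtain ⟨w, hw, -⟩ := (ContinuousLinearMap.adjoint (S.fracPow hS hα)).exists_preimage_of_inner_le
    hc (y := y) fun z => by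
      rw [ContinuousLinearMap.adjoint_adjoint, fracPow_apply]
      exact h z
  exact ⟨w, by rw [← S.fracPow_adjSemigroup_apply hS hα, hw]⟩

end Hilbert

end C0Semigroup

/-! ### Vectors and functions tested by duality -/

section WeakNotions

variable {Y : Type*} [NormedAddCommGroup Y] [InnerProductSpace ℂ Y]

theorem enorm_le_of_dense_inner {ι : Type*} {e : ι → Y} (he : DenseRange e) {y : Y} {c : ℝ≥0∞}
    (h : ∀ z, ‖inner ℂ (e z) y‖ₑ ≤ ‖e z‖ₑ * c) : ‖y‖ₑ ≤ c := by
  rcases eq_or_ne c ∞ with rfl | hc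
  · exact le_top
  lift c to ℝ≥0 using hc
  have hcl : IsClosed {z : Y | ‖inner ℂ z y‖ ≤ ‖z‖ * c} :=
    isClosed_le (by fun_prop) (by fun_prop)
  have h1 : ‖inner ℂ y y‖ ≤ ‖y‖ * c := by
    refine hcl.closure_subset_iff.2 ?_ (he y)
    rintro _ ⟨z, rfl⟩
    have := h z
    rw [← enorm_norm (e z), ← enorm_norm (inner ℂ _ _), Real.enorm_of_nonneg (norm_nonneg _),
      Real.enorm_of_nonneg (norm_nonneg _), ← ENNReal.ofReal_coe_nnreal,
      ← ENNReal.ofReal_mul (norm_nonneg _), ENNReal.ofReal_le_ofReal_iff (by positivity)] at this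
    exact this
  rw [inner_self_eq_norm_sq_to_K] at h1
  simp only [Complex.coe_algebraMap, norm_pow, Complex.norm_real, norm_norm] at h1
  rcases eq_or_ne y 0 with rfl | hy
  · simp
  · have h2 : ‖y‖ ≤ c := le_of_mul_le_mul_left (by nlinarith) (norm_pos_iff.2 hy)
    exact enorm_le_coe.2 h2

/-- Pettis' theorem in a separable Hilbert space: a function whose scalar products with a dense set
of vectors are measurable is itself measurable. -/
theorem aestronglyMeasurable_of_inner [CompleteSpace Y] [TopologicalSpace.SeparableSpace Y]
    {α ι : Type*} [MeasurableSpace α] {μ : Measure α} {e : ι → Y} (he : DenseRange e) {y : α → Y}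
    (h : ∀ i, AEStronglyMeasurable (fun t => inner ℂ (e i) (y t)) μ) :
    AEStronglyMeasurable y μ := by
  have : SecondCountableTopology Y := UniformSpace.secondCountable_of_separable Y
  borelize Y
  obtain ⟨c, hce, hcc, hcd⟩ :=
    (TopologicalSpace.IsSeparable.of_separableSpace (range e)).exists_countable_dense_subset
  have hd : Dense c := fun z => closure_minimal hcd isClosed_closure (he z)
  have : Countable c := hcc
  let J : Y → (c → ℂ) := fun y z => inner ℂ (z : Y) y
  have hJc : Continuous J := by fun_prop
  have hJi : Function.Injective J := fun a b hab =>
    hd.eq_of_inner_right ℂ fun z hz => congrFun hab ⟨z, hz⟩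
  have hJ := hJc.measurableEmbedding hJi
  refine AEMeasurable.aestronglyMeasurable (hJ.aemeasurable_comp_iff.1 ?_)
  refine aemeasurable_pi_lambda _ fun z => ?_
  obtain ⟨i, hi⟩ := hce z.2
  have := (h i).aemeasurable
  rw [hi] at this
  exact this

end WeakNotions

/-! ### Integrals over the half-line -/

/-- A convolution over `(0, t)` as an integral over a domain that does not depend on `t`. -/
theorem setLIntegral_convolution_eq (m g : ℝ → ℝ≥0∞) (t : ℝ) :
    ∫⁻ s in Ioo 0 t, m (t - s) * g s =
      ∫⁻ s in Ioi (0 : ℝ), (Ioi 0).indicator m (t - s) * g s := by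
  rw [← lintegral_indicator measurableSet_Ioo, ← lintegral_indicator measurableSet_Ioi]
  congr 1
  ext s
  by_cases h1 : 0 < s <;> by_cases h2 : s < t <;> simp [h1, h2, indicator]

theorem aemeasurable_convolution_integrand {m g : ℝ → ℝ≥0∞} (hm : Measurable m)
    (hg : AEMeasurable g (volume.restrict (Ioi 0))) :
    AEMeasurable (Function.uncurry fun t s => (Ioi 0).indicator m (t - s) * g s)
      ((volume.restrict (Ioi 0)).prod (volume.restrict (Ioi 0))) :=
  ((hm.indicator measurableSet_Ioi).comp (by fun_prop)).aemeasurable.mul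
    (hg.comp_quasiMeasurePreserving Measure.quasiMeasurePreserving_snd)

theorem aemeasurable_convolution_halfLine {m g : ℝ → ℝ≥0∞} (hm : Measurable m)
    (hg : AEMeasurable g (volume.restrict (Ioi 0))) :
    AEMeasurable (fun t => ∫⁻ s in Ioo 0 t, m (t - s) * g s) (volume.restrict (Ioi 0)) := by
  simp_rw [setLIntegral_convolution_eq]
  exact (aemeasurable_convolution_integrand hm hg).lintegral_prod_right'

theorem lintegral_convolution_halfLine {m g : ℝ → ℝ≥0∞} (hm : Measurable m)
    (hg : AEMeasurable g (volume.restrict (Ioi 0))) :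
    ∫⁻ t in Ioi (0 : ℝ), ∫⁻ s in Ioo 0 t, m (t - s) * g s =
      (∫⁻ t in Ioi (0 : ℝ), m t) * ∫⁻ t in Ioi (0 : ℝ), g t := by
  simp_rw [setLIntegral_convolution_eq]
  rw [lintegral_lintegral_swap (aemeasurable_convolution_integrand hm hg)]
  have h2 : ∀ s ∈ Ioi (0 : ℝ), ∫⁻ t in Ioi (0 : ℝ), (Ioi 0).indicator m (t - s) * g s =
      (∫⁻ t in Ioi (0 : ℝ), m t) * g s := fun s hs => by
    have hs0 : (0 : ℝ) < s := hs
    rw [lintegral_mul_const _ (show Measurable fun t => (Ioi 0).indicator m (t - s) from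
        (hm.indicator measurableSet_Ioi).comp (by fun_prop)),
      ← lintegral_indicator measurableSet_Ioi, ← lintegral_indicator measurableSet_Ioi,
      ← lintegral_add_right_eq_self _ s]
    congr 2
    ext t
    by_cases h : 0 < t
    · simp [h, indicator, add_pos h hs0]
    · simp [h, indicator]
  rw [setLIntegral_congr_fun measurableSet_Ioi h2, lintegral_const_mul'' _ hg]

/-- If the powers of a nonnegative quantity decay geometrically from one block `(kτ, (k+1)τ)` to the
next, its integral over the half-line is controlled by the first block, with an exponential weight
to spare. -/
theorem lintegral_exp_mul_le_of_blocks {f : ℝ → ℝ≥0∞} {p τ ω : ℝ} (hp : 0 < p) (hτ : 0 < τ)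
    (hω : 0 < ω) {c : ℝ≥0∞}
    (h : ∀ k : ℕ, ∫⁻ t in Ioc 0 τ, f (t + k * τ) ^ p ≤
      (ENNReal.ofReal (Real.exp (-ω * (k * τ))) * c) ^ p) :
    ∫⁻ t in Ioi (0 : ℝ), (ENNReal.ofReal (Real.exp (ω / 2 * t)) * f t) ^ p ≤
      ENNReal.ofReal (Real.exp (ω / 2 * τ) ^ p * (1 - Real.exp (-(ω / 2) * τ) ^ p)⁻¹) * c ^ p := by
  have hU : Ioi (0 : ℝ) ⊆ ⋃ k : ℕ, Ioc (0 + k * τ) (τ + k * τ) := fun t ht => by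
    have ht0 : 0 < t / τ := div_pos ht hτ
    have hc := Nat.ceil_pos.2 ht0
    have h1 := Nat.le_ceil (t / τ)
    have h2 := Nat.ceil_lt_add_one ht0.le
    obtain ⟨k, hk⟩ : ∃ k, ⌈t / τ⌉₊ = k + 1 := ⟨_, (Nat.succ_pred_eq_of_pos hc).symm⟩
    rw [hk, Nat.cast_add_one] at h1 h2
    rw [div_le_iff₀ hτ] at h1
    rw [add_lt_add_iff_right, lt_div_iff₀ hτ] at h2
    exact mem_iUnion.2 ⟨k, by linarith, by linarith⟩
  have hblock (k : ℕ) : ∫⁻ t in Ioc (0 + k * τ) (τ + k * τ),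
      (ENNReal.ofReal (Real.exp (ω / 2 * t)) * f t) ^ p ≤
      ENNReal.ofReal (Real.exp (ω / 2 * τ) ^ p * (Real.exp (-(ω / 2) * τ) ^ p) ^ k) * c ^ p := by
    have h1 := (measurePreserving_add_right volume (k * τ)).setLIntegral_comp_preimage_emb
      (measurableEmbedding_addRight (k * τ))
      (fun t => (ENNReal.ofReal (Real.exp (ω / 2 * t)) * f t) ^ p) (Ioc (0 + k * τ) (τ + k * τ))
    rw [← h1, preimage_add_const_Ioc, add_sub_cancel_right, add_sub_cancel_right]
    calc ∫⁻ t in Ioc 0 τ, (ENNReal.ofReal (Real.exp (ω / 2 * (t + k * τ))) * f (t + k * τ)) ^ p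
        ≤ ∫⁻ t in Ioc 0 τ, ENNReal.ofReal (Real.exp (ω / 2 * (τ + k * τ))) ^ p *
            f (t + k * τ) ^ p := by
          refine setLIntegral_mono' measurableSet_Ioc fun t ht => ?_
          rw [ENNReal.mul_rpow_of_nonneg _ _ hp.le]
          gcongr
          exact ht.2
      _ = ENNReal.ofReal (Real.exp (ω / 2 * (τ + k * τ))) ^ p *
            ∫⁻ t in Ioc 0 τ, f (t + k * τ) ^ p :=
          lintegral_const_mul' _ _ (ENNReal.rpow_ne_top_of_nonneg hp.le ENNReal.ofReal_ne_top)
      _ ≤ ENNReal.ofReal (Real.exp (ω / 2 * (τ + k * τ))) ^ p *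
            (ENNReal.ofReal (Real.exp (-ω * (k * τ))) * c) ^ p := by gcongr; exact h k
      _ = _ := by
          rw [ENNReal.mul_rpow_of_nonneg _ _ hp.le, ← mul_assoc,
            ENNReal.ofReal_rpow_of_nonneg (Real.exp_nonneg _) hp.le,
            ENNReal.ofReal_rpow_of_nonneg (Real.exp_nonneg _) hp.le,
            ← ENNReal.ofReal_mul (by positivity), ← Real.exp_mul, ← Real.exp_mul, ← Real.exp_mul,
            ← Real.exp_mul, ← Real.exp_nat_mul, ← Real.exp_add, ← Real.exp_add]
          congr 3
          ring
  have hr1 : Real.exp (-(ω / 2) * τ) ^ p < 1 := by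
    rw [← Real.exp_mul, Real.exp_lt_one_iff]
    have := mul_pos (mul_pos (half_pos hω) hτ) hp
    linarith
  refine (lintegral_mono_set hU).trans ((lintegral_iUnion_le _ _).trans
    ((ENNReal.tsum_le_tsum hblock).trans_eq ?_))
  rw [ENNReal.tsum_mul_right, ← ENNReal.ofReal_tsum_of_nonneg (fun k => by positivity)
    ((summable_geometric_of_lt_one (by positivity) hr1).mul_left _), tsum_mul_left,
    tsum_geometric_of_lt_one (by positivity) hr1]

/-! ### Estimates in `L^p` by duality and by iteration -/

section Lp

variable {α E : Type*} [MeasurableSpace α] {μ : Measure α} [NormedAddCommGroup E]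
  [InnerProductSpace ℂ E]

theorem eLpNorm_ofReal_eq {E : Type*} [NormedAddCommGroup E] {p : ℝ} (hp : 0 < p) (f : α → E) :
    eLpNorm f (ENNReal.ofReal p) μ = (∫⁻ t, ‖f t‖ₑ ^ p ∂μ) ^ (1 / p) := by
  rw [eLpNorm_eq_lintegral_rpow_enorm_toReal (by simpa using hp) ENNReal.ofReal_ne_top,
    ENNReal.toReal_ofReal hp.le]

/-- The converse of Hölder's inequality, tested on square integrable functions. The test functions
are truncations of the extremal `‖h‖^(P-2) h`. -/
theorem eLpNorm_le_of_inner_le {P r : ℝ} (hPr : P.HolderConjugate r) (hP : 2 ≤ P) {h : α → E}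
    (hh : MemLp h 2 μ) {C : ℝ≥0∞}
    (hC : ∀ φ : α → E, MemLp φ 2 μ →
      ‖∫ t, inner ℂ (φ t) (h t) ∂μ‖ₑ ≤ C * eLpNorm φ (ENNReal.ofReal r) μ) :
    eLpNorm h (ENNReal.ofReal P) μ ≤ C := by
  wlog hsm : StronglyMeasurable h generalizing h
  · have hae := hh.1.ae_eq_mk
    rw [eLpNorm_congr_ae hae]
    refine this (hh.ae_eq hae) (fun φ hφ => ?_) hh.1.stronglyMeasurable_mk
    have h1 : ∫ t, inner ℂ (φ t) (hh.1.mk h t) ∂μ = ∫ t, inner ℂ (φ t) (h t) ∂μ :=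
      integral_congr_ae (hae.mono fun t ht => congrArg (inner ℂ (φ t)) ht.symm)
    rw [h1]
    exact hC φ hφ
  have hP0 : 0 < P := hPr.pos
  have hr0 : 0 < r := hPr.symm.pos
  set A : ℕ → Set α := fun n => {t | ‖h t‖ ≤ n} with hA
  have hAm (n : ℕ) : MeasurableSet (A n) :=
    measurableSet_le hsm.norm.measurable measurable_const
  have hlim : ∀ᵐ t ∂μ, Tendsto (fun n => (A n).indicator h t) atTop (𝓝 (h t)) := by
    refine ae_of_all _ fun t => tendsto_const_nhds.congr' ?_
    obtain ⟨N, hN⟩ := exists_nat_ge ‖h t‖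
    filter_upwards [eventually_ge_atTop N] with n hn
    have : t ∈ A n := hN.trans (Nat.cast_le.2 hn)
    rw [indicator_of_mem this]
  refine Lp.eLpNorm_le_of_ae_tendsto (Eventually.of_forall fun n => ?_)
    (fun n => (hsm.indicator (hAm n)).aestronglyMeasurable) hlim
  set I : ℝ≥0∞ := ∫⁻ t, ‖(A n).indicator h t‖ₑ ^ P ∂μ with hI
  set g : α → ℝ := (A n).indicator fun t => ‖h t‖ ^ P with hg
  set φ : α → E := (A n).indicator fun t => ((‖h t‖ ^ (P - 2) : ℝ) : ℂ) • h t with hφ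
  have hgm : AEStronglyMeasurable g μ :=
    ((hsm.norm.measurable.pow_const P).indicator (hAm n)).aestronglyMeasurable
  have hφm : AEStronglyMeasurable φ μ := by
    refine (StronglyMeasurable.indicator ?_ (hAm n)).aestronglyMeasurable
    exact (Complex.measurable_ofReal.comp (hsm.norm.measurable.pow_const _)).stronglyMeasurable.smul
      hsm
  have hge (t : α) : ENNReal.ofReal (g t) = ‖(A n).indicator h t‖ₑ ^ P := by
    by_cases ht : t ∈ A n
    · rw [hg, indicator_of_mem ht, indicator_of_mem ht, ← ofReal_norm,
        ENNReal.ofReal_rpow_of_nonneg (norm_nonneg _) hP0.le]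
    · simp [hg, ht, hP0]
  have hφe (t : α) : ‖φ t‖ₑ ^ r = ‖(A n).indicator h t‖ₑ ^ P := by
    by_cases ht : t ∈ A n
    · rw [hφ, indicator_of_mem ht, indicator_of_mem ht, ← ofReal_norm,
        ← ofReal_norm, ENNReal.ofReal_rpow_of_nonneg (norm_nonneg _) hP0.le,
        ENNReal.ofReal_rpow_of_nonneg (norm_nonneg _) hr0.le, norm_smul, Complex.norm_real,
        Real.norm_of_nonneg (by positivity)]
      rcases eq_or_ne (h t) 0 with h0 | h0
      · simp [h0, hP0.ne', hr0.ne']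
      · have hn := norm_pos_iff.2 h0
        congr 1
        rw [← Real.rpow_add_one hn.ne', ← Real.rpow_mul hn.le]
        congr 1
        have := hPr.sub_one_mul_conj
        linarith
    · simp [hφ, ht, hP0, hr0]
  have hinner (t : α) : inner ℂ (φ t) (h t) = (g t : ℂ) := by
    by_cases ht : t ∈ A n
    · rw [hφ, hg, indicator_of_mem ht, indicator_of_mem ht, inner_smul_left, Complex.conj_ofReal,
        inner_self_eq_norm_sq_to_K]
      rcases eq_or_ne (h t) 0 with h0 | h0
      · simp [h0, hP0.ne']
      · have hn := norm_pos_iff.2 h0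
        change ((‖h t‖ ^ (P - 2) : ℝ) : ℂ) * (‖h t‖ : ℂ) ^ 2 = _
        rw [← Complex.ofReal_pow, ← Complex.ofReal_mul, ← Real.rpow_natCast,
          ← Real.rpow_add hn]
        congr 2
        push_cast
        ring
    · simp [hφ, hg, ht]
  have hφ2 : MemLp φ 2 μ := by
    refine hh.of_le_mul (c := (n : ℝ) ^ (P - 2)) hφm (ae_of_all _ fun t => ?_)
    by_cases ht : t ∈ A n
    · rw [hφ, indicator_of_mem ht, norm_smul, Complex.norm_real,
        Real.norm_of_nonneg (by positivity)]
      gcongr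
      exact ht
    · rw [hφ, indicator_of_notMem ht, norm_zero]
      positivity
  have hgi : Integrable g μ := by
    have h1 : Integrable (fun t => ‖φ t‖ * ‖h t‖) μ :=
      MemLp.integrable_mul (p := 2) (q := 2) hφ2.norm hh.norm
    refine h1.mono' hgm (ae_of_all _ fun t => ?_)
    rw [← Complex.norm_real, ← hinner]
    exact norm_inner_le_norm _ _
  have hg0 : 0 ≤ᵐ[μ] g := ae_of_all _ fun t => indicator_nonneg (fun _ _ => by positivity) t
  have hIe : ‖∫ t, inner ℂ (φ t) (h t) ∂μ‖ₑ = I := by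
    simp_rw [hinner]
    rw [integral_complex_ofReal, ← ofReal_norm, Complex.norm_real, Real.norm_of_nonneg
      (integral_nonneg_of_ae hg0), ofReal_integral_eq_lintegral_ofReal hgi hg0]
    exact lintegral_congr hge
  have hItop : I ≠ ∞ := by
    rw [hI, ← lintegral_congr hge, ← ofReal_integral_eq_lintegral_ofReal hgi hg0]
    exact ENNReal.ofReal_ne_top
  have h1 := hC φ hφ2
  rw [hIe, eLpNorm_ofReal_eq hr0, lintegral_congr hφe, ← hI] at h1
  rw [eLpNorm_ofReal_eq hP0, ← hI]
  rcases eq_or_ne I 0 with h0 | h0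
  · simp [h0, hP0]
  · -- the truncation makes `I` finite, which allows the division
    have h2 : I = I ^ (1 / P) * I ^ (1 / r) := by
      rw [← ENNReal.rpow_add _ _ h0 hItop, hPr.one_div_add_one_div, one_div_one, ENNReal.rpow_one]
    nth_rw 1 [h2] at h1
    refine (ENNReal.mul_le_mul_iff_left ?_ ?_).1 h1
    · simp [h0, hItop]
    · exact ENNReal.rpow_ne_top_of_nonneg (by positivity) hItop

/-- A contraction of `L²` that is also a contraction for the `L^P` norm: the solution of
`f + T f = g` inherits the integrability of `g`. -/
theorem eLpNorm_le_two_mul_of_add_eq {P : ℝ≥0∞} {T : Lp E 2 μ →L[ℂ] Lp E 2 μ}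
    (hT : ‖T‖ ≤ 1 / 2) (hTP : ∀ f, eLpNorm (T f) P μ ≤ 2⁻¹ * eLpNorm f P μ) (hP : 1 ≤ P)
    {f g : Lp E 2 μ} (hfg : f + T f = g) : eLpNorm f P μ ≤ 2 * eLpNorm g P μ := by
  -- the Neumann iterates converge to `f` in `L²`, and they are bounded in `L^P`
  let a : ℕ → Lp E 2 μ := fun n => (fun x => g - T x)^[n] 0
  have hsucc (n : ℕ) : a (n + 1) = g - T (a n) := Function.iterate_succ_apply' _ _ _
  have hdist (n : ℕ) : ‖a n - f‖ ≤ (1 / 2) ^ n * ‖f‖ := by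
    induction n with
    | zero => simp [a]
    | succ n ih =>
      have : a (n + 1) - f = -T (a n - f) := by
        rw [hsucc, ← hfg, map_sub]
        abel
      rw [this, norm_neg]
      calc ‖T (a n - f)‖ ≤ 1 / 2 * ((1 / 2) ^ n * ‖f‖) :=
            (T.le_opNorm _).trans (mul_le_mul hT ih (norm_nonneg _) (by norm_num))
        _ = _ := by ring
  have hlim : Tendsto a atTop (𝓝 f) := by
    rw [tendsto_iff_norm_sub_tendsto_zero]
    refine squeeze_zero (fun _ => norm_nonneg _) hdist ?_
    simpa using (tendsto_pow_atTop_nhds_zero_of_lt_one (r := (1 / 2 : ℝ)) (by norm_num)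
      (by norm_num)).mul_const ‖f‖
  obtain ⟨v, -, hv⟩ := (tendstoInMeasure_of_tendsto_Lp hlim).exists_seq_tendsto_ae
  refine Lp.eLpNorm_le_of_ae_tendsto (Eventually.of_forall fun n => ?_)
    (fun n => Lp.aestronglyMeasurable _) hv
  induction v n with
  | zero =>
    have : a 0 = 0 := rfl
    rw [this, eLpNorm_congr_ae (Lp.coeFn_zero _ _ _), eLpNorm_zero]
    exact zero_le
  | succ k ih =>
    rw [hsucc, eLpNorm_congr_ae (Lp.coeFn_sub _ _)]
    refine (eLpNorm_sub_le (Lp.aestronglyMeasurable _) (Lp.aestronglyMeasurable _) hP).trans ?_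
    calc eLpNorm g P μ + eLpNorm (T (a k)) P μ
        ≤ eLpNorm g P μ + 2⁻¹ * (2 * eLpNorm g P μ) := by
          gcongr
          exact (hTP _).trans (by gcongr)
      _ = _ := by
          rw [← mul_assoc, ENNReal.inv_mul_cancel two_ne_zero ENNReal.ofNat_ne_top, one_mul,
            two_mul]

end Lp

/-! ### Convolutions with operator-valued kernels -/

section Kernels

variable {X Y U : Type*} [AddCommGroup X] [Module ℂ X]
  [NormedAddCommGroup Y] [InnerProductSpace ℂ Y]
  [NormedAddCommGroup U] [InnerProductSpace ℂ U]

/-- The convolution `∫₀ᵗ ⟪κ(t - s) z, u(s)⟫ ds` of a function `u` with the formal adjoint of an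
operator-valued kernel `κ`, tested against the vector `z`. -/
noncomputable def weakConv (κ : ℝ → X →ₗ[ℂ] U) (u : ℝ → U) (z : X) (t : ℝ) : ℂ :=
  ∫ s in (0 : ℝ)..t, inner ℂ (κ (t - s) z) (u s)

/-- `y` is the convolution of `u` with the adjoint of the kernel `κ`, in the weak sense: the test
vectors `z` range over a space `X` that is mapped to `Y` by `e`. One null set of times serves for
all test vectors. -/
def IsConv (e : X →ₗ[ℂ] Y) (κ : ℝ → X →ₗ[ℂ] U) (u : ℝ → U) (y : ℝ → Y) : Prop :=
  ∀ᵐ t ∂halfLine, ∀ z, inner ℂ (e z) (y t) = weakConv κ u z t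

/-- The convolution with the kernel `κ`, measured in the seminorm `N`, is dominated pointwise by
`(m * ‖u‖ ^ p) ^ (1 / p)`. When `m` is integrable this gives boundedness on `L^p`, and when `m` is
bounded it gives boundedness from `L^p` to `L^∞`. -/
def ConvBound (κ : ℝ → X →ₗ[ℂ] U) (N : X → ℝ≥0∞) (p : ℝ) (m : ℝ → ℝ≥0∞) : Prop :=
  ∀ z (u : ℝ → U), AEStronglyMeasurable u halfLine → ∀ t,
    ∫⁻ s in Ioo 0 t, ‖κ (t - s) z‖ₑ * ‖u s‖ₑ ≤
      N z * (∫⁻ s in Ioo 0 t, m (t - s) * ‖u s‖ₑ ^ p) ^ (1 / p)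

/-- Convolution with the kernel `κ`, measured in the seminorm `N`, is bounded from `L^p(0, t)`, at
every time `t` and with the same constant `C`. -/
def PointwiseConvBound (κ : ℝ → X →ₗ[ℂ] U) (N : X → ℝ≥0∞) (p : ℝ) (C : ℝ≥0∞) : Prop :=
  ∀ u : ℝ → U, AEStronglyMeasurable u halfLine → ∀ (z : X) (t : ℝ),
    ∫⁻ s in Ioo 0 t, ‖κ (t - s) z‖ₑ * ‖u s‖ₑ ≤
      N z * (C * eLpNorm u (ENNReal.ofReal p) (volume.restrict (Ioo 0 t)))

theorem measurableEmbedding_const_sub (t : ℝ) : MeasurableEmbedding fun s : ℝ => t - s :=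
  (IsometryEquiv.subLeft t).toHomeomorph.measurableEmbedding

theorem measurePreserving_sub_Ioo (t : ℝ) :
    MeasurePreserving (fun s => t - s) (volume.restrict (Ioo 0 t)) (volume.restrict (Ioo 0 t)) := by
  have h := (Measure.measurePreserving_sub_left (volume : Measure ℝ) t).restrict_preimage_emb
    (measurableEmbedding_const_sub t) (Ioo 0 t)
  have : (fun s => t - s) ⁻¹' Ioo 0 t = Ioo 0 t := by
    rw [preimage_const_sub_Ioo, sub_self, sub_zero]
  rwa [this] at h

theorem lintegral_comp_sub_Ioo (f : ℝ → ℝ≥0∞) (t : ℝ) :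
    ∫⁻ s in Ioo 0 t, f (t - s) = ∫⁻ s in Ioo 0 t, f s :=
  (measurePreserving_sub_Ioo t).lintegral_comp_emb (measurableEmbedding_const_sub t) f

theorem enorm_inner_le_enorm {E : Type*} [NormedAddCommGroup E] [InnerProductSpace ℂ E] (x y : E) :
    ‖(inner ℂ x y : ℂ)‖ₑ ≤ ‖x‖ₑ * ‖y‖ₑ := by
  simp only [enorm, ← ENNReal.coe_mul]
  exact_mod_cast nnnorm_inner_le_nnnorm x y

theorem absolutelyContinuous_Ioo (t : ℝ) : volume.restrict (Ioo 0 t) ≪ halfLine :=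
  (Measure.restrict_mono Ioo_subset_Ioi_self le_rfl).absolutelyContinuous

theorem aestronglyMeasurable_comp_sub {E : Type*} [TopologicalSpace E] {f : ℝ → E}
    (hf : AEStronglyMeasurable f halfLine) (t : ℝ) :
    AEStronglyMeasurable (fun s => f (t - s)) (volume.restrict (Ioo 0 t)) :=
  (hf.mono_ac (absolutelyContinuous_Ioo t)).comp_measurePreserving (measurePreserving_sub_Ioo t)

/-- The inequality of Young for a kernel with an integrable majorant `k`: the inequality of Hölder
is applied with the factorization `k = k ^ (1 / q) * k ^ (1 / p)`. -/
theorem ConvBound.of_pointwise {κ : ℝ → X →ₗ[ℂ] U} {N : X → ℝ≥0∞} {k : ℝ → ℝ≥0∞}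
    (hk : Measurable k) (h : ∀ t, 0 < t → ∀ z, ‖κ t z‖ₑ ≤ k t * N z) {p q : ℝ}
    (hpq : p.HolderConjugate q) :
    ConvBound κ N p fun t => (∫⁻ s in Ioi (0 : ℝ), k s) ^ (p - 1) * k t := by
  intro z u hu t
  have hp := hpq.pos
  have hq := hpq.symm.pos
  have hum : AEMeasurable (fun s => ‖u s‖ₑ) (volume.restrict (Ioo 0 t)) :=
    (hu.mono_ac (absolutelyContinuous_Ioo t)).enorm
  have hkm : Measurable fun s => k (t - s) := hk.comp (by fun_prop)
  calc ∫⁻ s in Ioo 0 t, ‖κ (t - s) z‖ₑ * ‖u s‖ₑ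
      ≤ ∫⁻ s in Ioo 0 t, N z * (k (t - s) ^ (1 / q) * (k (t - s) ^ (1 / p) * ‖u s‖ₑ)) := by
        refine setLIntegral_mono' measurableSet_Ioo fun s hs => ?_
        rw [← mul_assoc (_ ^ _), ← ENNReal.rpow_add_of_nonneg _ _ (by positivity) (by positivity),
          hpq.symm.one_div_add_one_div, one_div_one, ENNReal.rpow_one, ← mul_assoc, mul_comm (N z)]
        gcongr
        exact h _ (sub_pos.2 hs.2) z
    _ = N z * ∫⁻ s in Ioo 0 t, k (t - s) ^ (1 / q) * (k (t - s) ^ (1 / p) * ‖u s‖ₑ) :=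
        lintegral_const_mul'' _ (by fun_prop)
    _ ≤ N z * ((∫⁻ s in Ioo 0 t, (k (t - s) ^ (1 / q)) ^ q) ^ (1 / q) *
          (∫⁻ s in Ioo 0 t, (k (t - s) ^ (1 / p) * ‖u s‖ₑ) ^ p) ^ (1 / p)) := by
        gcongr
        exact ENNReal.lintegral_mul_le_Lp_mul_Lq _ hpq.symm (by fun_prop) (by fun_prop)
    _ = N z * ((∫⁻ s in Ioo 0 t, k (t - s)) ^ (1 / q) *
          (∫⁻ s in Ioo 0 t, k (t - s) * ‖u s‖ₑ ^ p) ^ (1 / p)) := by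
        simp_rw [ENNReal.mul_rpow_of_nonneg _ _ hp.le, ← ENNReal.rpow_mul, one_div,
          inv_mul_cancel₀ hp.ne', inv_mul_cancel₀ hq.ne', ENNReal.rpow_one]
    _ ≤ N z * ((∫⁻ s in Ioi (0 : ℝ), k s) ^ (1 / q) *
          (∫⁻ s in Ioo 0 t, k (t - s) * ‖u s‖ₑ ^ p) ^ (1 / p)) := by
        gcongr N z * (?_ ^ (1 / q) * _)
        refine (lintegral_comp_sub_Ioo k t).trans_le ?_
        exact lintegral_mono_set Ioo_subset_Ioi_self
    _ = _ := by
        congr 1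
        have h1 : 1 / q = (p - 1) * (1 / p) := by
          rw [one_div, one_div, ← hpq.one_sub_inv]
          field_simp
        rw [h1, ENNReal.rpow_mul, ← ENNReal.mul_rpow_of_nonneg _ _ (by positivity),
          ← lintegral_const_mul'' _ (by fun_prop)]
        simp_rw [mul_assoc]

/-- A kernel that belongs strongly to `L^q`, with an exponential weight `e^{at}` to spare: the
inequality of Hölder leaves the integrable weight `e^{-apt}` on the side of `u`. The constant is
uniform in `z`, although the kernel need not have a majorant in operator norm. -/
theorem ConvBound.of_weighted {κ : ℝ → X →ₗ[ℂ] U} {N : X → ℝ≥0∞}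
    (hκ : ∀ z, AEStronglyMeasurable (fun t => κ t z) halfLine) {a p q : ℝ} {C : ℝ≥0∞}
    (hpq : p.HolderConjugate q)
    (h : ∀ z, ∫⁻ t in Ioi (0 : ℝ), (ENNReal.ofReal (Real.exp (a * t)) * ‖κ t z‖ₑ) ^ q ≤
      (C * N z) ^ q) :
    ConvBound κ N p fun t => (C * ENNReal.ofReal (Real.exp (-a * t))) ^ p := by
  intro z u hu t
  have hp := hpq.pos
  have hq := hpq.symm.pos
  have hum : AEMeasurable (fun s => ‖u s‖ₑ) (volume.restrict (Ioo 0 t)) :=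
    (hu.mono_ac (absolutelyContinuous_Ioo t)).enorm
  have hkm : AEMeasurable (fun s => ‖κ (t - s) z‖ₑ) (volume.restrict (Ioo 0 t)) :=
    (aestronglyMeasurable_comp_sub (hκ z) t).enorm
  calc ∫⁻ s in Ioo 0 t, ‖κ (t - s) z‖ₑ * ‖u s‖ₑ
      = ∫⁻ s in Ioo 0 t, (ENNReal.ofReal (Real.exp (a * (t - s))) * ‖κ (t - s) z‖ₑ) *
          (ENNReal.ofReal (Real.exp (-a * (t - s))) * ‖u s‖ₑ) := by
        refine lintegral_congr fun s => ?_
        rw [mul_mul_mul_comm, ← ENNReal.ofReal_mul (Real.exp_nonneg _), ← Real.exp_add]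
        simp
    _ ≤ (∫⁻ s in Ioo 0 t,
            (ENNReal.ofReal (Real.exp (a * (t - s))) * ‖κ (t - s) z‖ₑ) ^ q) ^ (1 / q) *
          (∫⁻ s in Ioo 0 t, (ENNReal.ofReal (Real.exp (-a * (t - s))) * ‖u s‖ₑ) ^ p) ^ (1 / p) :=
        ENNReal.lintegral_mul_le_Lp_mul_Lq _ hpq.symm (by fun_prop) (by fun_prop)
    _ ≤ ((C * N z) ^ q) ^ (1 / q) *
          (∫⁻ s in Ioo 0 t, (ENNReal.ofReal (Real.exp (-a * (t - s))) * ‖u s‖ₑ) ^ p) ^ (1 / p) := by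
        gcongr
        refine (lintegral_comp_sub_Ioo
          (fun s => (ENNReal.ofReal (Real.exp (a * s)) * ‖κ s z‖ₑ) ^ q) t).trans_le ?_
        exact (lintegral_mono_set Ioo_subset_Ioi_self).trans (h z)
    _ = N z * (C * (∫⁻ s in Ioo 0 t,
          (ENNReal.ofReal (Real.exp (-a * (t - s))) * ‖u s‖ₑ) ^ p) ^ (1 / p)) := by
        rw [← ENNReal.rpow_mul, mul_one_div_cancel hq.ne', ENNReal.rpow_one]
        ring
    _ = _ := by
        congr 1
        simp_rw [ENNReal.mul_rpow_of_nonneg _ _ hp.le, mul_assoc]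
        rw [lintegral_const_mul'' _ (by fun_prop), ENNReal.mul_rpow_of_nonneg _ _ (by positivity),
          ← ENNReal.rpow_mul C, mul_one_div_cancel hp.ne', ENNReal.rpow_one]

theorem enorm_weakConv_le (κ : ℝ → X →ₗ[ℂ] U) (u : ℝ → U) (z : X) {t : ℝ} (ht : 0 ≤ t) :
    ‖weakConv κ u z t‖ₑ ≤ ∫⁻ s in Ioo 0 t, ‖κ (t - s) z‖ₑ * ‖u s‖ₑ := by
  rw [weakConv, intervalIntegral.integral_of_le ht, integral_Ioc_eq_integral_Ioo]
  exact (enorm_integral_le_lintegral_enorm _).trans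
    (lintegral_mono fun s => enorm_inner_le_enorm _ _)

theorem aestronglyMeasurable_weakConv {κ : ℝ → X →ₗ[ℂ] U} {u : ℝ → U} {z : X}
    (hκ : AEStronglyMeasurable (fun t => κ t z) halfLine) (hu : AEStronglyMeasurable u halfLine) :
    AEStronglyMeasurable (weakConv κ u z) halfLine := by
  set k₀ : ℝ → U := (Ioi 0).indicator fun t => κ t z with hk₀
  set u₀ : ℝ → U := (Ioi 0).indicator u with hu₀
  have hk : AEStronglyMeasurable k₀ volume :=
    (aestronglyMeasurable_indicator_iff measurableSet_Ioi).2 hκ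
  have hu' : AEStronglyMeasurable u₀ volume :=
    (aestronglyMeasurable_indicator_iff measurableSet_Ioi).2 hu
  have h1 : AEStronglyMeasurable (fun p : ℝ × ℝ => inner ℂ (k₀ (p.1 - p.2)) (u₀ p.2))
      (volume.prod volume) := by
    have h2 : AEStronglyMeasurable (fun p : ℝ × ℝ => k₀ (p.1 - p.2)) (volume.prod volume) :=
      hk.comp_quasiMeasurePreserving (quasiMeasurePreserving_sub_of_right_invariant volume volume)
    have h3 : AEStronglyMeasurable (fun p : ℝ × ℝ => u₀ p.2) (volume.prod volume) :=
      hu'.comp_quasiMeasurePreserving Measure.quasiMeasurePreserving_snd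
    exact h2.inner h3
  refine (h1.integral_prod_right'.mono_measure Measure.restrict_le_self).congr ?_
  filter_upwards [ae_restrict_mem measurableSet_Ioi] with t ht
  rw [weakConv, intervalIntegral.integral_of_le (le_of_lt ht), integral_Ioc_eq_integral_Ioo,
    ← integral_indicator measurableSet_Ioo]
  congr 1
  ext s
  by_cases h1 : 0 < s <;> by_cases h2 : s < t <;> simp [hk₀, hu₀, h1, h2, indicator]

theorem integrableOn_weakConv {κ : ℝ → X →ₗ[ℂ] U} {u : ℝ → U} {z : X}
    (hκ : AEStronglyMeasurable (fun t => κ t z) halfLine) (hu : AEStronglyMeasurable u halfLine)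
    {t : ℝ} (ht : 0 ≤ t) (hfin : ∫⁻ s in Ioo 0 t, ‖κ (t - s) z‖ₑ * ‖u s‖ₑ < ∞) :
    IntervalIntegrable (fun s => inner ℂ (κ (t - s) z) (u s)) volume 0 t := by
  rw [intervalIntegrable_iff_integrableOn_Ioo_of_le ht]
  refine ⟨(aestronglyMeasurable_comp_sub hκ t).inner
    (hu.mono_ac (absolutelyContinuous_Ioo t)), ?_⟩
  exact (lintegral_mono fun s => enorm_inner_le_enorm _ _).trans_lt hfin

theorem weakConv_add_left {κ : ℝ → X →ₗ[ℂ] U} {u : ℝ → U} {z w : X} {t : ℝ}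
    (hz : IntervalIntegrable (fun s => inner ℂ (κ (t - s) z) (u s)) volume 0 t)
    (hw : IntervalIntegrable (fun s => inner ℂ (κ (t - s) w) (u s)) volume 0 t) :
    weakConv κ u (z + w) t = weakConv κ u z t + weakConv κ u w t := by
  simp only [weakConv, _root_.map_add, inner_add_left]
  exact intervalIntegral.integral_add hz hw

theorem weakConv_smul_left (κ : ℝ → X →ₗ[ℂ] U) (u : ℝ → U) (c : ℂ) (z : X) (t : ℝ) :
    weakConv κ u (c • z) t = starRingEnd ℂ c * weakConv κ u z t := by
  simp only [weakConv, map_smul, inner_smul_left]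
  exact intervalIntegral.integral_const_mul _ _

theorem weakConv_add_right {κ : ℝ → X →ₗ[ℂ] U} {u v : ℝ → U} {z : X} {t : ℝ}
    (hu : IntervalIntegrable (fun s => inner ℂ (κ (t - s) z) (u s)) volume 0 t)
    (hv : IntervalIntegrable (fun s => inner ℂ (κ (t - s) z) (v s)) volume 0 t) :
    weakConv κ (u + v) z t = weakConv κ u z t + weakConv κ v z t := by
  simp only [weakConv, Pi.add_apply, inner_add_right]
  exact intervalIntegral.integral_add hu hv

theorem weakConv_smul_right (κ : ℝ → X →ₗ[ℂ] U) (u : ℝ → U) (c : ℂ) (z : X) (t : ℝ) :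
    weakConv κ (c • u) z t = c * weakConv κ u z t := by
  simp only [weakConv, Pi.smul_apply, inner_smul_right]
  exact intervalIntegral.integral_const_mul _ _

theorem weakConv_congr_right (κ : ℝ → X →ₗ[ℂ] U) {u v : ℝ → U} (h : u =ᵐ[halfLine] v) (z : X)
    {t : ℝ} (ht : 0 ≤ t) : weakConv κ u z t = weakConv κ v z t := by
  refine intervalIntegral.integral_congr_ae ?_
  filter_upwards [(ae_restrict_iff' measurableSet_Ioi).1 h] with s hs hst
  rw [uIoc_of_le ht] at hst
  rw [hs hst.1]

/-- At a time where the convolution is bounded in terms of `e z`, it is represented by a vector. -/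
theorem exists_inner_eq_weakConv [CompleteSpace Y] {e : X →ₗ[ℂ] Y} {κ : ℝ → X →ₗ[ℂ] U}
    {u : ℝ → U} (hκ : ∀ z, AEStronglyMeasurable (fun t => κ t z) halfLine)
    (hu : AEStronglyMeasurable u halfLine) {t : ℝ} (ht : 0 ≤ t) {c : ℝ≥0∞} (hc : c ≠ ∞)
    (h : ∀ z, ∫⁻ s in Ioo 0 t, ‖κ (t - s) z‖ₑ * ‖u s‖ₑ ≤ ‖e z‖ₑ * c) :
    ∃ y : Y, ∀ z, inner ℂ (e z) y = weakConv κ u z t := by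
  have hint (z : X) := integrableOn_weakConv (hκ z) hu ht
    ((h z).trans_lt (ENNReal.mul_lt_top enorm_lt_top hc.lt_top))
  let φ : X →ₗ[ℂ] ℂ :=
    { toFun := fun z => starRingEnd ℂ (weakConv κ u z t)
      map_add' := fun z w => by rw [weakConv_add_left (hint z) (hint w), _root_.map_add]
      map_smul' := fun a z => by
        rw [weakConv_smul_left, map_mul, Complex.conj_conj, RingHom.id_apply, smul_eq_mul] }
  obtain ⟨y, -, hy⟩ := exists_inner_eq_of_norm_le e φ (c := c.toReal) ENNReal.toReal_nonneg
    fun z => by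
    have h1 := (enorm_weakConv_le κ u z ht).trans (h z)
    have h2 : ‖φ z‖ = (‖weakConv κ u z t‖ₑ).toReal := by
      rw [toReal_enorm]
      exact RCLike.norm_conj _
    rw [h2, mul_comm]
    refine (ENNReal.toReal_mono (ENNReal.mul_ne_top enorm_ne_top hc) h1).trans_eq ?_
    rw [ENNReal.toReal_mul, toReal_enorm]
  refine ⟨y, fun z => ?_⟩
  rw [← inner_conj_symm, hy z]
  exact Complex.conj_conj _

theorem IsConv.congr {e : X →ₗ[ℂ] Y} {κ : ℝ → X →ₗ[ℂ] U} {u v : ℝ → U} {y w : ℝ → Y}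
    (h : IsConv e κ u y) (huv : u =ᵐ[halfLine] v) (hyw : y =ᵐ[halfLine] w) : IsConv e κ v w := by
  filter_upwards [h, hyw, ae_restrict_mem measurableSet_Ioi] with t h1 h2 ht z
  rw [← h2, h1, weakConv_congr_right κ huv z (le_of_lt ht)]

theorem IsConv.unique {e : X →ₗ[ℂ] Y} (he : DenseRange e) {κ : ℝ → X →ₗ[ℂ] U} {u : ℝ → U}
    {y w : ℝ → Y} (h : IsConv e κ u y) (h' : IsConv e κ u w) : y =ᵐ[halfLine] w := by
  filter_upwards [h, h'] with t h1 h2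
  exact he.eq_of_inner_right ℂ fun z => by rw [h1, h2]

variable {e : X →ₗ[ℂ] Y} {κ : ℝ → X →ₗ[ℂ] U} {p : ℝ} {m : ℝ → ℝ≥0∞}

/-- The convolution integrals converge at almost every time, simultaneously for all test vectors. -/
theorem ConvBound.ae_lt_top {N : X → ℝ≥0∞} (hB : ConvBound κ N p m) (hN : ∀ z, N z ≠ ∞) (hp : 0 < p)
    (hm : Measurable m) (hmi : ∫⁻ t in Ioi (0 : ℝ), m t ≠ ∞) {u : ℝ → U}
    (hu : MemLp u (ENNReal.ofReal p) halfLine) :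
    ∀ᵐ t ∂halfLine, (∫⁻ s in Ioo 0 t, m (t - s) * ‖u s‖ₑ ^ p) ^ (1 / p) ≠ ∞ ∧
      ∀ z, ∫⁻ s in Ioo 0 t, ‖κ (t - s) z‖ₑ * ‖u s‖ₑ < ∞ := by
  have hg : AEMeasurable (fun s => ‖u s‖ₑ ^ p) halfLine := hu.1.enorm.pow_const p
  have hgi : ∫⁻ t, ‖u t‖ₑ ^ p ∂halfLine ≠ ∞ := by
    have := hu.2
    rw [eLpNorm_ofReal_eq hp] at this
    intro h
    simp [h, hp] at this
  have h1 : ∀ᵐ t ∂halfLine, ∫⁻ s in Ioo 0 t, m (t - s) * ‖u s‖ₑ ^ p < ∞ := by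
    refine ae_lt_top' (aemeasurable_convolution_halfLine hm hg) ?_
    rw [lintegral_convolution_halfLine hm hg]
    exact ENNReal.mul_ne_top hmi hgi
  filter_upwards [h1] with t ht
  have h2 := ENNReal.rpow_ne_top_of_nonneg (one_div_nonneg.2 hp.le) ht.ne
  exact ⟨h2, fun z => (hB z u hu.1 t).trans_lt (ENNReal.mul_lt_top (hN z).lt_top h2.lt_top)⟩

theorem ConvBound.ae_enorm_le (he : DenseRange e) (hB : ConvBound κ (fun z => ‖e z‖ₑ) p m)
    {u : ℝ → U} (hu : AEStronglyMeasurable u halfLine) {y : ℝ → Y} (hy : IsConv e κ u y) :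
    ∀ᵐ t ∂halfLine, ‖y t‖ₑ ≤ (∫⁻ s in Ioo 0 t, m (t - s) * ‖u s‖ₑ ^ p) ^ (1 / p) := by
  filter_upwards [hy, ae_restrict_mem measurableSet_Ioi] with t ht ht0
  refine enorm_le_of_dense_inner he fun z => ?_
  rw [ht]
  exact (enorm_weakConv_le κ u z (le_of_lt ht0)).trans (hB z u hu t)

/-- A kernel that is dominated by an integrable function maps `L^p` to `L^p`. -/
theorem ConvBound.eLpNorm_le (he : DenseRange e) (hB : ConvBound κ (fun z => ‖e z‖ₑ) p m)
    (hp : 0 < p) (hm : Measurable m) {u : ℝ → U} (hu : AEStronglyMeasurable u halfLine) {y : ℝ → Y}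
    (hy : IsConv e κ u y) :
    eLpNorm y (ENNReal.ofReal p) halfLine ≤
      (∫⁻ t in Ioi (0 : ℝ), m t) ^ (1 / p) * eLpNorm u (ENNReal.ofReal p) halfLine := by
  rw [eLpNorm_ofReal_eq hp, eLpNorm_ofReal_eq hp, ← ENNReal.mul_rpow_of_nonneg _ _ (by positivity),
    ← lintegral_convolution_halfLine hm (hu.enorm.pow_const p)]
  refine ENNReal.rpow_le_rpow (lintegral_mono_ae ?_) (by positivity)
  filter_upwards [hB.ae_enorm_le he hu hy] with t ht
  refine (ENNReal.rpow_le_rpow ht hp.le).trans_eq ?_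
  rw [← ENNReal.rpow_mul, one_div_mul_cancel hp.ne', ENNReal.rpow_one]

/-- A kernel that is dominated by a bounded function maps `L^p` to `L^∞`. -/
theorem ConvBound.eLpNorm_top_le (he : DenseRange e) (hB : ConvBound κ (fun z => ‖e z‖ₑ) p m)
    (hp : 0 < p) {C : ℝ≥0∞} (hC : ∀ t, 0 < t → m t ≤ C ^ p) {u : ℝ → U}
    (hu : AEStronglyMeasurable u halfLine) {y : ℝ → Y} (hy : IsConv e κ u y) :
    eLpNorm y ∞ halfLine ≤ C * eLpNorm u (ENNReal.ofReal p) halfLine := by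
  rw [eLpNorm_exponent_top]
  refine essSup_le_of_ae_le _ ?_
  filter_upwards [hB.ae_enorm_le he hu hy] with t ht
  refine ht.trans ?_
  rw [eLpNorm_ofReal_eq hp]
  calc (∫⁻ s in Ioo 0 t, m (t - s) * ‖u s‖ₑ ^ p) ^ (1 / p)
      ≤ (∫⁻ s in Ioo 0 t, C ^ p * ‖u s‖ₑ ^ p) ^ (1 / p) := by
        refine ENNReal.rpow_le_rpow (setLIntegral_mono' measurableSet_Ioo fun s hs => ?_)
          (by positivity)
        gcongr
        exact hC _ (sub_pos.2 hs.2)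
    _ ≤ (C ^ p * ∫⁻ s, ‖u s‖ₑ ^ p ∂halfLine) ^ (1 / p) := by
        refine ENNReal.rpow_le_rpow ?_ (by positivity)
        rw [← lintegral_const_mul'' _ (hu.enorm.pow_const p)]
        exact lintegral_mono_set Ioo_subset_Ioi_self
    _ = _ := by
        rw [ENNReal.mul_rpow_of_nonneg _ _ (by positivity), ← ENNReal.rpow_mul,
          mul_one_div_cancel hp.ne', ENNReal.rpow_one]

/-- The weak convolution with a kernel that is dominated by an integrable function is given by a
measurable function: it is represented by a vector at almost every time, and measurability follows
from the theorem of Pettis. -/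
theorem ConvBound.exists_isConv [CompleteSpace Y] [TopologicalSpace.SeparableSpace Y]
    (he : DenseRange e) (hκ : ∀ z, AEStronglyMeasurable (fun t => κ t z) halfLine)
    (hB : ConvBound κ (fun z => ‖e z‖ₑ) p m) (hp : 0 < p) (hm : Measurable m)
    (hmi : ∫⁻ t in Ioi (0 : ℝ), m t ≠ ∞) {u : ℝ → U} (hu : MemLp u (ENNReal.ofReal p) halfLine) :
    ∃ y : ℝ → Y, MemLp y (ENNReal.ofReal p) halfLine ∧ IsConv e κ u y := by
  classical
  have hex : ∀ᵐ t ∂halfLine, ∃ y : Y, ∀ z, inner ℂ (e z) y = weakConv κ u z t := by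
    filter_upwards [hB.ae_lt_top (fun z => enorm_ne_top) hp hm hmi hu,
      ae_restrict_mem measurableSet_Ioi] with t ht ht0
    exact exists_inner_eq_weakConv hκ hu.1 (le_of_lt ht0) ht.1 fun z => hB z u hu.1 t
  let y : ℝ → Y := fun t =>
    if h : ∃ y : Y, ∀ z, inner ℂ (e z) y = weakConv κ u z t then h.choose else 0
  have hy : IsConv e κ u y := by
    filter_upwards [hex] with t ht
    simp only [y, dif_pos ht]
    exact ht.choose_spec
  have hym : AEStronglyMeasurable y halfLine := by
    refine aestronglyMeasurable_of_inner he fun z => ?_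
    refine (aestronglyMeasurable_weakConv (hκ z) hu.1).congr ?_
    filter_upwards [hy] with t ht
    rw [ht]
  refine ⟨y, ⟨hym, ?_⟩, hy⟩
  exact (hB.eLpNorm_le he hp hm hu.1 hy).trans_lt
    (ENNReal.mul_lt_top (ENNReal.rpow_lt_top_of_nonneg (by positivity) hmi) hu.2)

/-- The convolution operator of a kernel, as a bounded operator on `L²(0, ∞)`. -/
theorem ConvBound.exists_convOp [CompleteSpace Y] [TopologicalSpace.SeparableSpace Y]
    (he : DenseRange e) (hκ : ∀ z, AEStronglyMeasurable (fun t => κ t z) halfLine)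
    (hB : ConvBound κ (fun z => ‖e z‖ₑ) 2 m) (hm : Measurable m)
    (hmi : ∫⁻ t in Ioi (0 : ℝ), m t ≠ ∞) :
    ∃ L : Lp U 2 halfLine →L[ℂ] Lp Y 2 halfLine, (∀ u : Lp U 2 halfLine, IsConv e κ u (L u)) ∧
      ‖L‖ ≤ ((∫⁻ t in Ioi (0 : ℝ), m t) ^ (1 / 2 : ℝ)).toReal := by
  have h2 : ENNReal.ofReal 2 = 2 := by simp
  have hu (u : Lp U 2 halfLine) : MemLp u (ENNReal.ofReal 2) halfLine := by
    rw [h2]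
    exact Lp.memLp u
  choose y hy hyc using fun u : Lp U 2 halfLine => hB.exists_isConv he hκ two_pos hm hmi (hu u)
  simp only [h2] at hy
  have hL (u : Lp U 2 halfLine) : IsConv e κ u ((hy u).toLp (y u)) :=
    (hyc u).congr (ae_eq_refl _) (hy u).coeFn_toLp.symm
  have hint (u : Lp U 2 halfLine) : ∀ᵐ t ∂halfLine, ∀ z,
      IntervalIntegrable (fun s => inner ℂ (κ (t - s) z) (u s)) volume 0 t := by
    filter_upwards [hB.ae_lt_top (fun z => enorm_ne_top) two_pos hm hmi (hu u),
      ae_restrict_mem measurableSet_Ioi] with t ht ht0 z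
    exact integrableOn_weakConv (hκ z) (hu u).1 (le_of_lt ht0) (ht.2 z)
  let L₀ : Lp U 2 halfLine →ₗ[ℂ] Lp Y 2 halfLine :=
    { toFun := fun u => (hy u).toLp (y u)
      map_add' := fun u v => by
        refine Lp.ext ((hL (u + v)).unique he ?_)
        filter_upwards [hL u, hL v, Lp.coeFn_add ((hy u).toLp (y u)) ((hy v).toLp (y v)), hint u,
          hint v, ae_restrict_mem measurableSet_Ioi] with t h1 h2 h3 h4 h5 ht0 z
        rw [h3, Pi.add_apply, inner_add_right, h1, h2,
          weakConv_congr_right κ (Lp.coeFn_add u v) z (le_of_lt ht0),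
          weakConv_add_right (h4 z) (h5 z)]
      map_smul' := fun c u => by
        refine Lp.ext ((hL (c • u)).unique he ?_)
        filter_upwards [hL u, Lp.coeFn_smul c ((hy u).toLp (y u)),
          ae_restrict_mem measurableSet_Ioi] with t h1 h3 ht0 z
        rw [RingHom.id_apply, h3, Pi.smul_apply, inner_smul_right, h1,
          weakConv_congr_right κ (Lp.coeFn_smul c u) z (le_of_lt ht0), weakConv_smul_right] }
  have hbound (u : Lp U 2 halfLine) :
      ‖L₀ u‖ ≤ ((∫⁻ t in Ioi (0 : ℝ), m t) ^ (1 / 2 : ℝ)).toReal * ‖u‖ := by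
    have h1 := hB.eLpNorm_le he two_pos hm (hu u).1 (hL u)
    rw [h2] at h1
    rw [Lp.norm_def, Lp.norm_def, ← ENNReal.toReal_mul]
    exact ENNReal.toReal_mono (ENNReal.mul_ne_top
      (ENNReal.rpow_ne_top_of_nonneg (by positivity) hmi) (Lp.eLpNorm_ne_top u)) h1
  exact ⟨L₀.mkContinuous _ hbound, hL, L₀.mkContinuous_norm_le ENNReal.toReal_nonneg hbound⟩

end Kernels

/-! ### The kernel `B* e^{A* t}` and its singular part -/

/-- Summation over blocks, for a family of kernels: the constant does not depend on the test vector.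
-/
theorem exists_exp_bound_of_blocks {X U : Type*} [AddCommGroup X] [Module ℂ X]
    [NormedAddCommGroup U] [NormedSpace ℂ U] {κ : ℝ → X →ₗ[ℂ] U}
    {N : X → ℝ≥0∞} {p τ ω : ℝ} (hp : 0 < p) (hτ : 0 < τ) (hω : 0 < ω) {C : ℝ≥0∞} (hC : C ≠ ∞)
    (h : ∀ z, ∀ k : ℕ, ∫⁻ t in Ioc 0 τ, ‖κ (t + k * τ) z‖ₑ ^ p ≤
      (ENNReal.ofReal (Real.exp (-ω * (k * τ))) * (C * N z)) ^ p) :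
    ∃ C' : ℝ≥0∞, C' ≠ ∞ ∧ ∀ z, ∫⁻ t in Ioi (0 : ℝ),
      (ENNReal.ofReal (Real.exp (ω / 2 * t)) * ‖κ t z‖ₑ) ^ p ≤ (C' * N z) ^ p := by
  set A := ENNReal.ofReal (Real.exp (ω / 2 * τ) ^ p * (1 - Real.exp (-(ω / 2) * τ) ^ p)⁻¹) with hA
  refine ⟨A ^ (1 / p) * C, ENNReal.mul_ne_top (ENNReal.rpow_ne_top_of_nonneg (by positivity)
    ENNReal.ofReal_ne_top) hC, fun z => ?_⟩
  refine (lintegral_exp_mul_le_of_blocks (f := fun t => ‖κ t z‖ₑ) hp hτ hω (h z)).trans_eq ?_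
  rw [← hA, mul_assoc, ENNReal.mul_rpow_of_nonneg _ (C * N z) hp.le, ← ENNReal.rpow_mul,
    one_div_mul_cancel hp.ne', ENNReal.rpow_one]

theorem eLpNorm_le_add_of_enorm_le {U : Type*} [NormedAddCommGroup U] {τ p : ℝ} (hp : 1 ≤ p)
    {f : ℝ → U} {g : ℝ → ℝ} {h : ℝ → U} (hf : ∀ t ∈ Ioc 0 τ, ‖f t‖ₑ ≤ ‖g t‖ₑ + ‖h t‖ₑ)
    (hg : AEStronglyMeasurable g (volume.restrict (Ioc 0 τ)))
    (hh : AEStronglyMeasurable h (volume.restrict (Ioc 0 τ))) :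
    eLpNorm f (ENNReal.ofReal p) (volume.restrict (Ioc 0 τ)) ≤
      eLpNorm g (ENNReal.ofReal p) (volume.restrict (Ioc 0 τ)) +
        eLpNorm h (ENNReal.ofReal p) (volume.restrict (Ioc 0 τ)) := by
  have h1 : 1 ≤ ENNReal.ofReal p := by simpa using hp
  rw [← eLpNorm_norm g, ← eLpNorm_norm h]
  refine le_trans ?_ (eLpNorm_add_le hg.norm hh.norm h1)
  refine eLpNorm_mono_enorm_ae ?_
  filter_upwards [ae_restrict_mem measurableSet_Ioc] with t ht
  refine (hf t ht).trans_eq ?_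
  rw [Pi.add_apply, Real.enorm_of_nonneg (r := ‖g t‖ + ‖h t‖) (by positivity),
    ENNReal.ofReal_add (norm_nonneg _) (norm_nonneg _), ofReal_norm, ofReal_norm]

section ControlKernel

variable {Y U : Type*}
  [NormedAddCommGroup Y] [InnerProductSpace ℂ Y] [CompleteSpace Y]
  [NormedAddCommGroup U] [InnerProductSpace ℂ U] [CompleteSpace U]

/-- The inclusion `D(A*) → Y` as a linear map. -/
def C0Semigroup.adjIncl (S : C0Semigroup Y) : S.AdjDom →ₗ[ℂ] Y where
  toFun := C0Semigroup.AdjDom.toY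
  map_add' _ _ := rfl
  map_smul' _ _ := rfl

@[simp]
theorem C0Semigroup.adjIncl_apply (S : C0Semigroup Y) (z : S.AdjDom) : S.adjIncl z = z.toY := rfl

theorem C0Semigroup.toY_adjEvolve (S : C0Semigroup Y) (t : ℝ≥0) (z : S.AdjDom) :
    (S.adjEvolve t z).toY = S.adj t z.toY := rfl

theorem C0Semigroup.adjEvolve_add (S : C0Semigroup Y) (s t : ℝ≥0) (z : S.AdjDom) :
    S.adjEvolve (s + t) z = S.adjEvolve s (S.adjEvolve t z) :=
  Subtype.ext (Prod.ext (S.adj_add_apply s t _) (S.adj_add_apply s t _))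

/-- The operators `B* e^{A* t} : D(A*) → U`. For `t < 0` the value is that at `t = 0`. -/
noncomputable def ctrlKernel (S : C0Semigroup Y) (B : U →L[ℂ] S.Extrap) (t : ℝ) :
    S.AdjDom →ₗ[ℂ] U where
  toFun z := ctrlAdj S B (S.adjEvolve t.toNNReal z)
  map_add' z w := by
    have : S.adjEvolve t.toNNReal (z + w) = S.adjEvolve t.toNNReal z + S.adjEvolve t.toNNReal w :=
      Subtype.ext (Prod.ext (map_add (S.adj _) _ _) (map_add (S.adj _) _ _))
    simp [this, ctrlAdj]
  map_smul' c z := by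
    have : S.adjEvolve t.toNNReal (c • z) = c • S.adjEvolve t.toNNReal z :=
      Subtype.ext (Prod.ext (map_smul (S.adj _) _ _) (map_smul (S.adj _) _ _))
    rw [this, ctrlAdj, map_smulₛₗ, map_smulₛₗ, starRingEnd_self_apply]
    rfl

theorem ctrlKernel_apply (S : C0Semigroup Y) (B : U →L[ℂ] S.Extrap) (t : ℝ) (z : S.AdjDom) :
    ctrlKernel S B t z = ctrlAdj S B (S.adjEvolve t.toNNReal z) := rfl

theorem ctrlKernel_add (S : C0Semigroup Y) (B : U →L[ℂ] S.Extrap) {s t : ℝ} (hs : 0 ≤ s)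
    (ht : 0 ≤ t) (z : S.AdjDom) :
    ctrlKernel S B (s + t) z = ctrlKernel S B s (S.adjEvolve t.toNNReal z) := by
  rw [ctrlKernel_apply, ctrlKernel_apply, Real.toNNReal_add hs ht, S.adjEvolve_add]

theorem continuous_ctrlKernel (S : C0Semigroup Y) (hS : S.ExpStable) (B : U →L[ℂ] S.Extrap)
    (z : S.AdjDom) : Continuous fun t => ctrlKernel S B t z := by
  have h1 : Continuous fun t : ℝ => S.adjEvolve t.toNNReal z :=
    Continuous.subtype_mk (((S.adjSemigroup hS).continuous_orbit z.1.1).prodMk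
      ((S.adjSemigroup hS).continuous_orbit z.1.2)) _
  exact (InnerProductSpace.toDual ℂ U).symm.continuous.comp (B.flip.continuous.comp h1)

/-- The mild solution is the sum of the free evolution and of the weak convolution of the control
with the kernel `B* e^{A* t}`. -/
theorem isStateAt_iff (S : C0Semigroup Y) (B : U →L[ℂ] S.Extrap) (x : Y) (u : Lp U 2 halfLine)
    (t : ℝ≥0) (y : Y) :
    IsStateAt S B x u t y ↔
      ∀ z : S.AdjDom,
        inner ℂ z.toY y = inner ℂ z.toY (S t x) + weakConv (ctrlKernel S B) u z t := by
  simp only [IsStateAt, weakConv, ctrlKernel_apply, inner_ctrlAdj]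

theorem setLIntegral_rpow_le_of_eLpNorm_le {E : Type*} [NormedAddCommGroup E] {f : ℝ → E} {p a : ℝ}
    (hp : 0 < p) {c : ℝ≥0∞} (h : eLpNorm f (ENNReal.ofReal p) (volume.restrict (Ioc 0 a)) ≤ c) :
    ∫⁻ t in Ioc 0 a, ‖f t‖ₑ ^ p ≤ c ^ p := by
  rw [eLpNorm_ofReal_eq hp] at h
  have := ENNReal.rpow_le_rpow h hp.le
  rwa [← ENNReal.rpow_mul, one_div_mul_cancel hp.ne', ENNReal.rpow_one] at this

theorem lintegral_Ioc_ofReal_rpow_neg {a s : ℝ} (ha : 0 ≤ a) (hs : s < 1) :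
    ∫⁻ t in Ioc 0 a, ENNReal.ofReal (t ^ (-s)) = ENNReal.ofReal (a ^ (1 - s) / (1 - s)) := by
  have h1 : IntegrableOn (fun t : ℝ => t ^ (-s)) (Ioc 0 a) := by
    have := intervalIntegral.intervalIntegrable_rpow' (a := 0) (b := a) (r := -s) (by linarith)
    rwa [intervalIntegrable_iff_integrableOn_Ioc_of_le ha] at this
  rw [← ofReal_integral_eq_lintegral_ofReal h1, ← intervalIntegral.integral_of_le ha,
    integral_rpow (Or.inl (by linarith))]
  · rw [Real.zero_rpow (by linarith), sub_zero, neg_add_eq_sub]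
  · filter_upwards [ae_restrict_mem measurableSet_Ioc] with t ht
    exact Real.rpow_nonneg ht.1.le _

/-- A block bound for `B* e^{A* t}` on a first interval `(0, τ)` propagates to the half-line by the
semigroup law. -/
theorem exists_exp_bound_ctrlKernel (S : C0Semigroup Y) (B : U →L[ℂ] S.Extrap)
    {N : S.AdjDom → ℝ≥0∞} {M ω p τ : ℝ} (hM : 0 ≤ M) (hω : 0 < ω) (hp : 0 < p) (hτ : 0 < τ)
    (hN : ∀ (t : ℝ≥0) z, N (S.adjEvolve t z) ≤ ENNReal.ofReal (M * Real.exp (-ω * t)) * N z)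
    {C : ℝ≥0∞} (hC : C ≠ ∞)
    (h : ∀ z, eLpNorm (fun t => ctrlKernel S B t z) (ENNReal.ofReal p)
      (volume.restrict (Ioc 0 τ)) ≤ C * N z) :
    ∃ C' : ℝ≥0∞, C' ≠ ∞ ∧ ∀ z, ∫⁻ t in Ioi (0 : ℝ),
      (ENNReal.ofReal (Real.exp (ω / 2 * t)) * ‖ctrlKernel S B t z‖ₑ) ^ p ≤ (C' * N z) ^ p := by
  refine exists_exp_bound_of_blocks hp hτ hω (C := ENNReal.ofReal M * C)
    (ENNReal.mul_ne_top ENNReal.ofReal_ne_top hC) fun z k => ?_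
  have hk : (0 : ℝ) ≤ k * τ := by positivity
  have h1 : ∫⁻ t in Ioc 0 τ, ‖ctrlKernel S B (t + k * τ) z‖ₑ ^ p =
      ∫⁻ t in Ioc 0 τ, ‖ctrlKernel S B t (S.adjEvolve (k * τ).toNNReal z)‖ₑ ^ p :=
    setLIntegral_congr_fun measurableSet_Ioc fun t ht => by
      simp only [ctrlKernel_add S B ht.1.le hk]
  rw [h1]
  refine setLIntegral_rpow_le_of_eLpNorm_le hp ((h _).trans ?_)
  have h2 := hN (k * τ).toNNReal z
  rw [Real.coe_toNNReal _ hk, ENNReal.ofReal_mul hM] at h2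
  calc C * N (S.adjEvolve (k * τ).toNNReal z)
      ≤ C * (ENNReal.ofReal M * ENNReal.ofReal (Real.exp (-ω * (k * τ))) * N z) := by gcongr
    _ = _ := by ring

end ControlKernel

section NearKernel

variable {Y U : Type*}
  [NormedAddCommGroup Y] [InnerProductSpace ℂ Y] [CompleteSpace Y]
  [NormedAddCommGroup U] [InnerProductSpace ℂ U]

/-- The part of the kernel `F` near `t = 0`, where it is singular. -/
noncomputable def nearKernel (S : C0Semigroup Y) (F : ℝ → Y →L[ℂ] U) (δ t : ℝ) :
    S.AdjDom →ₗ[ℂ] U :=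
  if t < δ then (F t).toLinearMap ∘ₗ S.adjIncl else 0

theorem nearKernel_of_lt (S : C0Semigroup Y) (F : ℝ → Y →L[ℂ] U) {δ t : ℝ} (h : t < δ)
    (z : S.AdjDom) : nearKernel S F δ t z = F t z.toY := by
  simp [nearKernel, h]

theorem nearKernel_of_le (S : C0Semigroup Y) (F : ℝ → Y →L[ℂ] U) {δ t : ℝ} (h : δ ≤ t)
    (z : S.AdjDom) : nearKernel S F δ t z = 0 := by
  simp [nearKernel, h.not_gt]

end NearKernel

section Decomposition

variable {Y U Z : Type*}
  [NormedAddCommGroup Y] [InnerProductSpace ℂ Y] [CompleteSpace Y]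
  [NormedAddCommGroup U] [InnerProductSpace ℂ U] [CompleteSpace U]
  [NormedAddCommGroup Z] [InnerProductSpace ℂ Z] [CompleteSpace Z]
  {S : C0Semigroup Y} {B : U →L[ℂ] S.Extrap} {R : Y →L[ℂ] Z}
  {F : ℝ → Y →L[ℂ] U} {G : ℝ → S.AdjDom →L[ℂ] U} {γ ε : ℝ}

namespace DecompositionHypotheses

theorem enorm_toY_adjEvolve_le {M ω : ℝ} (hM : ∀ t : ℝ≥0, ‖S t‖ ≤ M * Real.exp (-ω * t)) (t : ℝ≥0)
    (z : S.AdjDom) :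
    ‖(S.adjEvolve t z).toY‖ₑ ≤ ENNReal.ofReal (M * Real.exp (-ω * t)) * ‖z.toY‖ₑ := by
  have h1 : ‖(S.adjEvolve t z).toY‖ ≤ M * Real.exp (-ω * t) * ‖z.toY‖ :=
    ((S.adj t).le_opNorm z.toY).trans
      (mul_le_mul_of_nonneg_right ((S.norm_adj t).trans_le (hM t)) (norm_nonneg _))
  have h0 : 0 ≤ M * Real.exp (-ω * t) := (norm_nonneg _).trans (hM t)
  rw [← ofReal_norm, ← ofReal_norm, ← ENNReal.ofReal_mul h0]
  exact ENNReal.ofReal_le_ofReal h1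

theorem enorm_negFracPow_adjEvolve_le (hS : S.ExpStable) {M ω α : ℝ} (hα : 0 < α)
    (hM : ∀ t : ℝ≥0, ‖S t‖ ≤ M * Real.exp (-ω * t)) (t : ℝ≥0) (z : S.AdjDom) :
    ‖negFracPow S.adj α (S.adjEvolve t z).toY‖ₑ ≤
      ENNReal.ofReal (M * Real.exp (-ω * t)) * ‖negFracPow S.adj α z.toY‖ₑ := by
  have h2 (x : Y) : negFracPow S.adj α x =
      (S.adjSemigroup hS).fracPow (S.adjSemigroup_expStable hS) hα x :=
    ((S.adjSemigroup hS).fracPow_apply (S.adjSemigroup_expStable hS) hα x).symm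
  have h3 : negFracPow S.adj α (S.adjEvolve t z).toY = S.adj t (negFracPow S.adj α z.toY) := by
    rw [h2, h2]
    exact ((S.adjSemigroup hS).fracPow_comm (S.adjSemigroup_expStable hS) hα t z.toY).symm
  have h1 : ‖S.adj t (negFracPow S.adj α z.toY)‖ ≤
      M * Real.exp (-ω * t) * ‖negFracPow S.adj α z.toY‖ :=
    ((S.adj t).le_opNorm _).trans (by gcongr; exact (S.norm_adj t).trans_le (hM t))
  have h0 : 0 ≤ M * Real.exp (-ω * t) := (norm_nonneg _).trans (hM t)
  rw [h3, ← ofReal_norm, ← ofReal_norm, ← ENNReal.ofReal_mul h0]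
  exact ENNReal.ofReal_le_ofReal h1

variable (H : DecompositionHypotheses S B R F G γ ε)
include H

theorem enorm_F_le : ∃ N : ℝ, 0 < N ∧ ∀ t : ℝ, 0 < t → ∀ y : Y,
    ‖F t y‖ₑ ≤ ENNReal.ofReal (N * t ^ (-γ)) * ‖y‖ₑ := by
  obtain ⟨η, N, hη, hN, hF⟩ := H.singular_estimate
  refine ⟨N, hN, fun t ht y => ?_⟩
  have h1 : Real.exp (-η * t) ≤ 1 := Real.exp_le_one_iff.2 (by nlinarith)
  have h2 : 0 ≤ N * t ^ (-γ) := by positivity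
  have h3 : ‖F t y‖ ≤ N * t ^ (-γ) * ‖y‖ := ((F t).le_opNorm y).trans (by
    gcongr
    exact (hF t ht).trans (mul_le_of_le_one_right h2 h1))
  rw [← ofReal_norm, ← ofReal_norm, ← ENNReal.ofReal_mul h2]
  exact ENNReal.ofReal_le_ofReal h3

/-- The bounds of `G` in `L^p(0, T; U)`, with real exponents. -/
theorem exists_G_bound : ∃ T : ℝ, 0 < T ∧ ∀ p : ℝ, 1 ≤ p → ∃ K : ℝ≥0∞, K ≠ ∞ ∧ ∀ z : S.AdjDom,
    AEStronglyMeasurable (fun t => G t z) (onInterval T) ∧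
      eLpNorm (fun t => G t z) (ENNReal.ofReal p) (onInterval T) ≤ K * ‖z.toY‖ₑ := by
  obtain ⟨T, hT, h⟩ := H.integrability
  refine ⟨T, hT, fun p hp => ?_⟩
  have : Fact (1 ≤ ENNReal.ofReal p) := ⟨by simpa using hp⟩
  obtain ⟨K, hK⟩ := h (ENNReal.ofReal p) ENNReal.ofReal_ne_top
  refine ⟨‖K‖ₑ, enorm_ne_top, fun z => ⟨(Lp.aestronglyMeasurable _).congr (hK z), ?_⟩⟩
  rw [← eLpNorm_congr_ae (hK z), ← Lp.enorm_def]
  exact K.le_opENorm _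

theorem ctrlKernel_eq {t : ℝ} (ht : 0 < t) (z : S.AdjDom) :
    ctrlKernel S B t z = F t z.toY + G t z :=
  H.decomposition t ht z

/-- No measurability of `F` is assumed. It follows on `(0, T)` from the continuity of `B* e^{A* t}
z` and the measurability of `G(t) z`. -/
theorem aestronglyMeasurable_nearKernel (hS : S.ExpStable) {T δ : ℝ} (hδT : δ ≤ T) {z : S.AdjDom}
    (hG : AEStronglyMeasurable (fun t => G t z) (onInterval T)) :
    AEStronglyMeasurable (fun t => nearKernel S F δ t z) halfLine := by
  have h1 : AEStronglyMeasurable ((Ioo 0 δ).indicator fun t => ctrlKernel S B t z - G t z)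
      halfLine := by
    rw [aestronglyMeasurable_indicator_iff measurableSet_Ioo]
    refine (continuous_ctrlKernel S hS B z).aestronglyMeasurable.sub (hG.mono_measure ?_)
    rw [Measure.restrict_restrict measurableSet_Ioo]
    exact Measure.restrict_mono_set _ fun t (ht : t ∈ Ioo 0 δ ∩ Ioi 0) =>
      ⟨ht.1.1, ht.1.2.trans_le hδT⟩
  refine h1.congr ?_
  filter_upwards [ae_restrict_mem measurableSet_Ioi] with t ht
  rcases lt_or_ge t δ with h | h
  · rw [indicator_of_mem (show t ∈ Ioo 0 δ from ⟨ht, h⟩), nearKernel_of_lt S F h,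
      H.ctrlKernel_eq ht, add_sub_cancel_right]
  · rw [indicator_of_notMem (fun h' => h'.2.not_ge h), nearKernel_of_le S F h]

theorem enorm_nearKernel_le : ∃ N : ℝ, 0 < N ∧ ∀ δ t : ℝ, 0 < t → ∀ z : S.AdjDom,
    ‖nearKernel S F δ t z‖ₑ ≤
      (Iio δ).indicator (fun t => ENNReal.ofReal (N * t ^ (-γ))) t * ‖z.toY‖ₑ := by
  obtain ⟨N, hN, h⟩ := H.enorm_F_le
  refine ⟨N, hN, fun δ t ht z => ?_⟩
  rcases lt_or_ge t δ with hδ | hδ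
  · rw [indicator_of_mem (by exact hδ), nearKernel_of_lt S F hδ]
    exact h t ht _
  · rw [nearKernel_of_le S F hδ, enorm_zero]
    exact zero_le

/-- `B* e^{A* t}` belongs to `L^p(0, ∞)` strongly, with an exponential weight, as long as the
singularity `t ^ (-γ)` of `F` does. -/
theorem exists_ctrlKernel_bound {M ω p : ℝ} (hM0 : 0 ≤ M) (hω : 0 < ω)
    (hM : ∀ t : ℝ≥0, ‖S t‖ ≤ M * Real.exp (-ω * t)) (hp : 1 ≤ p) (hpγ : γ * p < 1) :
    ∃ C : ℝ≥0∞, C ≠ ∞ ∧ ∀ z : S.AdjDom, ∫⁻ t in Ioi (0 : ℝ),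
      (ENNReal.ofReal (Real.exp (ω / 2 * t)) * ‖ctrlKernel S B t z‖ₑ) ^ p ≤ (C * ‖z.toY‖ₑ) ^ p := by
  have hp0 : 0 < p := by linarith
  obtain ⟨N, hN, hF⟩ := H.enorm_F_le
  obtain ⟨T, hT, hG⟩ := H.exists_G_bound
  obtain ⟨K, hK, hGK⟩ := hG p hp
  set τ := T / 2 with hτ
  have hτ0 : 0 < τ := half_pos hT
  have hsub : volume.restrict (Ioc 0 τ) ≤ onInterval T :=
    Measure.restrict_mono_set _ (fun t ht => ⟨ht.1, ht.2.trans_lt (half_lt_self hT)⟩)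
  set a : ℝ≥0∞ := eLpNorm (fun t : ℝ => N * t ^ (-γ)) (ENNReal.ofReal p) (volume.restrict (Ioc 0 τ))
    with ha
  have hatop : a ≠ ∞ := by
    rw [ha, eLpNorm_ofReal_eq hp0]
    refine ENNReal.rpow_ne_top_of_nonneg (by positivity) ?_
    have : ∫⁻ t in Ioc 0 τ, ‖N * t ^ (-γ)‖ₑ ^ p =
        ∫⁻ t in Ioc 0 τ, ENNReal.ofReal (N ^ p) * ENNReal.ofReal (t ^ (-(γ * p))) := by
      refine setLIntegral_congr_fun measurableSet_Ioc fun t ht => ?_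
      have ht0 : 0 < t := ht.1
      rw [Real.enorm_of_nonneg (by positivity),
        ENNReal.ofReal_rpow_of_nonneg (by positivity) hp0.le,
        ← ENNReal.ofReal_mul (by positivity), Real.mul_rpow hN.le (by positivity),
        ← Real.rpow_mul ht0.le, neg_mul]
    rw [this, lintegral_const_mul' _ _ ENNReal.ofReal_ne_top,
      lintegral_Ioc_ofReal_rpow_neg hτ0.le hpγ]
    exact ENNReal.mul_ne_top ENNReal.ofReal_ne_top ENNReal.ofReal_ne_top
  refine exists_exp_bound_ctrlKernel S B (N := fun z => ‖z.toY‖ₑ) hM0 hω hp0 hτ0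
    (enorm_toY_adjEvolve_le hM) (C := a + K) (ENNReal.add_ne_top.2 ⟨hatop, hK⟩) fun z => ?_
  refine (eLpNorm_le_add_of_enorm_le hp (g := fun t => ‖z.toY‖ * (N * t ^ (-γ)))
    (h := fun t => G t z) (fun t ht => ?_) ?_ ((hGK z).1.mono_measure hsub)).trans ?_
  · rw [H.ctrlKernel_eq ht.1]
    refine (enorm_add_le _ _).trans (add_le_add_left ((hF t ht.1 _).trans_eq ?_) _)
    have := Real.rpow_nonneg ht.1.le (-γ)
    rw [mul_comm ‖z.toY‖, Real.enorm_of_nonneg (by positivity),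
      ENNReal.ofReal_mul (mul_nonneg hN.le this), ofReal_norm]
  · exact (((measurable_id.pow_const (-γ)).const_mul N).const_mul _).aestronglyMeasurable
  · rw [add_mul]
    refine add_le_add ?_ ((eLpNorm_mono_measure _ hsub).trans (hGK z).2)
    have := eLpNorm_const_smul (‖z.toY‖) (fun t : ℝ => N * t ^ (-γ)) (ENNReal.ofReal p)
      (volume.restrict (Ioc 0 τ))
    rw [enorm_norm, ← ha, mul_comm] at this
    exact this.le

/-- The same with the weaker norm `‖A*^{-ε} z‖`, for exponents up to the one of the regularity
assumption. -/
theorem exists_ctrlKernel_bound_fracPow (hS : S.ExpStable) {M ω : ℝ} (hM0 : 0 ≤ M) (hω : 0 < ω)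
    (hM : ∀ t : ℝ≥0, ‖S t‖ ≤ M * Real.exp (-ω * t)) :
    ∃ q : ℝ, 1 < q ∧ q < 2 ∧ ∀ p, 1 ≤ p → p ≤ q → ∃ C : ℝ≥0∞, C ≠ ∞ ∧ ∀ z : S.AdjDom,
      ∫⁻ t in Ioi (0 : ℝ), (ENNReal.ofReal (Real.exp (ω / 2 * t)) * ‖ctrlKernel S B t z‖ₑ) ^ p ≤
        (C * ‖negFracPow S.adj ε z.toY‖ₑ) ^ p := by
  obtain ⟨T, hT, -, q, hq, hq1, hq2, K, hK⟩ := H.regularity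
  have hqtop : q ≠ ∞ := (hq2.trans (by simp)).ne
  have hqr : ENNReal.ofReal q.toReal = q := ENNReal.ofReal_toReal hqtop
  refine ⟨q.toReal, ?_, ?_, fun p hp hpq => ?_⟩
  · rw [← ENNReal.toReal_one, ENNReal.toReal_lt_toReal ENNReal.one_ne_top hqtop]
    exact hq1
  · rw [← ENNReal.toReal_ofNat, ENNReal.toReal_lt_toReal hqtop (by simp)]
    exact hq2
  have hp0 : 0 < p := by linarith
  set τ := T / 2 with hτ
  have hτ0 : 0 < τ := half_pos hT
  have hsub : volume.restrict (Ioc 0 τ) ≤ onInterval T :=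
    Measure.restrict_mono_set _ (fun t ht => ⟨ht.1, ht.2.trans_lt (half_lt_self hT)⟩)
  set c : ℝ≥0∞ := volume.restrict (Ioc 0 τ) univ ^ (1 / (ENNReal.ofReal p).toReal - 1 / q.toReal)
    with hc
  have hctop : c ≠ ∞ := by
    refine ENNReal.rpow_ne_top_of_nonneg ?_ (measure_ne_top _ _)
    rw [ENNReal.toReal_ofReal hp0.le, sub_nonneg]
    exact one_div_le_one_div_of_le hp0 hpq
  refine exists_exp_bound_ctrlKernel S B (N := fun z => ‖negFracPow S.adj ε z.toY‖ₑ) hM0 hω hp0 hτ0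
    (enorm_negFracPow_adjEvolve_le hS H.eps_pos hM) (C := ‖K‖ₑ * c)
    (ENNReal.mul_ne_top enorm_ne_top hctop) fun z => ?_
  refine (eLpNorm_le_eLpNorm_mul_rpow_measure_univ (q := q) ?_
    (continuous_ctrlKernel S hS B z).aestronglyMeasurable).trans ?_
  · rw [← hqr]
    exact ENNReal.ofReal_le_ofReal hpq
  · rw [← hc, mul_right_comm]
    gcongr
    refine (eLpNorm_mono_measure _ hsub).trans ?_
    refine (eLpNorm_congr_ae (hK z)).symm.trans_le ?_
    rw [← Lp.enorm_def]
    exact K.le_opENorm _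

/-- Away from the singularity of `F`, the kernel `B* e^{A* t}` belongs strongly to every `L^p`. -/
theorem exists_farKernel_bound {M ω T δ p : ℝ} (hM1 : 1 ≤ M) (hω : 0 < ω)
    (hM : ∀ t : ℝ≥0, ‖S t‖ ≤ M * Real.exp (-ω * t)) (hδ : 0 < δ) (hδT : 2 * δ < T) (hp : 1 ≤ p)
    {K : ℝ≥0∞} (hK : K ≠ ∞) (hG : ∀ z : S.AdjDom,
      AEStronglyMeasurable (fun t => G t z) (onInterval T) ∧
      eLpNorm (fun t => G t z) (ENNReal.ofReal p) (onInterval T) ≤ K * ‖z.toY‖ₑ) :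
    ∃ C : ℝ≥0∞, C ≠ ∞ ∧ ∀ z : S.AdjDom, ∫⁻ t in Ioi (0 : ℝ),
      (ENNReal.ofReal (Real.exp (ω / 2 * t)) *
        ‖(ctrlKernel S B t - nearKernel S F δ t) z‖ₑ) ^ p ≤ (C * ‖z.toY‖ₑ) ^ p := by
  have hp0 : 0 < p := by linarith
  have hM0 : 0 ≤ M := by linarith
  obtain ⟨N, hN, hF⟩ := H.enorm_F_le
  set b : ℝ := N * δ ^ (-γ) with hb
  have hb0 : 0 ≤ b := by positivity
  set a : ℝ≥0∞ := eLpNorm (fun _ : ℝ => b) (ENNReal.ofReal p) (volume.restrict (Ioc 0 δ)) with ha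
  have hatop : a ≠ ∞ := (memLp_const b).eLpNorm_ne_top
  -- the block `(δ, 2δ)` controls all later blocks
  have hblock (z : S.AdjDom) : eLpNorm (fun t => ctrlKernel S B (t + δ) z) (ENNReal.ofReal p)
      (volume.restrict (Ioc 0 δ)) ≤ (a + K) * ‖z.toY‖ₑ := by
    have hmp : MeasurePreserving (fun t => t + δ) (volume.restrict (Ioc 0 δ))
        (volume.restrict (Ioc δ (2 * δ))) := by
      have := (measurePreserving_add_right volume δ).restrict_preimage_emb
        (measurableEmbedding_addRight δ) (Ioc δ (2 * δ))
      rwa [preimage_add_const_Ioc, sub_self, two_mul, add_sub_cancel_right, ← two_mul] at this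
    have hsub : volume.restrict (Ioc δ (2 * δ)) ≤ onInterval T :=
      Measure.restrict_mono_set _ (fun t ht => ⟨hδ.trans ht.1, ht.2.trans_lt hδT⟩)
    have hGm := (hG z).1.mono_measure hsub
    refine (eLpNorm_le_add_of_enorm_le hp (g := fun _ => ‖z.toY‖ * b)
      (h := fun t => G (t + δ) z) (fun t ht => ?_) aestronglyMeasurable_const
      (hGm.comp_measurePreserving hmp)).trans ?_
    · have htδ : 0 < t + δ := add_pos ht.1 hδ
      rw [H.ctrlKernel_eq htδ]
      refine (enorm_add_le _ _).trans (add_le_add_left ((hF _ htδ _).trans ?_) _)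
      rw [mul_comm ‖z.toY‖, Real.enorm_of_nonneg (by positivity), ENNReal.ofReal_mul hb0,
        ofReal_norm]
      rw [hb]
      gcongr ENNReal.ofReal (N * ?_) * _
      exact Real.rpow_le_rpow_of_nonpos hδ (by linarith [ht.1]) (by linarith [H.gamma_mem.1])
    · rw [add_mul]
      refine add_le_add ?_ ?_
      · have := eLpNorm_const_smul (‖z.toY‖) (fun _ : ℝ => b) (ENNReal.ofReal p)
          (volume.restrict (Ioc 0 δ))
        rw [enorm_norm, ← ha, mul_comm] at this
        exact this.le
      · have := eLpNorm_comp_measurePreserving (p := ENNReal.ofReal p) hGm hmp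
        refine (this.trans_le (eLpNorm_mono_measure _ hsub)).trans (hG z).2
  -- the factor `e^{ωδ}` compensates for the shift of the index by one block
  set C₀ : ℝ≥0∞ := ENNReal.ofReal (M * Real.exp (ω * δ)) * (a + K) with hC₀
  refine exists_exp_bound_of_blocks (N := fun z : S.AdjDom => ‖z.toY‖ₑ) hp0 hδ hω (C := C₀)
    (ENNReal.mul_ne_top ENNReal.ofReal_ne_top (ENNReal.add_ne_top.2 ⟨hatop, hK⟩)) fun z k => ?_
  rcases k with _ | k
  · -- on the first block only `G` is left
    have h1 : eLpNorm (fun t => G t z) (ENNReal.ofReal p) (volume.restrict (Ioc 0 δ)) ≤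
        ENNReal.ofReal (Real.exp (-ω * ((0 : ℕ) * δ))) * (C₀ * ‖z.toY‖ₑ) := by
      have hsub : volume.restrict (Ioc 0 δ) ≤ onInterval T :=
        Measure.restrict_mono_set _ fun t ht => ⟨ht.1, by linarith [ht.2]⟩
      refine (eLpNorm_mono_measure _ hsub).trans ((hG z).2.trans ?_)
      · have h2 : 1 ≤ ENNReal.ofReal (M * Real.exp (ω * δ)) := by
          rw [ENNReal.one_le_ofReal]
          exact one_le_mul_of_one_le_of_one_le hM1 (Real.one_le_exp (by positivity))
        simp only [Nat.cast_zero, zero_mul, mul_zero, Real.exp_zero, ENNReal.ofReal_one, one_mul]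
        gcongr
        calc K ≤ a + K := le_add_self
          _ ≤ C₀ := le_mul_of_one_le_left zero_le h2
    refine le_trans (lintegral_mono_ae ?_) (setLIntegral_rpow_le_of_eLpNorm_le hp0 h1)
    rw [restrict_Ioo_eq_restrict_Ioc.symm]
    filter_upwards [ae_restrict_mem measurableSet_Ioo] with t ht
    rw [Nat.cast_zero, zero_mul, add_zero, LinearMap.sub_apply, nearKernel_of_lt S F ht.2,
      H.ctrlKernel_eq ht.1, add_sub_cancel_left]
  · have hk : (0 : ℝ) ≤ k * δ := by positivity
    have h1 : ∫⁻ t in Ioc 0 δ, ‖(ctrlKernel S B (t + (k + 1 : ℕ) * δ) -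
          nearKernel S F δ (t + (k + 1 : ℕ) * δ)) z‖ₑ ^ p =
        ∫⁻ t in Ioc 0 δ, ‖ctrlKernel S B (t + δ) (S.adjEvolve (k * δ).toNNReal z)‖ₑ ^ p := by
      refine setLIntegral_congr_fun measurableSet_Ioc fun t ht => ?_
      have h2 : t + (k + 1 : ℕ) * δ = t + δ + k * δ := by push_cast; ring
      have ht0 := ht.1
      rw [h2, LinearMap.sub_apply, nearKernel_of_le S F (by linarith), sub_zero,
        ctrlKernel_add S B (by linarith) hk]
    rw [h1]
    refine setLIntegral_rpow_le_of_eLpNorm_le hp0 ((hblock _).trans ?_)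
    have h3 := enorm_toY_adjEvolve_le hM (k * δ).toNNReal z
    rw [Real.coe_toNNReal _ hk] at h3
    calc (a + K) * ‖(S.adjEvolve (k * δ).toNNReal z).toY‖ₑ
        ≤ (a + K) * (ENNReal.ofReal (M * Real.exp (-ω * (k * δ))) * ‖z.toY‖ₑ) := by gcongr
      _ = _ := by
        have h4 : ENNReal.ofReal (M * Real.exp (-ω * ((k : ℝ) * δ))) =
            ENNReal.ofReal (Real.exp (-ω * ((k + 1 : ℕ) * δ))) *
              ENNReal.ofReal (M * Real.exp (ω * δ)) := by
          rw [← ENNReal.ofReal_mul (Real.exp_nonneg _), mul_left_comm (Real.exp _), ← Real.exp_add,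
            Nat.cast_add_one]
          congr 3
          ring
        rw [h4, hC₀]
        ring

end DecompositionHypotheses
end Decomposition

/-! ### Splitting of the input-to-state map -/

/-- Interpolation between `L^p` and `L^∞`. -/
theorem eLpNorm_le_of_le_of_top {α E : Type*} [MeasurableSpace α] {μ : Measure α}
    [NormedAddCommGroup E] {p s : ℝ} (hp : 0 < p) (hps : p ≤ s) {y : α → E} {D : ℝ≥0∞}
    (h1 : eLpNorm y (ENNReal.ofReal p) μ ≤ D) (h2 : eLpNorm y ∞ μ ≤ D) :
    eLpNorm y (ENNReal.ofReal s) μ ≤ D := by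
  have hs : 0 < s := hp.trans_le hps
  rcases eq_or_ne D ∞ with rfl | hD
  · exact le_top
  rw [eLpNorm_ofReal_eq hp] at h1
  rw [eLpNorm_ofReal_eq hs]
  have h3 : ∫⁻ t, ‖y t‖ₑ ^ p ∂μ ≤ D ^ p := by
    have := ENNReal.rpow_le_rpow h1 hp.le
    rwa [← ENNReal.rpow_mul, one_div_mul_cancel hp.ne', ENNReal.rpow_one] at this
  have h4 : ∫⁻ t, ‖y t‖ₑ ^ s ∂μ ≤ D ^ s :=
    calc ∫⁻ t, ‖y t‖ₑ ^ s ∂μ ≤ ∫⁻ t, D ^ (s - p) * ‖y t‖ₑ ^ p ∂μ := by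
          rw [eLpNorm_exponent_top] at h2
          refine lintegral_mono_ae ?_
          filter_upwards [ae_le_eLpNormEssSup (f := y) (μ := μ)] with t ht
          rw [show ‖y t‖ₑ ^ s = ‖y t‖ₑ ^ (s - p) * ‖y t‖ₑ ^ p by
            rw [← ENNReal.rpow_add_of_nonneg _ _ (sub_nonneg.2 hps) hp.le, sub_add_cancel]]
          gcongr
          exact ht.trans h2
      _ = D ^ (s - p) * ∫⁻ t, ‖y t‖ₑ ^ p ∂μ :=
          lintegral_const_mul' _ _ (ENNReal.rpow_ne_top_of_nonneg (sub_nonneg.2 hps) hD)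
      _ ≤ D ^ (s - p) * D ^ p := by gcongr
      _ = D ^ s := by
          rw [← ENNReal.rpow_add_of_nonneg _ _ (sub_nonneg.2 hps) hp.le, sub_add_cancel]
  refine (ENNReal.rpow_le_rpow h4 (by positivity)).trans_eq ?_
  rw [← ENNReal.rpow_mul, mul_one_div_cancel hs.ne', ENNReal.rpow_one]

theorem lintegral_mul_exp_rpow_ne_top {a p : ℝ} (ha : 0 < a) (hp : 0 < p) {C : ℝ≥0∞} (hC : C ≠ ∞) :
    ∫⁻ t in Ioi (0 : ℝ), (C * ENNReal.ofReal (Real.exp (-a * t))) ^ p ≠ ∞ := by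
  have h1 (t : ℝ) : (C * ENNReal.ofReal (Real.exp (-a * t))) ^ p =
      C ^ p * ENNReal.ofReal (Real.exp (-(a * p) * t)) := by
    rw [ENNReal.mul_rpow_of_nonneg _ _ hp.le,
      ENNReal.ofReal_rpow_of_nonneg (Real.exp_nonneg _) hp.le, ← Real.exp_mul]
    congr 3
    ring
  simp_rw [h1]
  have h2 := ENNReal.rpow_ne_top_of_nonneg hp.le hC
  rw [lintegral_const_mul' _ _ h2]
  refine ENNReal.mul_ne_top h2 ?_
  have h3 := (exp_neg_integrableOn_Ioi 0 (mul_pos ha hp)).lintegral_lt_top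
  exact h3.ne

theorem mul_exp_rpow_le {a p t : ℝ} (ha : 0 < a) (hp : 0 < p) (ht : 0 < t) (C : ℝ≥0∞) :
    (C * ENNReal.ofReal (Real.exp (-a * t))) ^ p ≤ C ^ p := by
  refine ENNReal.rpow_le_rpow (mul_le_of_le_one_right zero_le ?_) hp.le
  rw [ENNReal.ofReal_le_one, Real.exp_le_one_iff]
  nlinarith

/-- A bounded operator on `L²(0, ∞)` that splits, for every `c > 0`, into a part of norm at most `c`
on `L²`, `L^r` and `L^P`, and a part that improves integrability from `L²` to `L^P` and from
`L^r` to `L²`. -/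
def SplitsSmall {Y U : Type*} [NormedAddCommGroup Y] [NormedSpace ℂ Y] [NormedAddCommGroup U]
    [NormedSpace ℂ U] (L : Lp U 2 halfLine →L[ℂ] Lp Y 2 halfLine) (P r : ℝ) : Prop :=
  ∀ c : ℝ≥0, 0 < c → ∃ L₁ L₂ : Lp U 2 halfLine →L[ℂ] Lp Y 2 halfLine, L = L₁ + L₂ ∧ ‖L₁‖ ≤ c ∧
    (∀ u, eLpNorm (L₁ u) (ENNReal.ofReal r) halfLine ≤ c * eLpNorm u (ENNReal.ofReal r) halfLine) ∧
    (∀ u, eLpNorm (L₁ u) (ENNReal.ofReal P) halfLine ≤ c * eLpNorm u (ENNReal.ofReal P) halfLine) ∧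
    ∃ C : ℝ≥0∞, C ≠ ∞ ∧
      (∀ u, eLpNorm (L₂ u) (ENNReal.ofReal P) halfLine ≤ C * eLpNorm u 2 halfLine) ∧
      ∀ u, eLpNorm (L₂ u) 2 halfLine ≤ C * eLpNorm u (ENNReal.ofReal r) halfLine

section ConvSum

variable {X Y U : Type*} [AddCommGroup X] [Module ℂ X]
  [NormedAddCommGroup Y] [InnerProductSpace ℂ Y]
  [NormedAddCommGroup U] [InnerProductSpace ℂ U] {e : X →ₗ[ℂ] Y}

theorem weakConv_add_kernel {κ κ' : ℝ → X →ₗ[ℂ] U} {u : ℝ → U} {z : X} {t : ℝ}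
    (h : IntervalIntegrable (fun s => inner ℂ (κ (t - s) z) (u s)) volume 0 t)
    (h' : IntervalIntegrable (fun s => inner ℂ (κ' (t - s) z) (u s)) volume 0 t) :
    weakConv (κ + κ') u z t = weakConv κ u z t + weakConv κ' u z t := by
  simp only [weakConv, Pi.add_apply, LinearMap.add_apply, inner_add_left]
  exact intervalIntegral.integral_add h h'

/-- The convolution operator of a sum of two kernels splits accordingly. -/
theorem exists_convOp_add [CompleteSpace Y] [TopologicalSpace.SeparableSpace Y]
    (he : DenseRange e) {κ κ' : ℝ → X →ₗ[ℂ] U}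
    (hκ : ∀ z, AEStronglyMeasurable (fun t => κ t z) halfLine)
    (hκ' : ∀ z, AEStronglyMeasurable (fun t => κ' t z) halfLine) {m m' : ℝ → ℝ≥0∞}
    (hB : ConvBound κ (fun z => ‖e z‖ₑ) 2 m) (hm : Measurable m)
    (hmi : ∫⁻ t in Ioi (0 : ℝ), m t ≠ ∞)
    (hB' : ConvBound κ' (fun z => ‖e z‖ₑ) 2 m') (hm' : Measurable m')
    (hmi' : ∫⁻ t in Ioi (0 : ℝ), m' t ≠ ∞) :
    ∃ L L' : Lp U 2 halfLine →L[ℂ] Lp Y 2 halfLine,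
      (∀ u : Lp U 2 halfLine, IsConv e κ u (L u)) ∧
      (∀ u : Lp U 2 halfLine, IsConv e κ' u (L' u)) ∧
      (∀ u : Lp U 2 halfLine, IsConv e (κ + κ') u ((L + L') u)) ∧
      ‖L‖ ≤ ((∫⁻ t in Ioi (0 : ℝ), m t) ^ (1 / 2 : ℝ)).toReal := by
  obtain ⟨L, hL, hLn⟩ := hB.exists_convOp he hκ hm hmi
  obtain ⟨L', hL', -⟩ := hB'.exists_convOp he hκ' hm' hmi'
  refine ⟨L, L', hL, hL', fun u => ?_, hLn⟩
  have hu : MemLp u (ENNReal.ofReal 2) halfLine := by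
    rw [ENNReal.ofReal_ofNat]
    exact Lp.memLp u
  filter_upwards [hL u, hL' u, Lp.coeFn_add (L u) (L' u), ae_restrict_mem measurableSet_Ioi,
    hB.ae_lt_top (fun z => enorm_ne_top) two_pos hm hmi hu,
    hB'.ae_lt_top (fun z => enorm_ne_top) two_pos hm' hmi' hu] with t h1 h2 h3 ht h4 h5 z
  rw [_root_.add_apply, h3, Pi.add_apply, inner_add_right, h1, h2,
    weakConv_add_kernel (integrableOn_weakConv (hκ z) hu.1 (le_of_lt ht) (h4.2 z))
      (integrableOn_weakConv (hκ' z) hu.1 (le_of_lt ht) (h5.2 z))]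

end ConvSum

section InputMap

variable {Y U Z : Type*}
  [NormedAddCommGroup Y] [InnerProductSpace ℂ Y] [CompleteSpace Y]
  [NormedAddCommGroup U] [InnerProductSpace ℂ U] [CompleteSpace U]
  [NormedAddCommGroup Z] [InnerProductSpace ℂ Z] [CompleteSpace Z]
  {S : C0Semigroup Y} {B : U →L[ℂ] S.Extrap} {R : Y →L[ℂ] Z}
  {F : ℝ → Y →L[ℂ] U} {G : ℝ → S.AdjDom →L[ℂ] U} {γ ε : ℝ}

namespace DecompositionHypotheses

variable (H : DecompositionHypotheses S B R F G γ ε)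
include H

/-- The control kernel is the sum of `F` on `(0, δ)` and of a remainder. The first part is small for
small `δ`, because `t ^ (-γ)` is integrable at `0`. The remainder belongs strongly to every `L^q`,
so it maps every `L^p` to `L^p` and to `L^∞`. -/
theorem exists_split [TopologicalSpace.SeparableSpace Y] (hS : S.ExpStable) {P r : ℝ}
    (hPr : P.HolderConjugate r) (hP : 2 ≤ P) {c : ℝ≥0} (hc : 0 < c) :
    ∃ L₁ L₂ : Lp U 2 halfLine →L[ℂ] Lp Y 2 halfLine,
    (∀ u : Lp U 2 halfLine, IsConv S.adjIncl (ctrlKernel S B) u ((L₁ + L₂) u)) ∧ ‖L₁‖ ≤ c ∧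
    (∀ u, eLpNorm (L₁ u) (ENNReal.ofReal r) halfLine ≤ c * eLpNorm u (ENNReal.ofReal r) halfLine) ∧
    (∀ u, eLpNorm (L₁ u) (ENNReal.ofReal P) halfLine ≤ c * eLpNorm u (ENNReal.ofReal P) halfLine) ∧
    ∃ C : ℝ≥0∞, C ≠ ∞ ∧
      (∀ u, eLpNorm (L₂ u) (ENNReal.ofReal P) halfLine ≤ C * eLpNorm u 2 halfLine) ∧
      ∀ u, eLpNorm (L₂ u) 2 halfLine ≤ C * eLpNorm u (ENNReal.ofReal r) halfLine := by
  have he : DenseRange S.adjIncl := S.dense_adjDom hS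
  have hP0 := hPr.pos
  have hr0 := hPr.symm.pos
  have hr1 : 1 < r := hPr.symm.lt
  have hr2 : r ≤ 2 := by
    have := hPr.sub_one_mul_conj
    nlinarith
  have h22 : Real.HolderConjugate 2 2 := Real.HolderConjugate.two_two
  obtain ⟨M, ω, hM1, hω, hM⟩ := id hS
  obtain ⟨T, hT, hG⟩ := H.exists_G_bound
  obtain ⟨N, hN, hnear⟩ := H.enorm_nearKernel_le
  have hγ : 0 < 1 - γ := sub_pos.2 H.gamma_mem.2
  -- near zero the singular kernel has a small integral
  obtain ⟨δ, hδ, hδT, hδc⟩ : ∃ δ : ℝ, 0 < δ ∧ 2 * δ < T ∧ N * (δ ^ (1 - γ) / (1 - γ)) ≤ c := by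
    have h1 : Tendsto (fun δ : ℝ => N * (δ ^ (1 - γ) / (1 - γ))) (𝓝[>] 0) (𝓝 0) := by
      have h2 : ContinuousAt (fun δ : ℝ => N * (δ ^ (1 - γ) / (1 - γ))) 0 :=
        ((Real.continuousAt_rpow_const 0 (1 - γ) (Or.inr hγ.le)).div_const _).const_mul N
      have h3 := h2.tendsto.mono_left (nhdsWithin_le_nhds (s := Ioi 0))
      simpa [Real.zero_rpow hγ.ne'] using h3
    have h4 : ∀ᶠ δ : ℝ in 𝓝[>] 0, 2 * δ < T := by
      have : ∀ᶠ δ : ℝ in 𝓝 0, δ < T / 2 := gt_mem_nhds (half_pos hT)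
      filter_upwards [nhdsWithin_le_nhds this] with δ hδ
      linarith
    obtain ⟨δ, h5, h6, h7⟩ := ((h1.eventually (ge_mem_nhds (show (0 : ℝ) < c from hc))).and
      (h4.and self_mem_nhdsWithin)).exists
    exact ⟨δ, h7, h6, h5⟩
  set k : ℝ → ℝ≥0∞ := (Iio δ).indicator fun t => ENNReal.ofReal (N * t ^ (-γ)) with hk
  have hkm : Measurable k :=
    (ENNReal.measurable_ofReal.comp ((measurable_id.pow_const (-γ)).const_mul N)).indicator
      measurableSet_Iio
  have hki : ∫⁻ t in Ioi (0 : ℝ), k t ≤ c := by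
    rw [hk, setLIntegral_indicator measurableSet_Iio]
    have h1 : Iio δ ∩ Ioi 0 ⊆ Ioc 0 δ := fun t ht => ⟨ht.2, le_of_lt ht.1⟩
    refine (lintegral_mono_set h1).trans ?_
    simp_rw [ENNReal.ofReal_mul hN.le]
    rw [lintegral_const_mul' _ _ ENNReal.ofReal_ne_top,
      lintegral_Ioc_ofReal_rpow_neg hδ.le H.gamma_mem.2, ← ENNReal.ofReal_mul hN.le]
    exact ENNReal.ofReal_le_of_le_toReal hδc
  have hkT : ∫⁻ t in Ioi (0 : ℝ), k t ≠ ∞ := (hki.trans_lt ENNReal.coe_lt_top).ne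
  have hmc {p q : ℝ} (hpq : p.HolderConjugate q) :
      (∫⁻ t in Ioi (0 : ℝ), (∫⁻ s in Ioi (0 : ℝ), k s) ^ (p - 1) * k t) ^ (1 / p) ≤ c := by
    have hp1 := hpq.lt
    have h1 : (∫⁻ s in Ioi (0 : ℝ), k s) ^ (p - 1) * ∫⁻ s in Ioi (0 : ℝ), k s =
        (∫⁻ s in Ioi (0 : ℝ), k s) ^ p := by
      conv_lhs => rw [← ENNReal.rpow_one (∫⁻ s in Ioi (0 : ℝ), k s), ← ENNReal.rpow_mul, one_mul,
        ← ENNReal.rpow_add_of_nonneg _ _ (by linarith) zero_le_one, sub_add_cancel]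
    rw [lintegral_const_mul _ hkm, h1, ← ENNReal.rpow_mul, mul_one_div_cancel hpq.pos.ne',
      ENNReal.rpow_one]
    exact hki
  have hmm (p : ℝ) : Measurable fun t => (∫⁻ s in Ioi (0 : ℝ), k s) ^ (p - 1) * k t :=
    hkm.const_mul _
  have hBnear {p q : ℝ} (hpq : p.HolderConjugate q) := ConvBound.of_pointwise
    (κ := nearKernel S F δ) (N := fun z => ‖z.toY‖ₑ) hkm (fun t ht z => hnear δ t ht z) hpq
  have hκ (z : S.AdjDom) : AEStronglyMeasurable (fun t => nearKernel S F δ t z) halfLine := by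
    obtain ⟨K, -, hK⟩ := hG 1 le_rfl
    exact H.aestronglyMeasurable_nearKernel hS (by linarith) (hK z).1
  set κ' : ℝ → S.AdjDom →ₗ[ℂ] U := fun t => ctrlKernel S B t - nearKernel S F δ t with hκ'
  have hκm' (z : S.AdjDom) : AEStronglyMeasurable (fun t => κ' t z) halfLine :=
    (continuous_ctrlKernel S hS B z).aestronglyMeasurable.sub (hκ z)
  have hBfar {p q : ℝ} (hpq : p.HolderConjugate q) : ∃ C : ℝ≥0∞, C ≠ ∞ ∧
      ConvBound κ' (fun z => ‖z.toY‖ₑ) p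
        fun t => (C * ENNReal.ofReal (Real.exp (-(ω / 2) * t))) ^ p := by
    obtain ⟨K, hK, hGK⟩ := hG q hpq.symm.lt.le
    obtain ⟨C, hC, hCb⟩ := H.exists_farKernel_bound hM1 hω hM hδ hδT hpq.symm.lt.le hK hGK
    exact ⟨C, hC, ConvBound.of_weighted hκm' hpq hCb⟩
  have hmm' (C : ℝ≥0∞) (p : ℝ) :
      Measurable fun t : ℝ => (C * ENNReal.ofReal (Real.exp (-(ω / 2) * t))) ^ p := by fun_prop
  obtain ⟨C₂, hC₂, hB₂⟩ := hBfar h22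
  obtain ⟨C₃, hC₃, hB₃⟩ := hBfar hPr.symm
  have hm2 : ∫⁻ t in Ioi (0 : ℝ), (∫⁻ s in Ioi (0 : ℝ), k s) ^ ((2 : ℝ) - 1) * k t ≠ ∞ := by
    intro h
    have := hmc h22
    rw [h, ENNReal.top_rpow_of_pos (by norm_num)] at this
    exact ENNReal.coe_ne_top (top_le_iff.1 this)
  obtain ⟨L₁, L₂, h1, h2, h3, h4⟩ := exists_convOp_add he hκ hκm' (hBnear h22) (hmm 2) hm2 hB₂
    (hmm' C₂ 2) (lintegral_mul_exp_rpow_ne_top (half_pos hω) two_pos hC₂)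
  have hsum : nearKernel S F δ + κ' = ctrlKernel S B := by
    funext t
    simp [hκ']
  rw [hsum] at h3
  have h20 : ENNReal.ofReal 2 = 2 := ENNReal.ofReal_ofNat 2
  refine ⟨L₁, L₂, h3, h4.trans ?_, fun u => ?_, fun u => ?_, ?_⟩
  · exact ENNReal.toReal_le_coe_of_le_coe (hmc h22)
  · refine ((hBnear hPr.symm).eLpNorm_le he hr0 (hmm r) (Lp.aestronglyMeasurable u) (h1 u)).trans ?_
    gcongr
    exact hmc hPr.symm
  · refine ((hBnear hPr).eLpNorm_le he hP0 (hmm P) (Lp.aestronglyMeasurable u) (h1 u)).trans ?_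
    gcongr
    exact hmc hPr
  · -- the far part maps `L^p` to `L^p ∩ L^∞`, for `p = 2` and `p = r`
    have hfar {p : ℝ} (hp : 0 < p) {C : ℝ≥0∞} (hC : C ≠ ∞) (hB : ConvBound κ' (fun z => ‖z.toY‖ₑ) p
        fun t => (C * ENNReal.ofReal (Real.exp (-(ω / 2) * t))) ^ p) :
        ∃ D : ℝ≥0∞, D ≠ ∞ ∧ ∀ s, p ≤ s → ∀ u : Lp U 2 halfLine,
          eLpNorm (L₂ u) (ENNReal.ofReal s) halfLine ≤
            D * eLpNorm u (ENNReal.ofReal p) halfLine := by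
      refine ⟨(∫⁻ t in Ioi (0 : ℝ),
          (C * ENNReal.ofReal (Real.exp (-(ω / 2) * t))) ^ p) ^ (1 / p) + C,
        ENNReal.add_ne_top.2 ⟨ENNReal.rpow_ne_top_of_nonneg (by positivity)
          (lintegral_mul_exp_rpow_ne_top (half_pos hω) hp hC), hC⟩, fun s hs u => ?_⟩
      refine eLpNorm_le_of_le_of_top hp hs ?_ ?_
      · refine (hB.eLpNorm_le he hp (hmm' C p) (Lp.aestronglyMeasurable u) (h2 u)).trans ?_
        gcongr
        exact le_self_add
      · refine (hB.eLpNorm_top_le he hp (fun t ht => mul_exp_rpow_le (half_pos hω) hp ht C)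
          (Lp.aestronglyMeasurable u) (h2 u)).trans ?_
        gcongr
        exact le_add_self
    obtain ⟨D₂, hD₂, hE₂⟩ := hfar two_pos hC₂ hB₂
    obtain ⟨D₃, hD₃, hE₃⟩ := hfar hr0 hC₃ hB₃
    refine ⟨D₂ + D₃, ENNReal.add_ne_top.2 ⟨hD₂, hD₃⟩, fun u => ?_, fun u => ?_⟩
    · refine (hE₂ P hP u).trans ?_
      rw [h20]
      gcongr
      exact le_self_add
    · have := hE₃ 2 hr2 u
      rw [h20] at this
      refine this.trans ?_
      gcongr
      exact le_add_self

/-- The input-to-state map `u ↦ ∫₀ᵗ e^{A(t-s)} B u(s) ds` is bounded on `L²(0, ∞)`, and it splits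
into a small part and an integrability improving part. -/
theorem exists_inputMap [TopologicalSpace.SeparableSpace Y] (hS : S.ExpStable) {P r : ℝ}
    (hPr : P.HolderConjugate r) (hP : 2 ≤ P) :
    ∃ L : Lp U 2 halfLine →L[ℂ] Lp Y 2 halfLine,
      (∀ u : Lp U 2 halfLine, IsConv S.adjIncl (ctrlKernel S B) u (L u)) ∧ SplitsSmall L P r := by
  obtain ⟨L₁, L₂, h, -⟩ := H.exists_split hS hPr hP one_pos
  refine ⟨L₁ + L₂, h, fun c hc => ?_⟩
  obtain ⟨L₃, L₄, h', h''⟩ := H.exists_split hS hPr hP hc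
  refine ⟨L₃, L₄, ?_, h''⟩
  ext1 u
  exact Lp.ext ((h u).unique (S.dense_adjDom hS) (h' u))

/-- The choice of the exponents. The dual exponent `r` satisfies `γ r < 1`, so that `B* e^{A* t} z`
belongs to `L^r(0, ∞)` with a bound by `‖z‖`, and it does not exceed the exponent of the regularity
assumption, so that there is also a bound by `‖A*^{-ε} z‖`. Hence controls in `L^P` have a state at
every time, with a gain of the power `ε` of `A`. -/
theorem exists_exponents (hS : S.ExpStable) :
    ∃ P r : ℝ, P.HolderConjugate r ∧ 2 ≤ P ∧ ∃ C : ℝ≥0∞, C ≠ ∞ ∧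
      PointwiseConvBound (ctrlKernel S B) (fun z => ‖z.toY‖ₑ) P C ∧
      PointwiseConvBound (ctrlKernel S B)
        (fun z => ENNReal.ofReal ‖negFracPow S.adj ε z.toY‖) P C := by
  obtain ⟨M, ω, hM1, hω, hM⟩ := id hS
  have hM0 : 0 ≤ M := by linarith
  obtain ⟨q, hq1, hq2, hq⟩ := H.exists_ctrlKernel_bound_fracPow hS hM0 hω hM
  obtain ⟨r, hr1, hrq, hrγ⟩ : ∃ r : ℝ, 1 < r ∧ r ≤ q ∧ γ * r < 1 := by
    have hγ0 := H.gamma_mem.1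
    have hγ1 : 1 < γ⁻¹ := (one_lt_inv₀ hγ0).2 H.gamma_mem.2
    obtain ⟨r, h1, h2⟩ := exists_between (lt_min hq1 hγ1)
    refine ⟨r, h1, (h2.trans_le (min_le_left _ _)).le, ?_⟩
    have := mul_lt_mul_of_pos_left (h2.trans_le (min_le_right _ _)) hγ0
    rwa [mul_inv_cancel₀ hγ0.ne'] at this
  have hrP : r.HolderConjugate (Real.conjExponent r) := Real.HolderConjugate.conjExponent hr1
  set P := Real.conjExponent r with hPdef
  have hPr := hrP.symm
  have hP2 : 2 ≤ P := by
    have h1 := hrP.sub_one_mul_conj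
    have h2 := hPr.pos
    nlinarith
  have hP0 := hPr.pos
  obtain ⟨C₁, hC₁, hb₁⟩ := H.exists_ctrlKernel_bound hM0 hω hM hr1.le hrγ
  obtain ⟨C₂, hC₂, hb₂⟩ := hq r hr1.le hrq
  have hκ (z : S.AdjDom) := (continuous_ctrlKernel S hS B z).aestronglyMeasurable (μ := halfLine)
  have key {N : S.AdjDom → ℝ≥0∞} {C : ℝ≥0∞} (hC : ∀ z, ∫⁻ t in Ioi (0 : ℝ),
      (ENNReal.ofReal (Real.exp (ω / 2 * t)) * ‖ctrlKernel S B t z‖ₑ) ^ r ≤ (C * N z) ^ r)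
      (u : ℝ → U) (hu : AEStronglyMeasurable u halfLine) (z : S.AdjDom) (t : ℝ) :
      ∫⁻ s in Ioo 0 t, ‖ctrlKernel S B (t - s) z‖ₑ * ‖u s‖ₑ ≤
        N z * (C * eLpNorm u (ENNReal.ofReal P) (volume.restrict (Ioo 0 t))) := by
    refine (ConvBound.of_weighted hκ hPr hC z u hu t).trans ?_
    have h1 : ∫⁻ s in Ioo 0 t,
        (C * ENNReal.ofReal (Real.exp (-(ω / 2) * (t - s)))) ^ P * ‖u s‖ₑ ^ P ≤
        C ^ P * ∫⁻ s in Ioo 0 t, ‖u s‖ₑ ^ P := by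
      rw [← lintegral_const_mul'' _ ((hu.mono_ac (absolutelyContinuous_Ioo t)).enorm.pow_const P)]
      refine setLIntegral_mono' measurableSet_Ioo fun s hs => ?_
      exact mul_le_mul_left (mul_exp_rpow_le (half_pos hω) hP0 (sub_pos.2 hs.2) C) _
    rw [eLpNorm_ofReal_eq hP0]
    gcongr
    refine (ENNReal.rpow_le_rpow h1 (by positivity)).trans_eq ?_
    rw [ENNReal.mul_rpow_of_nonneg _ _ (by positivity), ← ENNReal.rpow_mul,
      mul_one_div_cancel hP0.ne', ENNReal.rpow_one]
  refine ⟨P, r, hPr, hP2, C₁ + C₂, ENNReal.add_ne_top.2 ⟨hC₁, hC₂⟩, fun u hu z t => ?_,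
    fun u hu z t => ?_⟩
  · refine (key hb₁ u hu z t).trans ?_
    gcongr
    exact le_self_add
  · simp only [ofReal_norm]
    refine (key hb₂ u hu z t).trans ?_
    gcongr
    exact le_add_self

end DecompositionHypotheses

end InputMap

/-! ### The equation `f + L* Q L f = h` and its regularity -/

theorem enorm_integral_inner_le {α E : Type*} [MeasurableSpace α] {μ : Measure α}
    [NormedAddCommGroup E] [InnerProductSpace ℂ E] {f g : α → E} (hf : AEStronglyMeasurable f μ)
    (hg : AEStronglyMeasurable g μ) {s s' : ℝ≥0∞} [s.HolderConjugate s'] :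
    ‖∫ t, (inner ℂ (f t) (g t) : ℂ) ∂μ‖ₑ ≤ eLpNorm f s μ * eLpNorm g s' μ := by
  refine (enorm_integral_le_lintegral_enorm _).trans ?_
  rw [← eLpNorm_one_eq_lintegral_enorm]
  have := eLpNorm_le_eLpNorm_mul_eLpNorm_of_nnnorm (p := s) (q := s') (r := 1) hf hg
    (fun x y => (inner ℂ x y : ℂ)) 1 (ae_of_all _ fun t => by
      rw [one_mul]
      exact nnnorm_inner_le_nnnorm _ _)
  simpa using this

theorem eLpNorm_compLpL_le {α E E' : Type*} [MeasurableSpace α] {μ : Measure α}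
    [NormedAddCommGroup E] [NormedSpace ℂ E] [NormedAddCommGroup E'] [NormedSpace ℂ E']
    (Q : E →L[ℂ] E') (f : Lp E 2 μ) (p : ℝ≥0∞) :
    eLpNorm (Q.compLpL 2 μ f) p μ ≤ ‖Q‖ₑ * eLpNorm f p μ := by
  refine eLpNorm_le_nnreal_smul_eLpNorm_of_ae_le_mul (c := ‖Q‖₊) ?_ p
  filter_upwards [Q.coeFn_compLpL f] with t ht
  rw [ht]
  exact Q.le_opNNNorm _

theorem eLpNorm_two_apply_le {α E E' : Type*} [MeasurableSpace α] {μ : Measure α}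
    [NormedAddCommGroup E] [NormedSpace ℂ E] [NormedAddCommGroup E'] [NormedSpace ℂ E']
    (T : Lp E 2 μ →L[ℂ] Lp E' 2 μ) (f : Lp E 2 μ) :
    eLpNorm (T f) 2 μ ≤ ‖T‖ₑ * eLpNorm f 2 μ := by
  rw [← Lp.enorm_def, ← Lp.enorm_def]
  exact T.le_opENorm f

section Feedback

variable {Y U : Type*} [NormedAddCommGroup Y] [InnerProductSpace ℂ Y] [CompleteSpace Y]
  [NormedAddCommGroup U] [InnerProductSpace ℂ U] [CompleteSpace U]

/-- Bounds of an operator from `L^r` transfer to bounds of its adjoint into the dual space `L^P`. -/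
theorem eLpNorm_adjoint_le {P r : ℝ} (hPr : P.HolderConjugate r) (hP : 2 ≤ P)
    {T : Lp U 2 halfLine →L[ℂ] Lp Y 2 halfLine} {s s' : ℝ≥0∞} [s.HolderConjugate s'] {C : ℝ≥0∞}
    (h : ∀ u, eLpNorm (T u) s halfLine ≤ C * eLpNorm u (ENNReal.ofReal r) halfLine)
    (v : Lp Y 2 halfLine) :
    eLpNorm (ContinuousLinearMap.adjoint T v) (ENNReal.ofReal P) halfLine ≤
      C * eLpNorm v s' halfLine := by
  refine eLpNorm_le_of_inner_le hPr hP (Lp.memLp _) fun φ hφ => ?_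
  have h1 : ∫ t, inner ℂ (φ t) (ContinuousLinearMap.adjoint T v t) ∂halfLine =
      ∫ t, inner ℂ (T hφ.toLp t) (v t) ∂halfLine := by
    rw [← L2.inner_def (𝕜 := ℂ) (T hφ.toLp) v, ← ContinuousLinearMap.adjoint_inner_right,
      L2.inner_def]
    refine integral_congr_ae ?_
    filter_upwards [hφ.coeFn_toLp] with t ht
    rw [ht]
  rw [h1]
  refine (enorm_integral_inner_le (s := s) (s' := s') (Lp.aestronglyMeasurable _)
    (Lp.aestronglyMeasurable _)).trans ?_
  calc _ ≤ C * eLpNorm φ (ENNReal.ofReal r) halfLine * eLpNorm v s' halfLine := by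
        gcongr
        rw [← eLpNorm_congr_ae hφ.coeFn_toLp]
        exact h _
    _ = _ := by ring

variable {P r : ℝ} {L : Lp U 2 halfLine →L[ℂ] Lp Y 2 halfLine}

/-- The adjoint of `L` is bounded from `L² ∩ L^P` to `L^P`, by duality with the bounds of `L` on
`L^r`. -/
theorem SplitsSmall.exists_adjoint_bound (hL : SplitsSmall L P r) (hPr : P.HolderConjugate r)
    (hP : 2 ≤ P) : ∃ C : ℝ≥0∞, C ≠ ∞ ∧ ∀ v,
      eLpNorm (ContinuousLinearMap.adjoint L v) (ENNReal.ofReal P) halfLine ≤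
        C * (eLpNorm v (ENNReal.ofReal P) halfLine + eLpNorm v 2 halfLine) := by
  obtain ⟨L₁, L₂, rfl, -, h1, -, C, hC, -, h2⟩ := hL 1 one_pos
  have := hPr.symm.ennrealOfReal
  refine ⟨1 + C, by simp [hC], fun v => ?_⟩
  have h3 := eLpNorm_adjoint_le hPr hP (s' := ENNReal.ofReal P) h1 v
  have h4 := eLpNorm_adjoint_le hPr hP (s' := 2) h2 v
  rw [map_add, _root_.add_apply, eLpNorm_congr_ae (Lp.coeFn_add _ _)]
  refine (eLpNorm_add_le (Lp.aestronglyMeasurable _) (Lp.aestronglyMeasurable _) ?_).trans ?_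
  · rw [ENNReal.one_le_ofReal]
    linarith
  · rw [mul_add]
    refine add_le_add (h3.trans ?_) (h4.trans ?_)
    · gcongr
      simp
    · gcongr
      exact le_add_self

/-- The regularity of the solutions of `f + L* Q L f = h`: integrability of the right-hand side to
the power `P` passes to the solution. The small part of `L` gives a contraction, and the
remaining part improves square integrability. -/
theorem SplitsSmall.exists_bound (hL : SplitsSmall L P r) (hPr : P.HolderConjugate r)
    (hP : 2 ≤ P) (Q : Y →L[ℂ] Y) : ∃ C : ℝ≥0∞, C ≠ ∞ ∧ ∀ f h : Lp U 2 halfLine,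
      f + ContinuousLinearMap.adjoint L (Q.compLpL 2 halfLine (L f)) = h →
      eLpNorm f (ENNReal.ofReal P) halfLine ≤
        C * (eLpNorm h (ENNReal.ofReal P) halfLine + eLpNorm f 2 halfLine) := by
  -- with this choice `c ‖Q‖ c ≤ 1 / 2`, so that `L₁* Q L₁` is a contraction on `L²` and on `L^P`
  set c : ℝ≥0 := 2⁻¹ * (1 + ‖Q‖₊)⁻¹ with hc
  have hQ1 : (0 : ℝ≥0) < 1 + ‖Q‖₊ := by positivity
  have hc0 : 0 < c := by positivity
  have hcQ : c * (1 + ‖Q‖₊) = 2⁻¹ := by rw [hc, mul_assoc, inv_mul_cancel₀ hQ1.ne', mul_one]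
  have hcc : c * (‖Q‖₊ * c) ≤ 2⁻¹ := by
    have h1 : c * ‖Q‖₊ ≤ 2⁻¹ := hcQ ▸ mul_le_mul_right le_add_self _
    have h2 : c ≤ 1 := by
      have : c * 1 ≤ 2⁻¹ := hcQ ▸ mul_le_mul_right le_self_add _
      rw [mul_one] at this
      exact this.trans (by norm_num)
    calc c * (‖Q‖₊ * c) = c * ‖Q‖₊ * c := by ring
      _ ≤ 2⁻¹ * 1 := mul_le_mul' h1 h2
      _ = 2⁻¹ := mul_one _
  clear_value c
  obtain ⟨L₁, L₂, rfl, h0, h1, h1P, C, hC, h2P, h2⟩ := hL c hc0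
  have := hPr.symm.ennrealOfReal
  have h3 := eLpNorm_adjoint_le hPr hP (s' := ENNReal.ofReal P) h1
  have h4 := eLpNorm_adjoint_le hPr hP (s' := 2) h2
  have hP1 : 1 ≤ ENNReal.ofReal P := by
    rw [ENNReal.one_le_ofReal]
    linarith
  let 𝒬 := Q.compLpL 2 (halfLine)
  let T : Lp U 2 halfLine →L[ℂ] Lp U 2 halfLine := ContinuousLinearMap.adjoint L₁ ∘L 𝒬 ∘L L₁
  have hT : ‖T‖ ≤ 1 / 2 := by
    have h5 : ‖T‖ ≤ c * (‖Q‖ * c) := by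
      refine (ContinuousLinearMap.opNorm_comp_le _ _).trans ?_
      rw [ContinuousLinearMap.adjoint.norm_map]
      refine mul_le_mul h0 ((ContinuousLinearMap.opNorm_comp_le _ _).trans ?_) (norm_nonneg _)
        c.coe_nonneg
      exact mul_le_mul Q.norm_compLpL_le h0 (norm_nonneg _) (norm_nonneg _)
    have h6 : (c : ℝ) * (‖Q‖ * c) ≤ 2⁻¹ := by exact_mod_cast hcc
    linarith
  have hTP (f) : eLpNorm (T f) (ENNReal.ofReal P) halfLine ≤
      2⁻¹ * eLpNorm f (ENNReal.ofReal P) halfLine := by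
    have h6 : (c : ℝ≥0∞) * (‖Q‖ₑ * c) ≤ 2⁻¹ := by
      have : ((c * (‖Q‖₊ * c) : ℝ≥0) : ℝ≥0∞) ≤ ((2⁻¹ : ℝ≥0) : ℝ≥0∞) := by exact_mod_cast hcc
      change (c : ℝ≥0∞) * ((‖Q‖₊ : ℝ≥0∞) * c) ≤ 2⁻¹
      rwa [ENNReal.coe_mul, ENNReal.coe_mul, ENNReal.coe_inv two_ne_zero, ENNReal.coe_ofNat] at this
    calc _ ≤ c * (‖Q‖ₑ * (c * eLpNorm f (ENNReal.ofReal P) halfLine)) := by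
          refine (h3 _).trans ?_
          gcongr
          refine (eLpNorm_compLpL_le _ _ _).trans ?_
          gcongr
          exact h1P f
      _ = c * (‖Q‖ₑ * c) * eLpNorm f (ENNReal.ofReal P) halfLine := by ring
      _ ≤ _ := by gcongr
  set D : ℝ≥0∞ := 1 + c * (‖Q‖ₑ * C) + C * (‖Q‖ₑ * ‖L₁ + L₂‖ₑ) with hD
  have hDt : D ≠ ∞ := by
    simp only [hD]
    finiteness
  refine ⟨2 * D, ENNReal.mul_ne_top (by simp) hDt, fun f h hfh => ?_⟩
  let a := ContinuousLinearMap.adjoint L₁ (𝒬 (L₂ f))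
  let b := ContinuousLinearMap.adjoint L₂ (𝒬 ((L₁ + L₂) f))
  have hfT : f + T f = h - a - b := by
    rw [← hfh]
    simp only [a, b, T, 𝒬, ContinuousLinearMap.comp_apply, _root_.add_apply, map_add]
    abel
  refine (eLpNorm_le_two_mul_of_add_eq hT hTP hP1 hfT).trans ?_
  rw [mul_assoc]
  gcongr
  have ha : eLpNorm a (ENNReal.ofReal P) halfLine ≤ c * (‖Q‖ₑ * C) * eLpNorm f 2 halfLine := by
    calc _ ≤ c * (‖Q‖ₑ * (C * eLpNorm f 2 halfLine)) := by
          refine (h3 _).trans ?_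
          gcongr
          refine (eLpNorm_compLpL_le _ _ _).trans ?_
          gcongr
          exact h2P f
      _ = _ := by ring
  have hb : eLpNorm b (ENNReal.ofReal P) halfLine ≤
      C * (‖Q‖ₑ * ‖L₁ + L₂‖ₑ) * eLpNorm f 2 halfLine := by
    calc _ ≤ C * (‖Q‖ₑ * (‖L₁ + L₂‖ₑ * eLpNorm f 2 halfLine)) := by
          refine (h4 _).trans ?_
          gcongr
          refine (eLpNorm_compLpL_le _ _ _).trans ?_
          gcongr
          exact eLpNorm_two_apply_le _ f
      _ = _ := by ring
  rw [eLpNorm_congr_ae (Lp.coeFn_sub _ _)]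
  refine (eLpNorm_sub_le (Lp.aestronglyMeasurable _) (Lp.aestronglyMeasurable _) hP1).trans ?_
  rw [eLpNorm_congr_ae (Lp.coeFn_sub _ _)]
  refine (add_le_add_left (eLpNorm_sub_le (Lp.aestronglyMeasurable _)
    (Lp.aestronglyMeasurable _) hP1) _).trans ?_
  refine (add_le_add (add_le_add le_rfl ha) hb).trans ?_
  rw [hD]
  set N := eLpNorm h (ENNReal.ofReal P) halfLine
  set N' := eLpNorm f 2 halfLine
  calc N + c * (‖Q‖ₑ * C) * N' + C * (‖Q‖ₑ * ‖L₁ + L₂‖ₑ) * N'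
      = 1 * N + (c * (‖Q‖ₑ * C) + C * (‖Q‖ₑ * ‖L₁ + L₂‖ₑ)) * N' := by ring
    _ ≤ (1 + c * (‖Q‖ₑ * C) + C * (‖Q‖ₑ * ‖L₁ + L₂‖ₑ)) * N +
        (1 + c * (‖Q‖ₑ * C) + C * (‖Q‖ₑ * ‖L₁ + L₂‖ₑ)) * N' := by
        gcongr
        · rw [add_assoc]
          exact le_self_add
        · exact le_add_self
    _ = _ := by ring

variable {Z : Type*} [NormedAddCommGroup Z] [InnerProductSpace ℂ Z] [CompleteSpace Z]

theorem inner_compLpL_adjoint_comp (R : Y →L[ℂ] Z) (f g : Lp Y 2 halfLine) :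
    (inner ℂ f ((ContinuousLinearMap.adjoint R ∘L R).compLpL 2 halfLine g) : ℂ) =
      inner ℂ (R.compLpL 2 halfLine f) (R.compLpL 2 halfLine g) := by
  rw [L2.inner_def, L2.inner_def]
  refine integral_congr_ae ?_
  filter_upwards [(ContinuousLinearMap.adjoint R ∘L R).coeFn_compLpL g, R.coeFn_compLpL f,
    R.coeFn_compLpL g] with t h1 h2 h3
  rw [h1, h2, h3, ContinuousLinearMap.comp_apply, ContinuousLinearMap.adjoint_inner_right]

/-- The equation `f + L* R* R L f = L* v` has a unique solution `f = K v`. The operator `K` is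
bounded on `L²`, and it preserves integrability to the power `P`. -/
theorem SplitsSmall.exists_feedback (hL : SplitsSmall L P r) (hPr : P.HolderConjugate r)
    (hP : 2 ≤ P) (R : Y →L[ℂ] Z) : ∃ K : Lp Y 2 halfLine →L[ℂ] Lp U 2 halfLine,
      (∀ v f, f + ContinuousLinearMap.adjoint L
        ((ContinuousLinearMap.adjoint R ∘L R).compLpL 2 halfLine (L f)) =
          ContinuousLinearMap.adjoint L v ↔ f = K v) ∧
      ∃ C : ℝ≥0∞, C ≠ ∞ ∧ ∀ v, eLpNorm (K v) (ENNReal.ofReal P) halfLine ≤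
        C * (eLpNorm v (ENNReal.ofReal P) halfLine + eLpNorm v 2 halfLine) := by
  obtain ⟨C, hC, hb⟩ := hL.exists_bound hPr hP (ContinuousLinearMap.adjoint R ∘L R)
  obtain ⟨C', hC', hb'⟩ := hL.exists_adjoint_bound hPr hP
  set 𝒬 := (ContinuousLinearMap.adjoint R ∘L R).compLpL 2 halfLine with h𝒬
  set Λ : Lp U 2 halfLine →L[ℂ] Lp U 2 halfLine :=
    ContinuousLinearMap.id ℂ _ + ContinuousLinearMap.adjoint L ∘L 𝒬 ∘L L with hΛ
  have hΛa (f) : Λ f = f + ContinuousLinearMap.adjoint L (𝒬 (L f)) := rfl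
  -- the operator `1 + L* R* R L` is coercive
  have hu : IsUnit Λ := by
    refine ContinuousLinearMap.isUnit_of_forall_le_norm_inner_map Λ one_pos fun f => ?_
    have h1 : (inner ℂ f (Λ f) : ℂ) =
        ((‖f‖ ^ 2 + ‖R.compLpL 2 halfLine (L f)‖ ^ 2 : ℝ) : ℂ) := by
      rw [hΛa, inner_add_right, ContinuousLinearMap.adjoint_inner_right,
        inner_compLpL_adjoint_comp, inner_self_eq_norm_sq_to_K, inner_self_eq_norm_sq_to_K]
      push_cast
      rfl
    rw [norm_inner_symm, h1, Complex.norm_real, Real.norm_of_nonneg (by positivity)]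
    simp only [NNReal.coe_one, mul_one]
    nlinarith [sq_nonneg ‖R.compLpL 2 halfLine (L f)‖]
  obtain ⟨w, hw⟩ := hu
  have hinv1 (f) : Λ ((↑w⁻¹ : _ →L[ℂ] _) f) = f := by
    have := congrArg (fun T : _ →L[ℂ] _ => T f) w.mul_inv
    rwa [hw] at this
  have hinv2 (f) : (↑w⁻¹ : _ →L[ℂ] _) (Λ f) = f := by
    have := congrArg (fun T : _ →L[ℂ] _ => T f) w.inv_mul
    rwa [hw] at this
  set K : Lp Y 2 halfLine →L[ℂ] Lp U 2 halfLine :=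
    (↑w⁻¹ : _ →L[ℂ] _) ∘L ContinuousLinearMap.adjoint L with hK
  have hiff (v f) : f + ContinuousLinearMap.adjoint L (𝒬 (L f)) =
      ContinuousLinearMap.adjoint L v ↔ f = K v := by
    rw [← hΛa]
    constructor
    · intro h
      rw [hK, ContinuousLinearMap.comp_apply, ← h, hinv2]
    · rintro rfl
      exact hinv1 _
  refine ⟨K, hiff, C * (C' + ‖K‖ₑ), by finiteness, fun v => ?_⟩
  have h1 := hb _ _ ((hiff v (K v)).2 rfl)
  refine h1.trans ?_
  rw [mul_assoc, add_mul]
  gcongr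
  · exact hb' v
  · refine (eLpNorm_two_apply_le K v).trans ?_
    gcongr
    exact le_add_self

end Feedback

/-! ### Quadratic functionals and the free evolution -/

section Quadratic

variable {H₁ H₂ : Type*} [NormedAddCommGroup H₁] [InnerProductSpace ℂ H₁]
  [NormedAddCommGroup H₂] [InnerProductSpace ℂ H₂]

/-- Completing the square at a critical point of `u ↦ ‖a + M u‖² + ‖u‖²`. -/
theorem norm_sq_add_norm_sq_eq {M : H₁ →L[ℂ] H₂} {a : H₂} {w : H₁}
    (hw : ∀ φ, (inner ℂ φ w + inner ℂ (M φ) (a + M w) : ℂ) = 0) (v : H₁) :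
    ‖a + M v‖ ^ 2 + ‖v‖ ^ 2 =
      ‖a + M w‖ ^ 2 + ‖w‖ ^ 2 + (‖M (v - w)‖ ^ 2 + ‖v - w‖ ^ 2) := by
  have h1 : a + M v = M (v - w) + (a + M w) := by
    rw [map_sub]
    abel
  have h2 : v = (v - w) + w := by abel
  have h3 := norm_add_sq (𝕜 := ℂ) (M (v - w)) (a + M w)
  have h4 := norm_add_sq (𝕜 := ℂ) (v - w) w
  rw [← h1] at h3
  rw [← h2] at h4
  have h5 := congrArg Complex.re (hw (v - w))
  rw [Complex.add_re, Complex.zero_re] at h5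
  simp only [RCLike.re_to_complex] at h3 h4
  rw [h3, h4]
  linarith

end Quadratic

section FreeEvolution

/-- An exponentially decaying function belongs to `L^p(0, ∞)`. -/
theorem exists_eLpNorm_le_of_exp_le {a p : ℝ} (ha : 0 < a) (hp : 0 < p) :
    ∃ D : ℝ≥0∞, D ≠ ∞ ∧ ∀ {E : Type*} [NormedAddCommGroup E] (f : ℝ → E) (C : ℝ≥0∞),
      (∀ t, 0 < t → ‖f t‖ₑ ≤ C * ENNReal.ofReal (Real.exp (-a * t))) →
        eLpNorm f (ENNReal.ofReal p) halfLine ≤ D * C := by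
  refine ⟨(∫⁻ t in Ioi (0 : ℝ), (1 * ENNReal.ofReal (Real.exp (-a * t))) ^ p) ^ (1 / p),
    ENNReal.rpow_ne_top_of_nonneg (by positivity)
      (lintegral_mul_exp_rpow_ne_top ha hp ENNReal.one_ne_top), fun f C h => ?_⟩
  rw [eLpNorm_ofReal_eq hp]
  calc _ ≤ (∫⁻ t in Ioi (0 : ℝ),
        (1 * ENNReal.ofReal (Real.exp (-a * t))) ^ p * C ^ p) ^ (1 / p) := by
        gcongr ?_ ^ (1 / p)
        refine setLIntegral_mono' measurableSet_Ioi fun t ht => ?_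
        rw [← ENNReal.mul_rpow_of_nonneg _ _ hp.le, one_mul, mul_comm]
        exact ENNReal.rpow_le_rpow (h t ht) hp.le
    _ = _ := by
        rw [lintegral_mul_const _ (by fun_prop), ENNReal.mul_rpow_of_nonneg _ _ (by positivity),
          ← ENNReal.rpow_mul, mul_one_div_cancel hp.ne', ENNReal.rpow_one]

variable {Y : Type*} [NormedAddCommGroup Y] [InnerProductSpace ℂ Y]

namespace C0Semigroup

theorem ExpStable.exists_eLpNorm_orbit_le {S : C0Semigroup Y} (hS : S.ExpStable) {p : ℝ}
    (hp : 0 < p) : ∃ C : ℝ≥0∞, C ≠ ∞ ∧ ∀ x,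
      eLpNorm (fun t : ℝ => S t.toNNReal x) (ENNReal.ofReal p) halfLine ≤ C * ‖x‖ₑ := by
  obtain ⟨M, ω, hM1, hω, hM⟩ := hS
  obtain ⟨D, hD, h⟩ := exists_eLpNorm_le_of_exp_le hω hp
  refine ⟨D * ENNReal.ofReal M, by finiteness, fun x => ?_⟩
  rw [mul_assoc]
  refine h _ _ fun t ht => ?_
  have h1 := ((S t.toNNReal).le_opNorm x).trans
    (mul_le_mul_of_nonneg_right (hM t.toNNReal) (norm_nonneg x))
  rw [Real.coe_toNNReal _ ht.le] at h1
  rw [← ofReal_norm, ← ofReal_norm, ← ENNReal.ofReal_mul (by linarith),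
    ← ENNReal.ofReal_mul (by positivity)]
  refine ENNReal.ofReal_le_ofReal (h1.trans_eq ?_)
  ring

/-- The map `x ↦ e^{A ·} x` from `Y` to `L²(0, ∞; Y)`. -/
theorem ExpStable.exists_orbitMap {S : C0Semigroup Y} (hS : S.ExpStable) :
    ∃ E : Y →L[ℂ] Lp Y 2 halfLine, ∀ x, E x =ᵐ[halfLine] fun t => S t.toNNReal x := by
  obtain ⟨C, hC, h⟩ := hS.exists_eLpNorm_orbit_le two_pos
  rw [ENNReal.ofReal_ofNat] at h
  have hmem (x : Y) : MemLp (fun t : ℝ => S t.toNNReal x) 2 halfLine :=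
    ⟨(S.continuous_orbit x).aestronglyMeasurable, (h x).trans_lt (by finiteness)⟩
  let E : Y →ₗ[ℂ] Lp Y 2 halfLine :=
    { toFun := fun x => (hmem x).toLp
      map_add' := fun x y => by
        rw [← MemLp.toLp_add]
        congr 1
        funext t
        exact _root_.map_add (S t.toNNReal) x y
      map_smul' := fun c x => by
        rw [RingHom.id_apply, ← MemLp.toLp_const_smul]
        congr 1
        funext t
        exact _root_.map_smul (S t.toNNReal) c x }
  refine ⟨E.mkContinuous C.toReal fun x => ?_, fun x => (hmem x).coeFn_toLp⟩
  have h1 : ‖E x‖ = (eLpNorm (fun t : ℝ => S t.toNNReal x) 2 halfLine).toReal :=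
    Lp.norm_toLp _ (hmem x)
  rw [h1]
  refine (ENNReal.toReal_mono (by finiteness) (h x)).trans_eq ?_
  rw [ENNReal.toReal_mul, toReal_enorm]

end C0Semigroup

end FreeEvolution

/-! ### Optimal controls -/

section Optimality

variable {Y U Z : Type*}
  [NormedAddCommGroup Y] [InnerProductSpace ℂ Y] [CompleteSpace Y]
  [NormedAddCommGroup U] [InnerProductSpace ℂ U] [CompleteSpace U]
  [NormedAddCommGroup Z] [InnerProductSpace ℂ Z] [CompleteSpace Z]
  {S : C0Semigroup Y} {B : U →L[ℂ] S.Extrap} {R : Y →L[ℂ] Z}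
  {L : Lp U 2 halfLine →L[ℂ] Lp Y 2 halfLine} {E : Y →L[ℂ] Lp Y 2 halfLine}

omit [CompleteSpace U] in
theorem IsStateAt.unique (hS : S.ExpStable) {x : Y} {u : Lp U 2 halfLine} {t : ℝ≥0} {y y' : Y}
    (h : IsStateAt S B x u t y) (h' : IsStateAt S B x u t y') : y = y' := by
  refine (S.dense_adjDom hS).eq_of_inner_right ℂ ?_
  intro z
  rw [h z, h' z]

/-- The trajectory of the control `u` is `E x + L u`. -/
theorem isTrajectory_add (hE : ∀ x, E x =ᵐ[halfLine] fun t => S t.toNNReal x)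
    (hL : ∀ u : Lp U 2 halfLine, IsConv S.adjIncl (ctrlKernel S B) u (L u)) (x : Y)
    (u : Lp U 2 halfLine) : IsTrajectory S B x u (E x + L u : Lp Y 2 halfLine) := by
  filter_upwards [hE x, hL u, Lp.coeFn_add (E x) (L u), ae_restrict_mem measurableSet_Ioi]
    with t h1 h2 h3 ht
  rw [isStateAt_iff]
  intro z
  rw [h3, Pi.add_apply, inner_add_right, h1, Real.coe_toNNReal _ (le_of_lt ht), ← h2 z]
  rfl

theorem IsTrajectory.ae_eq (hS : S.ExpStable)
    (hE : ∀ x, E x =ᵐ[halfLine] fun t => S t.toNNReal x)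
    (hL : ∀ u : Lp U 2 halfLine, IsConv S.adjIncl (ctrlKernel S B) u (L u)) {x : Y}
    {u : Lp U 2 halfLine} {y : ℝ → Y} (hy : IsTrajectory S B x u y) :
    y =ᵐ[halfLine] (E x + L u : Lp Y 2 halfLine) := by
  filter_upwards [hy, isTrajectory_add hE hL x u] with t h1 h2 using h1.unique hS h2

theorem lintegral_enorm_sq_eq {α F : Type*} [MeasurableSpace α] {μ : Measure α}
    [NormedAddCommGroup F] (f : Lp F 2 μ) :
    ∫⁻ t, ‖f t‖ₑ ^ 2 ∂μ = ENNReal.ofReal (‖f‖ ^ 2) := by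
  have h1 := eLpNorm_ofReal_eq (μ := μ) two_pos f
  rw [ENNReal.ofReal_ofNat, ← Lp.enorm_def] at h1
  rw [ENNReal.ofReal_pow (norm_nonneg _), ofReal_norm, h1, ← ENNReal.rpow_natCast,
    ← ENNReal.rpow_mul]
  norm_num

omit [CompleteSpace Z] in
theorem IsTrajectory.cost_eq (hS : S.ExpStable)
    (hE : ∀ x, E x =ᵐ[halfLine] fun t => S t.toNNReal x)
    (hL : ∀ u : Lp U 2 halfLine, IsConv S.adjIncl (ctrlKernel S B) u (L u)) {x : Y}
    {u : Lp U 2 halfLine} {y : ℝ → Y} (hy : IsTrajectory S B x u y) :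
    cost R u y = ENNReal.ofReal (‖R.compLpL 2 halfLine (E x) +
      (R.compLpL 2 halfLine ∘L L) u‖ ^ 2 + ‖u‖ ^ 2) := by
  rw [ContinuousLinearMap.comp_apply, ← map_add, ENNReal.ofReal_add (by positivity) (by positivity),
    ← lintegral_enorm_sq_eq, ← lintegral_enorm_sq_eq, cost, ← lintegral_add_right']
  · refine lintegral_congr_ae ?_
    filter_upwards [hy.ae_eq hS hE hL, R.coeFn_compLpL (E x + L u)] with t h1 h2
    rw [h1, h2]
  · exact (Lp.aestronglyMeasurable u).enorm.pow_const _

variable {K : Lp Y 2 halfLine →L[ℂ] Lp U 2 halfLine}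

/-- The Euler equation of the minimization of `‖R (w + L u)‖² + ‖u‖²` over `u`. -/
theorem eq_feedback_iff
    (hK : ∀ v f, f + ContinuousLinearMap.adjoint L
      ((ContinuousLinearMap.adjoint R ∘L R).compLpL 2 halfLine (L f)) =
        ContinuousLinearMap.adjoint L v ↔ f = K v) (w : Lp Y 2 halfLine) (u : Lp U 2 halfLine) :
    u = K (-(ContinuousLinearMap.adjoint R ∘L R).compLpL 2 halfLine w) ↔
      ∀ φ, (inner ℂ φ u + inner ℂ ((R.compLpL 2 halfLine ∘L L) φ)
        (R.compLpL 2 halfLine w + (R.compLpL 2 halfLine ∘L L) u) : ℂ) = 0 := by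
  rw [← hK]
  have h1 (φ : Lp U 2 halfLine) : (inner ℂ φ u + inner ℂ ((R.compLpL 2 halfLine ∘L L) φ)
      (R.compLpL 2 halfLine w + (R.compLpL 2 halfLine ∘L L) u) : ℂ) =
      inner ℂ φ (u + ContinuousLinearMap.adjoint L
        ((ContinuousLinearMap.adjoint R ∘L R).compLpL 2 halfLine (L u)) -
        ContinuousLinearMap.adjoint L
          (-(ContinuousLinearMap.adjoint R ∘L R).compLpL 2 halfLine w)) := by
    simp only [inner_sub_right, inner_add_right, map_neg, inner_neg_right,
      ContinuousLinearMap.adjoint_inner_right, inner_compLpL_adjoint_comp,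
      ContinuousLinearMap.comp_apply]
    ring
  simp_rw [h1]
  rw [← sub_eq_zero]
  exact ⟨fun h φ => by rw [h, inner_zero_right], fun h => inner_self_eq_zero.1 (h _)⟩

/-- The optimal control is the critical point of the cost functional: completing the square there
shows that it is the only minimizer. -/
theorem isOptimalControl_iff (hS : S.ExpStable)
    (hE : ∀ x, E x =ᵐ[halfLine] fun t => S t.toNNReal x)
    (hL : ∀ u : Lp U 2 halfLine, IsConv S.adjIncl (ctrlKernel S B) u (L u))
    (hK : ∀ v f, f + ContinuousLinearMap.adjoint L
      ((ContinuousLinearMap.adjoint R ∘L R).compLpL 2 halfLine (L f)) =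
        ContinuousLinearMap.adjoint L v ↔ f = K v) {x : Y} {u : Lp U 2 halfLine} :
    IsOptimalControl S B R x u ↔
      u = K (-(ContinuousLinearMap.adjoint R ∘L R).compLpL 2 halfLine (E x)) := by
  set w := K (-(ContinuousLinearMap.adjoint R ∘L R).compLpL 2 halfLine (E x)) with hw
  have hsq := norm_sq_add_norm_sq_eq ((eq_feedback_iff hK (E x) w).1 hw)
  constructor
  · rintro ⟨y, hy, h⟩
    have h1 := h w _ (isTrajectory_add hE hL x w)
    rw [hy.cost_eq hS hE hL, (isTrajectory_add hE hL x w).cost_eq hS hE hL,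
      ENNReal.ofReal_le_ofReal_iff (by positivity), hsq u] at h1
    have h2 : ‖u - w‖ ^ 2 = 0 := by
      nlinarith [sq_nonneg ‖u - w‖, sq_nonneg ‖(R.compLpL 2 halfLine ∘L L) (u - w)‖]
    rwa [sq_eq_zero_iff, norm_eq_zero, sub_eq_zero] at h2
  · rintro rfl
    refine ⟨_, isTrajectory_add hE hL x w, fun v z hz => ?_⟩
    rw [hz.cost_eq hS hE hL, (isTrajectory_add hE hL x w).cost_eq hS hE hL]
    refine ENNReal.ofReal_le_ofReal ?_
    rw [hsq v]
    exact le_add_of_nonneg_right (by positivity)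

end Optimality

/-! ### Delays and advances -/

section Shift

variable {F : Type*} [NormedAddCommGroup F]

theorem measurePreserving_add_Ioi (s b : ℝ) :
    MeasurePreserving (fun t => t + s) (volume.restrict (Ioi (b - s)))
      (volume.restrict (Ioi b)) := by
  have h := (measurePreserving_add_right volume s).restrict_preimage_emb
    (measurableEmbedding_addRight s) (Ioi b)
  rwa [preimage_add_const_Ioi] at h

theorem measurePreserving_add_halfLine (s : ℝ) :
    MeasurePreserving (fun t => t + s) halfLine (volume.restrict (Ioi s)) := by
  simpa using measurePreserving_add_Ioi s s

theorem measurePreserving_sub_halfLine (s : ℝ) :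
    MeasurePreserving (fun t => t - s) (volume.restrict (Ioi s)) halfLine := by
  simpa [sub_eq_add_neg] using measurePreserving_add_Ioi (-s) 0

theorem restrict_Ioi_le_halfLine {s : ℝ} (hs : 0 ≤ s) : volume.restrict (Ioi s) ≤ halfLine :=
  Measure.restrict_mono_set _ (Ioi_subset_Ioi hs)

theorem ae_halfLine_add {s : ℝ} (hs : 0 ≤ s) {p : ℝ → Prop} (h : ∀ᵐ t ∂halfLine, p t) :
    ∀ᵐ t ∂halfLine, p (t + s) :=
  (measurePreserving_add_halfLine s).quasiMeasurePreserving.ae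
    ((restrict_Ioi_le_halfLine hs).absolutelyContinuous.ae_le h)

theorem ae_halfLine_sub (s : ℝ) {p : ℝ → Prop} (h : ∀ᵐ t ∂halfLine, p t) :
    ∀ᵐ t ∂halfLine, s < t → p (t - s) := by
  have h1 := (measurePreserving_sub_halfLine s).quasiMeasurePreserving.ae h
  exact ae_restrict_of_ae ((ae_restrict_iff' measurableSet_Ioi).1 h1)

theorem exists_advance {s : ℝ} (hs : 0 ≤ s) (u : Lp F 2 halfLine) :
    ∃ v : Lp F 2 halfLine, v =ᵐ[halfLine] fun t => u (t + s) := by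
  have h1 : MemLp (fun t => u (t + s)) 2 halfLine :=
    ((Lp.memLp u).mono_measure (restrict_Ioi_le_halfLine hs)).comp_measurePreserving
      (measurePreserving_add_halfLine s)
  exact ⟨h1.toLp, h1.coeFn_toLp⟩

/-- The delay of a function on `(0, ∞)` by the time `s`. -/
noncomputable def delay (s : ℝ) (f : ℝ → F) : ℝ → F := (Ioi s).indicator fun t => f (t - s)

theorem delay_of_lt {s t : ℝ} (h : s < t) (f : ℝ → F) : delay s f t = f (t - s) :=
  indicator_of_mem (mem_Ioi.2 h) _

theorem delay_of_le {s t : ℝ} (h : t ≤ s) (f : ℝ → F) : delay s f t = 0 :=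
  indicator_of_notMem (notMem_Ioi.2 h) _

theorem exists_delay {s : ℝ} (hs : 0 ≤ s) (u : Lp F 2 halfLine) :
    ∃ v : Lp F 2 halfLine, v =ᵐ[halfLine] delay s u := by
  have h1 : MemLp (fun t => u (t - s)) 2 (volume.restrict (Ioi s)) :=
    (Lp.memLp u).comp_measurePreserving (measurePreserving_sub_halfLine s)
  have h2 : MemLp (delay s u) 2 halfLine := by
    rw [delay, memLp_indicator_iff_restrict measurableSet_Ioi,
      Measure.restrict_restrict measurableSet_Ioi, inter_eq_left.2 (Ioi_subset_Ioi hs)]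
    exact h1
  exact ⟨h2.toLp, h2.coeFn_toLp⟩

/-- Delay and advance are adjoint to each other. -/
theorem inner_eq_of_delay {H : Type*} [NormedAddCommGroup H] [InnerProductSpace ℂ H] {s : ℝ}
    (hs : 0 ≤ s) {φ ψ u v : Lp H 2 halfLine} (hφ : φ =ᵐ[halfLine] delay s ψ)
    (hv : v =ᵐ[halfLine] fun t => u (t + s)) : (inner ℂ φ u : ℂ) = inner ℂ ψ v := by
  rw [L2.inner_def, L2.inner_def]
  have h1 : ∫ t, inner ℂ (φ t) (u t) ∂halfLine =
      ∫ t, (Ioi s).indicator (fun t => inner ℂ (ψ (t - s)) (u t)) t ∂halfLine := by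
    refine integral_congr_ae ?_
    filter_upwards [hφ] with t ht
    rw [ht]
    rcases lt_or_ge s t with h | h
    · rw [delay_of_lt h, indicator_of_mem (mem_Ioi.2 h)]
    · rw [delay_of_le h, indicator_of_notMem (notMem_Ioi.2 h), inner_zero_left]
  rw [h1, integral_indicator measurableSet_Ioi, Measure.restrict_restrict measurableSet_Ioi,
    inter_eq_left.2 (Ioi_subset_Ioi hs),
    ← (measurePreserving_add_halfLine s).integral_comp (measurableEmbedding_addRight s)]
  refine integral_congr_ae ?_
  filter_upwards [hv] with t ht
  rw [ht, add_sub_cancel_right]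

variable {X Y U : Type*} [AddCommGroup X] [Module ℂ X] [NormedAddCommGroup Y]
  [InnerProductSpace ℂ Y] [NormedAddCommGroup U] [InnerProductSpace ℂ U]

theorem weakConv_delay_of_le (κ : ℝ → X →ₗ[ℂ] U) (u : ℝ → U) (z : X) {s t : ℝ} (h0 : 0 ≤ t)
    (h : t ≤ s) : weakConv κ (delay s u) z t = 0 := by
  rw [weakConv, intervalIntegral.integral_of_le h0]
  refine setIntegral_eq_zero_of_forall_eq_zero fun σ hσ => ?_
  rw [delay_of_le (hσ.2.trans h), inner_zero_right]

theorem weakConv_delay_of_lt (κ : ℝ → X →ₗ[ℂ] U) (u : ℝ → U) (z : X) {s t : ℝ} (hs : 0 ≤ s)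
    (h : s < t) : weakConv κ (delay s u) z t = weakConv κ u z (t - s) := by
  have h1 := intervalIntegral.integral_comp_sub_right (a := s) (b := t)
    (fun σ => (inner ℂ (κ (t - s - σ) z) (u σ) : ℂ)) s
  rw [sub_self] at h1
  rw [weakConv, weakConv, ← h1, intervalIntegral.integral_of_le h.le,
    intervalIntegral.integral_of_le (hs.trans h.le)]
  have h2 : Ioc s t = Ioi s ∩ Ioc 0 t := by
    ext σ
    simp only [mem_Ioc, mem_inter_iff, mem_Ioi]
    exact ⟨fun h => ⟨h.1, hs.trans_lt h.1, h.2⟩, fun h => ⟨h.1, h.2.2⟩⟩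
  rw [h2, ← Measure.restrict_restrict measurableSet_Ioi, ← integral_indicator measurableSet_Ioi]
  congr 1
  funext σ
  rcases lt_or_ge s σ with h | h
  · rw [delay_of_lt h, indicator_of_mem (mem_Ioi.2 h)]
    congr 3
    ring
  · rw [delay_of_le h, indicator_of_notMem (notMem_Ioi.2 h), inner_zero_right]

/-- Convolution commutes with delays. -/
theorem IsConv.delay {e : X →ₗ[ℂ] Y} {κ : ℝ → X →ₗ[ℂ] U} {u : ℝ → U} {y : ℝ → Y} {s : ℝ}
    (hs : 0 ≤ s) (h : IsConv e κ u y) : IsConv e κ (delay s u) (delay s y) := by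
  filter_upwards [ae_halfLine_sub s h, ae_restrict_mem measurableSet_Ioi] with t h1 ht z
  rcases lt_or_ge s t with h2 | h2
  · rw [delay_of_lt h2, weakConv_delay_of_lt κ u z hs h2, h1 h2]
  · rw [delay_of_le h2, weakConv_delay_of_le κ u z (le_of_lt ht) h2, inner_zero_right]

end Shift

/-! ### States at every time -/

section PointwiseState

theorem eLpNorm_Ioo_le {F : Type*} [NormedAddCommGroup F] (u : ℝ → F) (p : ℝ≥0∞) (t : ℝ) :
    eLpNorm u p (volume.restrict (Ioo 0 t)) ≤ eLpNorm u p halfLine :=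
  eLpNorm_mono_measure _ (Measure.restrict_mono_set _ Ioo_subset_Ioi_self)

/-- Absolute continuity of the norm, which yields the continuity of the states at `t = 0`. -/
theorem tendsto_eLpNorm_Ioo {F : Type*} [NormedAddCommGroup F] {u : ℝ → F} {p : ℝ} (hp : 0 < p)
    (hu : eLpNorm u (ENNReal.ofReal p) halfLine ≠ ∞) :
    Tendsto (fun t : ℝ≥0 => eLpNorm u (ENNReal.ofReal p) (volume.restrict (Ioo 0 (t : ℝ)))) (𝓝 0)
      (𝓝 0) := by
  have h1 : ∫⁻ s in Ioi (0 : ℝ), ‖u s‖ₑ ^ p ≠ ∞ := by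
    intro h
    rw [eLpNorm_ofReal_eq hp, h, ENNReal.top_rpow_of_pos (by positivity)] at hu
    exact hu rfl
  have h2 : Tendsto (fun t : ℝ≥0 => halfLine (Ioo 0 (t : ℝ))) (𝓝 0) (𝓝 0) := by
    have h3 : Tendsto (fun t : ℝ≥0 => (t : ℝ≥0∞)) (𝓝 0) (𝓝 0) :=
      ENNReal.continuous_coe.tendsto 0
    refine tendsto_of_tendsto_of_tendsto_of_le_of_le tendsto_const_nhds h3 (fun _ => zero_le)
      fun t => (Measure.restrict_apply_le _ _).trans_eq ?_
    simp
  have h3 := tendsto_setLIntegral_zero h1 h2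
  have h4 (t : ℝ≥0) : eLpNorm u (ENNReal.ofReal p) (volume.restrict (Ioo 0 (t : ℝ))) =
      (∫⁻ s in Ioo 0 (t : ℝ), ‖u s‖ₑ ^ p ∂halfLine) ^ (1 / p) := by
    rw [eLpNorm_ofReal_eq hp, Measure.restrict_restrict measurableSet_Ioo,
      inter_eq_left.2 Ioo_subset_Ioi_self]
  simp_rw [h4]
  have h5 := h3.ennrpow_const (1 / p)
  rwa [ENNReal.zero_rpow_of_pos (by positivity)] at h5

variable {Y U : Type*}
  [NormedAddCommGroup Y] [InnerProductSpace ℂ Y] [CompleteSpace Y]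
  [NormedAddCommGroup U] [InnerProductSpace ℂ U] [CompleteSpace U]
  {S : C0Semigroup Y} {B : U →L[ℂ] S.Extrap} {P : ℝ} {C : ℝ≥0∞}

theorem PointwiseConvBound.intervalIntegrable
    (hb : PointwiseConvBound (ctrlKernel S B) (fun z => ‖z.toY‖ₑ) P C) (hC : C ≠ ∞)
    (hS : S.ExpStable) {u : Lp U 2 halfLine}
    (hu : eLpNorm u (ENNReal.ofReal P) halfLine ≠ ∞) (z : S.AdjDom) {t : ℝ} (ht : 0 ≤ t) :
    IntervalIntegrable (fun s => inner ℂ (ctrlKernel S B (t - s) z) (u s)) volume 0 t := by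
  refine integrableOn_weakConv (continuous_ctrlKernel S hS B z).aestronglyMeasurable
    (Lp.aestronglyMeasurable u) ht ((hb u (Lp.aestronglyMeasurable u) z t).trans_lt ?_)
  have := ((eLpNorm_Ioo_le u (ENNReal.ofReal P) t).trans_lt hu.lt_top).ne
  exact ENNReal.mul_lt_top enorm_lt_top (by finiteness)

/-- For a control in `L^P` the state exists in `Y` at every time, not only at almost every time. -/
theorem PointwiseConvBound.exists_isStateAt
    (hb : PointwiseConvBound (ctrlKernel S B) (fun z => ‖z.toY‖ₑ) P C) (hC : C ≠ ∞)
    (hS : S.ExpStable) (x : Y) {u : Lp U 2 halfLine}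
    (hu : eLpNorm u (ENNReal.ofReal P) halfLine ≠ ∞) (t : ℝ≥0) : ∃ y, IsStateAt S B x u t y := by
  have := ((eLpNorm_Ioo_le u (ENNReal.ofReal P) t).trans_lt hu.lt_top).ne
  obtain ⟨y, hy⟩ := exists_inner_eq_weakConv (e := S.adjIncl)
    (fun z => (continuous_ctrlKernel S hS B z).aestronglyMeasurable)
    (Lp.aestronglyMeasurable u) t.coe_nonneg (by finiteness)
    fun z => hb u (Lp.aestronglyMeasurable u) z t
  refine ⟨S t x + y, (isStateAt_iff _ _ _ _ _ _).2 fun z => ?_⟩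
  rw [inner_add_right, ← hy z]
  rfl

theorem PointwiseConvBound.enorm_sub_le
    (hb : PointwiseConvBound (ctrlKernel S B) (fun z => ‖z.toY‖ₑ) P C)
    (hS : S.ExpStable) {x y : Y} {u : Lp U 2 halfLine} {t : ℝ≥0} (h : IsStateAt S B x u t y) :
    ‖y - S t x‖ₑ ≤ C * eLpNorm u (ENNReal.ofReal P) (volume.restrict (Ioo 0 (t : ℝ))) := by
  refine enorm_le_of_dense_inner (S.dense_adjDom hS) fun z => ?_
  rw [inner_sub_right, (isStateAt_iff _ _ _ _ _ _).1 h z, add_sub_cancel_left]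
  exact (enorm_weakConv_le _ _ _ t.coe_nonneg).trans (hb u (Lp.aestronglyMeasurable u) z t)

theorem PointwiseConvBound.isStateAt_add
    (hb : PointwiseConvBound (ctrlKernel S B) (fun z => ‖z.toY‖ₑ) P C) (hC : C ≠ ∞)
    (hS : S.ExpStable) {x x' y y' : Y} {u u' : Lp U 2 halfLine}
    (hu : eLpNorm u (ENNReal.ofReal P) halfLine ≠ ∞)
    (hu' : eLpNorm u' (ENNReal.ofReal P) halfLine ≠ ∞) {t : ℝ≥0}
    (h : IsStateAt S B x u t y) (h' : IsStateAt S B x' u' t y') :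
    IsStateAt S B (x + x') (u + u') t (y + y') := by
  rw [isStateAt_iff] at *
  intro z
  rw [weakConv_congr_right _ (Lp.coeFn_add u u') z t.coe_nonneg,
    weakConv_add_right (hb.intervalIntegrable hC hS hu z t.coe_nonneg)
      (hb.intervalIntegrable hC hS hu' z t.coe_nonneg), inner_add_right, h, h', map_add,
    inner_add_right]
  ring

theorem IsStateAt.smul {x y : Y} {u : Lp U 2 halfLine} {t : ℝ≥0}
    (h : IsStateAt S B x u t y) (c : ℂ) : IsStateAt S B (c • x) (c • u) t (c • y) := by
  rw [isStateAt_iff] at *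
  intro z
  rw [weakConv_congr_right _ (Lp.coeFn_smul c u) z t.coe_nonneg, weakConv_smul_right,
    inner_smul_right, h, map_smul, inner_smul_right]
  ring

/-- The state can be restarted at the time `s`. -/
theorem PointwiseConvBound.isStateAt_restart
    (hb : PointwiseConvBound (ctrlKernel S B) (fun z => ‖z.toY‖ₑ) P C) (hC : C ≠ ∞)
    (hS : S.ExpStable) {x x' y : Y} {u u' : Lp U 2 halfLine}
    (hu : eLpNorm u (ENNReal.ofReal P) halfLine ≠ ∞) {s t : ℝ≥0}
    (hs : IsStateAt S B x u s x') (hu' : u' =ᵐ[halfLine] fun t => u (t + s))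
    (h : IsStateAt S B x u (s + t) y) : IsStateAt S B x' u' t y := by
  rw [isStateAt_iff] at *
  intro z
  have hi := hb.intervalIntegrable hC hS hu z (s + t).coe_nonneg
  rw [NNReal.coe_add] at hi
  have h1 : weakConv (ctrlKernel S B) u z ((s + t : ℝ≥0) : ℝ) =
      weakConv (ctrlKernel S B) u (S.adjEvolve t z) s + weakConv (ctrlKernel S B) u' z t := by
    rw [weakConv_congr_right _ hu' z t.coe_nonneg]
    have h2 := intervalIntegral.integral_comp_add_right (a := 0) (b := (t : ℝ))
      (fun σ => (inner ℂ (ctrlKernel S B (s + t - σ) z) (u σ) : ℂ)) s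
    rw [zero_add, add_comm (t : ℝ)] at h2
    have hsub : (s : ℝ) ∈ uIcc (0 : ℝ) (s + t) := by
      rw [uIcc_of_le (by positivity)]
      exact ⟨s.coe_nonneg, le_add_of_nonneg_right t.coe_nonneg⟩
    rw [weakConv, weakConv, weakConv, NNReal.coe_add,
      ← intervalIntegral.integral_add_adjacent_intervals
        (hi.mono_set (uIcc_subset_uIcc left_mem_uIcc hsub))
        (hi.mono_set (uIcc_subset_uIcc hsub right_mem_uIcc)), ← h2]
    congr 1
    · refine intervalIntegral.integral_congr fun σ hσ => ?_
      rw [uIcc_of_le s.coe_nonneg] at hσ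
      have := ctrlKernel_add S B (sub_nonneg.2 hσ.2) t.coe_nonneg z
      rw [Real.toNNReal_coe] at this
      rw [← this]
      congr 3
      ring
    · refine intervalIntegral.integral_congr fun σ _ => ?_
      congr 3
      ring
  have h3 := hs (S.adjEvolve t z)
  rw [S.toY_adjEvolve, C0Semigroup.adj, ContinuousLinearMap.adjoint_inner_left,
    ContinuousLinearMap.adjoint_inner_left] at h3
  have h4 : S (s + t) x = S t (S s x) := by rw [add_comm, S.add_apply]
  rw [h z, h1, h3, h4, add_assoc]

end PointwiseState

/-! ### The semigroup of optimal states -/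

section OptimalSemigroup

variable {Y U Z : Type*}
  [NormedAddCommGroup Y] [InnerProductSpace ℂ Y] [CompleteSpace Y]
  [NormedAddCommGroup U] [InnerProductSpace ℂ U] [CompleteSpace U]
  [NormedAddCommGroup Z] [InnerProductSpace ℂ Z] [CompleteSpace Z]
  {S : C0Semigroup Y} {B : U →L[ℂ] S.Extrap} {R : Y →L[ℂ] Z}
  {L : Lp U 2 halfLine →L[ℂ] Lp Y 2 halfLine} {E : Y →L[ℂ] Lp Y 2 halfLine}
  {K : Lp Y 2 halfLine →L[ℂ] Lp U 2 halfLine} {P : ℝ} {C : ℝ≥0∞}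

/-- Bellman's principle: the tail of an optimal control is optimal for the state that has been
reached. Since convolution commutes with delays, the Euler equation of the tail is the Euler
equation of the original problem, tested with delayed functions. -/
theorem PointwiseConvBound.advance_eq_feedback
    (hb : PointwiseConvBound (ctrlKernel S B) (fun z => ‖z.toY‖ₑ) P C) (hC : C ≠ ∞)
    (hS : S.ExpStable) (hE : ∀ x, E x =ᵐ[halfLine] fun t => S t.toNNReal x)
    (hL : ∀ u : Lp U 2 halfLine, IsConv S.adjIncl (ctrlKernel S B) u (L u))
    (hK : ∀ v f, f + ContinuousLinearMap.adjoint L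
      ((ContinuousLinearMap.adjoint R ∘L R).compLpL 2 halfLine (L f)) =
        ContinuousLinearMap.adjoint L v ↔ f = K v) {x x' : Y} {u u' : Lp U 2 halfLine}
    (hu : eLpNorm u (ENNReal.ofReal P) halfLine ≠ ∞)
    (huK : u = K (-(ContinuousLinearMap.adjoint R ∘L R).compLpL 2 halfLine (E x))) {s : ℝ≥0}
    (hs : IsStateAt S B x u s x') (hu' : u' =ᵐ[halfLine] fun t => u (t + s)) :
    u' = K (-(ContinuousLinearMap.adjoint R ∘L R).compLpL 2 halfLine (E x')) := by
  have hs0 := s.coe_nonneg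
  rw [eq_feedback_iff hK] at huK ⊢
  intro ψ
  obtain ⟨φ, hφ⟩ := exists_delay hs0 ψ
  have hy : (E x' + L u' : Lp Y 2 halfLine) =ᵐ[halfLine]
      fun t => (E x + L u : Lp Y 2 halfLine) (t + s) := by
    filter_upwards [isTrajectory_add hE hL x' u',
      ae_halfLine_add hs0 (isTrajectory_add hE hL x u), ae_restrict_mem measurableSet_Ioi]
      with t h1 h2 ht
    rw [Real.toNNReal_add (le_of_lt ht) hs0, Real.toNNReal_coe, add_comm] at h2
    exact h1.unique hS (hb.isStateAt_restart hC hS hu hs hu' h2)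
  have hRy : R.compLpL 2 halfLine (E x' + L u') =ᵐ[halfLine]
      fun t => R.compLpL 2 halfLine (E x + L u) (t + s) := by
    filter_upwards [hy, R.coeFn_compLpL (E x' + L u'),
      ae_halfLine_add hs0 (R.coeFn_compLpL (E x + L u))] with t h1 h2 h3
    rw [h2, h3, h1]
  have hLφ : L φ =ᵐ[halfLine] delay s (L ψ) :=
    (hL φ).unique (S.dense_adjDom hS) (((hL ψ).delay hs0).congr hφ.symm (ae_eq_refl _))
  have hRφ : R.compLpL 2 halfLine (L φ) =ᵐ[halfLine] delay s (R.compLpL 2 halfLine (L ψ)) := by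
    filter_upwards [hLφ, R.coeFn_compLpL (L φ), ae_halfLine_sub s (R.coeFn_compLpL (L ψ))]
      with t h1 h2 h3
    rw [h2, h1]
    rcases lt_or_ge (s : ℝ) t with h | h
    · rw [delay_of_lt h, delay_of_lt h, h3 h]
    · rw [delay_of_le h, delay_of_le h, _root_.map_zero]
  have h1 := huK φ
  rw [inner_eq_of_delay hs0 hφ hu', ContinuousLinearMap.comp_apply, ContinuousLinearMap.comp_apply,
    ← map_add, inner_eq_of_delay hs0 hRφ hRy] at h1
  rw [ContinuousLinearMap.comp_apply, ContinuousLinearMap.comp_apply, ← map_add]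
  exact h1

/-- The optimal states form a bounded strongly continuous semigroup. The semigroup law is the
principle of Bellman together with the uniqueness of the state, and continuity at `0` holds because
the control contributes at most its `L^P` norm on `(0, t)`. -/
theorem PointwiseConvBound.exists_optimalSemigroup
    (hb : PointwiseConvBound (ctrlKernel S B) (fun z => ‖z.toY‖ₑ) P C) (hC : C ≠ ∞)
    (hS : S.ExpStable) (hP : 0 < P) (hE : ∀ x, E x =ᵐ[halfLine] fun t => S t.toNNReal x)
    (hL : ∀ u : Lp U 2 halfLine, IsConv S.adjIncl (ctrlKernel S B) u (L u))
    (hK : ∀ v f, f + ContinuousLinearMap.adjoint L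
      ((ContinuousLinearMap.adjoint R ∘L R).compLpL 2 halfLine (L f)) =
        ContinuousLinearMap.adjoint L v ↔ f = K v) {D : ℝ≥0∞} (hD : D ≠ ∞)
    (hu : ∀ x, eLpNorm (K (-(ContinuousLinearMap.adjoint R ∘L R).compLpL 2 halfLine (E x)))
      (ENNReal.ofReal P) halfLine ≤ D * ‖x‖ₑ) :
    ∃ Φ : C0Semigroup Y, (∃ M, ∀ t, ‖Φ t‖ ≤ M) ∧ ∀ x t, IsStateAt S B x
      (K (-(ContinuousLinearMap.adjoint R ∘L R).compLpL 2 halfLine (E x))) t (Φ t x) := by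
  set o : Y →L[ℂ] Lp U 2 halfLine :=
    K ∘L (-((ContinuousLinearMap.adjoint R ∘L R).compLpL 2 halfLine)) ∘L E with ho
  change ∀ x, eLpNorm (o x) (ENNReal.ofReal P) halfLine ≤ D * ‖x‖ₑ at hu
  have hut (x : Y) : eLpNorm (o x) (ENNReal.ofReal P) halfLine ≠ ∞ :=
    ((hu x).trans_lt (by finiteness)).ne
  choose f hf using fun (t : ℝ≥0) (x : Y) => hb.exists_isStateAt hC hS x (hut x) t
  obtain ⟨M, hM⟩ := hS.exists_bound
  have hfb (t : ℝ≥0) (x : Y) : ‖f t x‖ ≤ (ENNReal.ofReal M + C * D).toReal * ‖x‖ := by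
    have h1 : ‖f t x‖ₑ ≤ (ENNReal.ofReal M + C * D) * ‖x‖ₑ :=
      calc ‖f t x‖ₑ = ‖S t x + (f t x - S t x)‖ₑ := by rw [add_sub_cancel]
        _ ≤ ‖S t x‖ₑ + ‖f t x - S t x‖ₑ := enorm_add_le _ _
        _ ≤ ENNReal.ofReal M * ‖x‖ₑ + C * (D * ‖x‖ₑ) := by
            gcongr
            · rw [← ofReal_norm, ← ofReal_norm,
                ← ENNReal.ofReal_mul ((norm_nonneg _).trans (hM t))]
              exact ENNReal.ofReal_le_ofReal ((S t).le_of_opNorm_le (hM t) x)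
            · refine (hb.enorm_sub_le hS (hf t x)).trans ?_
              gcongr
              exact (eLpNorm_Ioo_le _ _ _).trans (hu x)
        _ = _ := by ring
    have h2 := ENNReal.toReal_mono (by finiteness) h1
    rwa [ENNReal.toReal_mul, toReal_enorm, toReal_enorm] at h2
  let T (t : ℝ≥0) : Y →L[ℂ] Y := LinearMap.mkContinuous
    { toFun := f t
      map_add' := fun x y => by
        refine (hf t (x + y)).unique hS ?_
        rw [_root_.map_add]
        exact hb.isStateAt_add hC hS (hut x) (hut y) (hf t x) (hf t y)
      map_smul' := fun c x => by
        refine (hf t (c • x)).unique hS ?_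
        rw [_root_.map_smul]
        exact (hf t x).smul c } _ (hfb t)
  have hT (t : ℝ≥0) (x : Y) : IsStateAt S B x (o x) t (T t x) := hf t x
  have hTM (t : ℝ≥0) : ‖T t‖ ≤ (ENNReal.ofReal M + C * D).toReal :=
    LinearMap.mkContinuous_norm_le _ ENNReal.toReal_nonneg _
  have hadd (s t : ℝ≥0) (x : Y) : T (s + t) x = T s (T t x) := by
    obtain ⟨u', hu'⟩ := exists_advance t.coe_nonneg (o x)
    have h1 := hb.advance_eq_feedback hC hS hE hL hK (hut x) rfl (hT t x) hu'
    have h2 : IsStateAt S B (T t x) u' s (T (s + t) x) :=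
      hb.isStateAt_restart hC hS (hut x) (hT t x) hu' (by rw [add_comm]; exact hT _ x)
    rw [h1] at h2
    exact h2.unique hS (hT s (T t x))
  have hzero (x : Y) : Tendsto (fun t => ‖T t x - x‖) (𝓝 0) (𝓝 0) := by
    have h1 : Tendsto (fun t => ‖S t x - x‖ₑ) (𝓝 0) (𝓝 0) := by
      have h2 := (((S.cont x).sub (continuous_const (y := x))).enorm).tendsto 0
      simpa [S.zero_apply] using h2
    have h3 := ENNReal.Tendsto.const_mul (tendsto_eLpNorm_Ioo hP (hut x)) (Or.inr hC)
    rw [mul_zero] at h3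
    have h4 : Tendsto (fun t => ‖T t x - x‖ₑ) (𝓝 0) (𝓝 0) := by
      have h5 := h3.add h1
      rw [add_zero] at h5
      refine tendsto_of_tendsto_of_tendsto_of_le_of_le tendsto_const_nhds h5 (fun _ => zero_le)
        fun t => ?_
      calc ‖T t x - x‖ₑ = ‖(T t x - S t x) + (S t x - x)‖ₑ := by rw [sub_add_sub_cancel]
        _ ≤ ‖T t x - S t x‖ₑ + ‖S t x - x‖ₑ := enorm_add_le _ _
        _ ≤ _ := by
          gcongr
          exact hb.enorm_sub_le hS (hT t x)
    have h6 := (ENNReal.tendsto_toReal ENNReal.zero_ne_top).comp h4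
    simpa [Function.comp_def] using h6
  refine ⟨⟨T, ?_, ?_, C0Semigroup.continuous_of_tendsto_zero hTM hadd dense_univ
    fun x _ => hzero x⟩, ⟨_, hTM⟩, fun x t => hT t x⟩
  · ext x
    refine (hT 0 x).unique hS ?_
    rw [isStateAt_iff]
    intro z
    simp [weakConv, S.zero_apply]
  · intro s t
    ext x
    exact hadd s t x

end OptimalSemigroup

/-! ### Comparison of the resolvents and of the domains -/

section Resolvent

variable {Y : Type*} [NormedAddCommGroup Y] [InnerProductSpace ℂ Y] [CompleteSpace Y]

/-- The difference of the resolvents at `1` as a Laplace transform. The point `1` is used because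
the optimal semigroup is only known to be bounded. -/
theorem C0Semigroup.inner_potential_sub {S Φ : C0Semigroup Y} (hS : (S.rescale 1).ExpStable)
    (hΦ : (Φ.rescale 1).ExpStable) (v w : Y) :
    (inner ℂ v ((Φ.rescale 1).potential hΦ w - (S.rescale 1).potential hS w) : ℂ) =
      ∫ t in Ioi (0 : ℝ), Real.exp (-t) • (inner ℂ v (Φ t.toNNReal w - S t.toNNReal w) : ℂ) := by
  have hi : IntegrableOn (fun t : ℝ => Φ.rescale 1 t.toNNReal w - S.rescale 1 t.toNNReal w)
      (Ioi 0) := ((Φ.rescale 1).integrableOn_orbit hΦ w).sub ((S.rescale 1).integrableOn_orbit hS w)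
  rw [potential_apply, potential_apply, ← integral_sub ((Φ.rescale 1).integrableOn_orbit hΦ w)
    ((S.rescale 1).integrableOn_orbit hS w), ← integral_inner hi]
  refine setIntegral_congr_fun measurableSet_Ioi fun t ht => ?_
  rw [rescale_apply, rescale_apply, ← smul_sub, ← Complex.coe_smul, inner_smul_right,
    Real.coe_toNNReal _ (le_of_lt ht), neg_one_mul, ← smul_eq_mul, Complex.coe_smul]

/-- A uniform bound of `⟪z, Φ(t) w - S(t) w⟫` passes to the difference of the resolvents. -/
theorem C0Semigroup.norm_inner_potential_sub_le {S Φ : C0Semigroup Y}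
    (hS : (S.rescale 1).ExpStable) (hΦ : (Φ.rescale 1).ExpStable) {z w : Y} {c : ℝ}
    (h : ∀ t, ‖(inner ℂ z (Φ t w - S t w) : ℂ)‖ ≤ c) :
    ‖(inner ℂ z ((Φ.rescale 1).potential hΦ w - (S.rescale 1).potential hS w) : ℂ)‖ ≤ c := by
  have h1 : ∫ t in Ioi (0 : ℝ), Real.exp (-t) * c = c := by
    rw [integral_mul_const, integral_exp_neg_Ioi_zero, one_mul]
  rw [inner_potential_sub, ← h1]
  refine norm_integral_le_of_norm_le ((integrableOn_exp_neg_Ioi 0).mul_const c)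
    (ae_of_all _ fun t => ?_)
  rw [norm_smul, Real.norm_of_nonneg (Real.exp_nonneg _)]
  gcongr
  exact h _

end Resolvent

section Domains

variable {Y U Z : Type*}
  [NormedAddCommGroup Y] [InnerProductSpace ℂ Y] [CompleteSpace Y]
  [NormedAddCommGroup U] [InnerProductSpace ℂ U] [CompleteSpace U]
  [NormedAddCommGroup Z] [InnerProductSpace ℂ Z] [CompleteSpace Z]
  {S : C0Semigroup Y} {B : U →L[ℂ] S.Extrap} {R : Y →L[ℂ] Z}

/-- `A*^{-ε} R* R` is dominated by `A^{-ε}`: this is the adjoint form of the boundedness of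
`A*^ε R* R A^{-ε}`. -/
theorem DecompositionHypotheses.exists_norm_observation_le {F : ℝ → Y →L[ℂ] U}
    {G : ℝ → S.AdjDom →L[ℂ] U} {γ ε : ℝ} (H : DecompositionHypotheses S B R F G γ ε)
    (hS : S.ExpStable) : ∃ c : ℝ, 0 ≤ c ∧ ∀ x,
      ‖negFracPow S.adj ε (ContinuousLinearMap.adjoint R (R x))‖ ≤ c * ‖negFracPow S ε x‖ := by
  obtain ⟨c, hc⟩ := H.observation
  refine ⟨max c 0, le_max_right _ _, fun x => ?_⟩
  rw [← S.fracPow_adjSemigroup_apply hS H.eps_pos, ← S.fracPow_apply hS H.eps_pos]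
  set A := S.fracPow hS H.eps_pos
  set y := ContinuousLinearMap.adjoint A (ContinuousLinearMap.adjoint R (R x)) with hy
  obtain ⟨w, hw, hwy⟩ := hc y
  rw [← S.fracPow_adjSemigroup_apply hS H.eps_pos, ← S.fracPow_apply hS H.eps_pos] at hwy
  have key {ξ w : Y} (h : ContinuousLinearMap.adjoint A w =
      ContinuousLinearMap.adjoint R (R (A ξ))) : (inner ℂ ξ y : ℂ) = inner ℂ w (A x) := by
    rw [hy, ContinuousLinearMap.adjoint_inner_right, ContinuousLinearMap.adjoint_inner_right,
      ← ContinuousLinearMap.adjoint_inner_left, ← h, ContinuousLinearMap.adjoint_inner_left]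
  have h1 : (inner ℂ y y : ℂ) = inner ℂ w (A x) := key hwy
  have h2 : ‖y‖ ^ 2 ≤ max c 0 * ‖y‖ * ‖A x‖ := by
    have h3 : ‖(inner ℂ y y : ℂ)‖ = ‖y‖ ^ 2 := by
      rw [inner_self_eq_norm_sq_to_K]
      simp
    rw [← h3, h1]
    refine (norm_inner_le_norm _ _).trans ?_
    gcongr
    exact hw.trans (by gcongr; exact le_max_left _ _)
  rcases eq_or_ne ‖y‖ 0 with h0 | h0
  · rw [h0]
    positivity
  · have : 0 < ‖y‖ := (norm_nonneg y).lt_of_ne' h0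
    nlinarith

variable {ε P : ℝ} {C : ℝ≥0∞}

theorem PointwiseConvBound.norm_weakConv_le {N : S.AdjDom → ℝ} (hN : ∀ z, 0 ≤ N z)
    (hb : PointwiseConvBound (ctrlKernel S B) (fun z => ENNReal.ofReal (N z)) P C) (hC : C ≠ ∞)
    {u : Lp U 2 halfLine} {D : ℝ≥0∞} (hD : D ≠ ∞)
    (hu : eLpNorm u (ENNReal.ofReal P) halfLine ≤ D) (z : S.AdjDom) {t : ℝ} (ht : 0 ≤ t) :
    ‖weakConv (ctrlKernel S B) u z t‖ ≤ (C * D).toReal * N z := by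
  have h1 := (enorm_weakConv_le (ctrlKernel S B) u z ht).trans
    (hb u (Lp.aestronglyMeasurable u) z t)
  have h2 : ‖weakConv (ctrlKernel S B) u z t‖ₑ ≤ ENNReal.ofReal (N z) * (C * D) := by
    refine h1.trans ?_
    gcongr
    exact (eLpNorm_Ioo_le _ _ _).trans hu
  have h3 := ENNReal.toReal_mono (by finiteness) h2
  rwa [toReal_enorm, ENNReal.toReal_mul, ENNReal.toReal_ofReal (hN z), mul_comm] at h3

variable {L : Lp U 2 halfLine →L[ℂ] Lp Y 2 halfLine} {E : Y →L[ℂ] Lp Y 2 halfLine}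
  {K : Lp Y 2 halfLine →L[ℂ] Lp U 2 halfLine} {Φ : C0Semigroup Y} {M : ℝ}

/-- A vector of `D(A_P)` has the form `(1 - A_P)⁻¹ w`. It differs from `(1 - A)⁻¹ w ∈ D(A) ⊆ D(A^ε)`
by a vector whose pairing with `z` is dominated by `‖A*^{-ε} z‖`, hence by a vector of `D(A^ε)`. -/
theorem domain_subset_fracDomain (hS : S.ExpStable) (h0 : 0 < ε) (h1 : ε < 1)
    (hΦ : ∀ t, ‖Φ t‖ ≤ M) {c : Y → ℝ} (hc : ∀ w, 0 ≤ c w)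
    (h : ∀ (w : Y) (z : S.AdjDom) (t : ℝ≥0), ‖(inner ℂ z.toY (Φ t w - S t w) : ℂ)‖ ≤
      c w * ‖negFracPow S.adj ε z.toY‖) :
    (Φ.generator.domain : Set Y) ⊆ fracDomain S ε := by
  rintro x ⟨y, hxy⟩
  obtain ⟨M', hM'⟩ := hS.exists_bound
  have hΦ1 : (Φ.rescale 1).ExpStable := C0Semigroup.rescale_expStable one_pos hΦ
  have hS1 : (S.rescale 1).ExpStable := C0Semigroup.rescale_expStable one_pos hM'
  obtain ⟨w, rfl⟩ : ∃ w, x = (Φ.rescale 1).potential hΦ1 w :=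
    ⟨_, by rw [(hxy.rescale 1).eq_neg_potential hΦ1, ← map_neg]⟩
  obtain ⟨g, hg, -⟩ := S.mem_fracDomain_of_inner_le hS h0 (S.dense_adjDom hS) (hc w)
    (y := (Φ.rescale 1).potential hΦ1 w - (S.rescale 1).potential hS1 w) (by
      rintro _ ⟨z, rfl⟩
      exact C0Semigroup.norm_inner_potential_sub_le hS1 hΦ1 (h w z))
  obtain ⟨c', hc'⟩ := S.exists_potential_eq_fracPow hS h0 h1
  have h2 := (S.potential_rescale hS 1 hS1 w).1
  rw [hc', ← Complex.coe_smul, ← map_smul] at h2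
  obtain ⟨g', hg'⟩ : ∃ g', (S.rescale 1).potential hS1 w = S.fracPow hS h0 g' := ⟨_, h2⟩
  rw [← S.fracPow_apply hS h0] at hg
  refine ⟨g + g', ?_⟩
  rw [← S.fracPow_apply hS h0, _root_.map_add, hg, ← hg', sub_add_cancel]

/-- For `y ∈ D(A_P*)` and `v = (1 - A_P*) y` one has `⟪y, w⟫ = ⟪v, (1 - A_P)⁻¹ w⟫`. By duality `y`
belongs to `D(A*^ε)` if this is dominated by `‖A^{-ε} w‖`. For the part of `(1 - A)⁻¹ w` the
domination follows from `A⁻¹ = A^{-(1-ε)} A^{-ε}`, up to a factor; for the difference of the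
resolvents it is the hypothesis `h`. -/
theorem adjoint_domain_subset_fracDomain (hS : S.ExpStable) (h0 : 0 < ε) (h1 : ε < 1)
    (hΦ : ∀ t, ‖Φ t‖ ≤ M) {c : Y → ℝ} (hc : ∀ v, 0 ≤ c v)
    (h : ∀ v w, ‖∫ t in Ioi (0 : ℝ),
      Real.exp (-t) • (inner ℂ v (Φ t.toNNReal w - S t.toNNReal w) : ℂ)‖ ≤
        c v * ‖negFracPow S ε w‖) :
    (Φ.generator†.domain : Set Y) ⊆ fracDomain S.adj ε := by
  intro y hy
  obtain ⟨M', hM'⟩ := hS.exists_bound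
  have hΦ1 : (Φ.rescale 1).ExpStable := C0Semigroup.rescale_expStable one_pos hΦ
  have hS1 : (S.rescale 1).ExpStable := C0Semigroup.rescale_expStable one_pos hM'
  set v := y - Φ.generator† ⟨y, hy⟩ with hv
  have hmem : (y, Φ.generator† ⟨y, hy⟩) ∈ Φ.generator†.graph :=
    LinearPMap.mem_graph _ ⟨y, hy⟩
  have hyv (w : Y) : (inner ℂ y w : ℂ) = inner ℂ v ((Φ.rescale 1).potential hΦ1 w) := by
    have h2 := (Φ.mem_adjDom_iff _ _).1 hmem _ _ (Φ.hasGen_potential_rescale 1 hΦ1 w)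
    rw [one_smul, inner_sub_right] at h2
    rw [hv, inner_sub_left, ← h2]
    ring
  have h1' : 0 < 1 - ε := sub_pos.2 h1
  obtain ⟨c', hc'⟩ := S.exists_potential_eq_fracPow hS h1' (sub_lt_self 1 h0)
  have hV (w : Y) : ‖S.potential hS w‖ ≤ |c'| * ‖S.fracPow hS h1'‖ * ‖negFracPow S ε w‖ := by
    rw [hc' w, S.fracPow_apply hS (sub_pos.2 (sub_lt_self 1 h0)), sub_sub_cancel, norm_smul,
      mul_assoc, Real.norm_eq_abs]
    gcongr
    exact ContinuousLinearMap.le_opNorm _ _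
  have hJS (w : Y) : ‖(S.rescale 1).potential hS1 w‖ ≤
      (1 + ‖(S.rescale 1).potential hS1‖) * ‖S.potential hS w‖ := by
    conv_lhs => rw [(S.potential_rescale hS 1 hS1 w).2]
    rw [one_smul]
    refine (norm_sub_le _ _).trans ?_
    rw [add_mul, one_mul]
    gcongr
    exact ContinuousLinearMap.le_opNorm _ _
  refine S.mem_adj_fracDomain_of_inner_le hS h0 (c := c v + ‖v‖ *
    ((1 + ‖(S.rescale 1).potential hS1‖) * (|c'| * ‖S.fracPow hS h1'‖))) (by
      have := hc v
      positivity) fun w => ?_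
  rw [norm_inner_symm, hyv, ← sub_add_cancel ((Φ.rescale 1).potential hΦ1 w)
    ((S.rescale 1).potential hS1 w), inner_add_right,
    C0Semigroup.inner_potential_sub, add_mul]
  refine (norm_add_le _ _).trans (add_le_add (h v w) ((norm_inner_le_norm _ _).trans ?_))
  rw [mul_assoc, mul_assoc]
  gcongr
  exact (hJS w).trans (by gcongr; exact hV w)

/-- The adjoint estimate. The function `f = K ψ` solves the adjoint problem with the source
`ψ(t) = e^{-t} v`; by the Euler equation, the pairing of `ψ` with the controlled part of the optimal
state equals the pairing of `-L f` with `R* R e^{A t} w`. Since `f` belongs to `L^P`, the values of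
`L f` belong to `D((-A)^ε)`. -/
theorem norm_integral_inner_le
    (hb : PointwiseConvBound (ctrlKernel S B)
      (fun z => ENNReal.ofReal ‖negFracPow S.adj ε z.toY‖) P C)
    (hC : C ≠ ∞) (hS : S.ExpStable) (h0 : 0 < ε) (hP : 0 < P)
    (hE : ∀ x, E x =ᵐ[halfLine] fun t => S t.toNNReal x)
    (hL : ∀ u : Lp U 2 halfLine, IsConv S.adjIncl (ctrlKernel S B) u (L u))
    (hK : ∀ v f, f + ContinuousLinearMap.adjoint L
      ((ContinuousLinearMap.adjoint R ∘L R).compLpL 2 halfLine (L f)) =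
        ContinuousLinearMap.adjoint L v ↔ f = K v) {D : ℝ≥0∞} (hD : D ≠ ∞)
    (hKP : ∀ v, eLpNorm (K v) (ENNReal.ofReal P) halfLine ≤
      D * (eLpNorm v (ENNReal.ofReal P) halfLine + eLpNorm v 2 halfLine))
    (hΦ : ∀ x t, IsStateAt S B x
      (K (-(ContinuousLinearMap.adjoint R ∘L R).compLpL 2 halfLine (E x))) t (Φ t x))
    {c : ℝ} (hc : 0 ≤ c) (hR : ∀ x, ‖negFracPow S.adj ε (ContinuousLinearMap.adjoint R (R x))‖ ≤
      c * ‖negFracPow S ε x‖) (v : Y) :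
    ∃ c', 0 ≤ c' ∧ ∀ w, ‖∫ t in Ioi (0 : ℝ),
      Real.exp (-t) • (inner ℂ v (Φ t.toNNReal w - S t.toNNReal w) : ℂ)‖ ≤
        c' * ‖negFracPow S ε w‖ := by
  obtain ⟨M, ω, hM1, hω, hM⟩ := id hS
  -- the source `ψ`
  have hψb (t : ℝ) (ht : 0 < t) : ‖Real.exp (-t) • v‖ₑ ≤
      ‖v‖ₑ * ENNReal.ofReal (Real.exp (-1 * t)) := by
    rw [enorm_smul, Real.enorm_of_nonneg (Real.exp_nonneg _), neg_one_mul, mul_comm]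
  have hψm : AEStronglyMeasurable (fun t : ℝ => Real.exp (-t) • v) halfLine := by fun_prop
  obtain ⟨D₂, hD₂, hψ2⟩ := exists_eLpNorm_le_of_exp_le (a := 1) one_pos two_pos
  obtain ⟨D₃, hD₃, hψP⟩ := exists_eLpNorm_le_of_exp_le (a := 1) one_pos hP
  have hψ2 := hψ2 _ _ hψb
  have hψP := hψP _ _ hψb
  rw [ENNReal.ofReal_ofNat] at hψ2
  have hψmem : MemLp (fun t : ℝ => Real.exp (-t) • v) 2 halfLine :=
    ⟨hψm, hψ2.trans_lt (by finiteness)⟩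
  set ψ := hψmem.toLp with hψ
  set f := K ψ with hf
  have hfP : eLpNorm f (ENNReal.ofReal P) halfLine ≤ D * (D₃ * ‖v‖ₑ + D₂ * ‖v‖ₑ) := by
    refine (hKP ψ).trans ?_
    rw [eLpNorm_congr_ae hψmem.coeFn_toLp, eLpNorm_congr_ae hψmem.coeFn_toLp]
    gcongr
  set b := (C * (D * (D₃ * ‖v‖ₑ + D₂ * ‖v‖ₑ))).toReal with hbdef
  have hb0 : 0 ≤ b := ENNReal.toReal_nonneg
  -- the values of `L f` are in `D((-A)^ε)`
  have hLf : ∀ᵐ t ∂halfLine, ∃ g, negFracPow S ε g = L f t ∧ ‖g‖ ≤ b := by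
    filter_upwards [hL f, ae_restrict_mem measurableSet_Ioi] with t ht ht0
    refine S.mem_fracDomain_of_inner_le hS h0 (S.dense_adjDom hS) hb0 ?_
    rintro _ ⟨z, rfl⟩
    have h2 := ht z
    rw [S.adjIncl_apply] at h2
    rw [h2]
    exact hb.norm_weakConv_le (fun z => norm_nonneg _) hC (by finiteness) hfP z (le_of_lt ht0)
  refine ⟨b * c * M * ω⁻¹, by positivity, fun w => ?_⟩
  set u := K (-(ContinuousLinearMap.adjoint R ∘L R).compLpL 2 halfLine (E w)) with hu
  have h2 : ∫ t in Ioi (0 : ℝ), Real.exp (-t) • (inner ℂ v (Φ t.toNNReal w - S t.toNNReal w) : ℂ) =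
      inner ℂ ψ (L u) := by
    rw [L2.inner_def]
    refine integral_congr_ae ?_
    filter_upwards [hψmem.coeFn_toLp, isTrajectory_add hE hL w u, hE w, Lp.coeFn_add (E w) (L u)]
      with t h3 h4 h5 h6
    have h7 := h4.unique hS (hΦ w t.toNNReal)
    rw [h3, ← h7, h6, Pi.add_apply, h5, add_sub_cancel_left, ← Complex.coe_smul, ← Complex.coe_smul,
      inner_smul_left, Complex.conj_ofReal, smul_eq_mul]
  -- the Euler equation for `u`, tested with `f`
  have h3 : (inner ℂ ψ (L u) : ℂ) =
      -inner ℂ (R.compLpL 2 halfLine (L f)) (R.compLpL 2 halfLine (E w)) := by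
    have h4 := (eq_feedback_iff hK (E w) u).1 hu f
    rw [inner_add_right] at h4
    simp only [ContinuousLinearMap.comp_apply] at h4
    rw [← ContinuousLinearMap.adjoint_inner_left, ← (hK ψ f).2 hf, inner_add_left,
      ContinuousLinearMap.adjoint_inner_left, ← inner_conj_symm _ (L u),
      inner_compLpL_adjoint_comp, inner_conj_symm]
    linear_combination h4
  rw [h2, h3, norm_neg, L2.inner_def]
  have h4 : ∫ t in Ioi (0 : ℝ), b * c * M * ‖negFracPow S ε w‖ * Real.exp (-ω * t) =
      b * c * M * ω⁻¹ * ‖negFracPow S ε w‖ := by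
    rw [integral_const_mul, integral_exp_mul_Ioi (neg_lt_zero.2 hω)]
    simp
    ring
  rw [← h4]
  refine norm_integral_le_of_norm_le ((exp_neg_integrableOn_Ioi 0 hω).const_mul _) ?_
  filter_upwards [hLf, hE w, R.coeFn_compLpL (L f), R.coeFn_compLpL (E w),
    ae_restrict_mem measurableSet_Ioi] with t ⟨g, hg, hgb⟩ h5 h6 h7 ht
  rw [h6, h7, h5, ← ContinuousLinearMap.adjoint_inner_right, ← hg, ← S.fracPow_apply hS h0,
    ← ContinuousLinearMap.adjoint_inner_right, S.fracPow_adjSemigroup_apply]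
  calc _ ≤ ‖g‖ * (c * ‖negFracPow S ε (S t.toNNReal w)‖) :=
        (norm_inner_le_norm _ _).trans (by gcongr; exact hR _)
    _ ≤ b * (c * (M * Real.exp (-ω * t) * ‖negFracPow S ε w‖)) := by
        rw [← S.fracPow_apply hS h0, ← S.fracPow_comm, S.fracPow_apply]
        gcongr
        have := (S t.toNNReal).le_of_opNorm_le (hM t.toNNReal) (negFracPow S ε w)
        rwa [Real.coe_toNNReal _ (le_of_lt ht)] at this
    _ = _ := by ring

end Domains
theorem proposition3p3
    {Y U Z : Type*}
    [NormedAddCommGroup Y] [InnerProductSpace ℂ Y] [CompleteSpace Y]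
    [TopologicalSpace.SeparableSpace Y]
    [NormedAddCommGroup U] [InnerProductSpace ℂ U] [CompleteSpace U]
    [TopologicalSpace.SeparableSpace U]
    [NormedAddCommGroup Z] [InnerProductSpace ℂ Z] [CompleteSpace Z]
    [TopologicalSpace.SeparableSpace Z]
    (S : C0Semigroup Y) (hS : S.ExpStable)
    (B : U →L[ℂ] S.Extrap) (R : Y →L[ℂ] Z)
    (F : ℝ → Y →L[ℂ] U) (G : ℝ → S.AdjDom →L[ℂ] U) (γ ε : ℝ)
    (H : DecompositionHypotheses S B R F G γ ε)
    (hε : ε < 1 - γ) :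
    (∀ x : Y, ∃! u, IsOptimalControl S B R x u) ∧
    ∃ Φ : C0Semigroup Y, IsOptimalStateSemigroup S B R Φ ∧
      (Φ.generator.domain : Set Y) ⊆ fracDomain S ε ∧
      (Φ.generator†.domain : Set Y) ⊆ fracDomain S.adj ε := by
  have hε1 : ε < 1 := by linarith [H.gamma_mem.1]
  obtain ⟨P, r, hPr, hP, C, hC, hb, hb'⟩ := H.exists_exponents hS
  obtain ⟨L, hL, hsplit⟩ := H.exists_inputMap hS hPr hP
  obtain ⟨E, hE⟩ := hS.exists_orbitMap
  obtain ⟨K, hK, D, hD, hKP⟩ := hsplit.exists_feedback hPr hP R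
  obtain ⟨C₂, hC₂, hE₂⟩ := hS.exists_eLpNorm_orbit_le two_pos
  obtain ⟨C₃, hC₃, hE₃⟩ := hS.exists_eLpNorm_orbit_le hPr.pos
  obtain ⟨c, hc, hR⟩ := H.exists_norm_observation_le hS
  have hopt (x : Y) (u : Lp U 2 halfLine) : IsOptimalControl S B R x u ↔
      u = K (-(ContinuousLinearMap.adjoint R ∘L R).compLpL 2 halfLine (E x)) :=
    isOptimalControl_iff hS hE hL hK
  set Q := ContinuousLinearMap.adjoint R ∘L R with hQ
  set D' := D * (‖Q‖ₑ * (C₃ + C₂)) with hD'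
  have hDt : D' ≠ ∞ := by
    rw [hD']
    finiteness
  have hu (x : Y) : eLpNorm (K (-Q.compLpL 2 halfLine (E x))) (ENNReal.ofReal P) halfLine ≤
      D' * ‖x‖ₑ := by
    refine (hKP _).trans ?_
    rw [eLpNorm_congr_ae (Lp.coeFn_neg _), eLpNorm_congr_ae (Lp.coeFn_neg _), eLpNorm_neg,
      eLpNorm_neg]
    have h2 := hE₂ x
    have h3 := hE₃ x
    rw [ENNReal.ofReal_ofNat, ← eLpNorm_congr_ae (hE x)] at h2
    rw [← eLpNorm_congr_ae (hE x)] at h3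
    calc _ ≤ D * (‖Q‖ₑ * (C₃ * ‖x‖ₑ) + ‖Q‖ₑ * (C₂ * ‖x‖ₑ)) := by
          gcongr
          · exact (eLpNorm_compLpL_le _ _ _).trans (by gcongr)
          · exact (eLpNorm_compLpL_le _ _ _).trans (by gcongr)
      _ = _ := by
          rw [hD']
          ring
  obtain ⟨Φ, ⟨M, hM⟩, hΦ⟩ := hb.exists_optimalSemigroup hC hS hPr.pos hE hL hK hDt hu
  refine ⟨fun x => ⟨_, (hopt x _).2 rfl, fun u hu => (hopt x u).1 hu⟩, Φ,
    fun x => ⟨_, (hopt x _).2 rfl, hΦ x⟩, ?_, ?_⟩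
  · refine domain_subset_fracDomain hS H.eps_pos hε1 hM
      (c := fun w => (C * (D' * ‖w‖ₑ)).toReal) (fun w => ENNReal.toReal_nonneg) fun w z t => ?_
    rw [inner_sub_right, (isStateAt_iff _ _ _ _ _ _).1 (hΦ w t) z, add_sub_cancel_left]
    exact hb'.norm_weakConv_le (fun z => norm_nonneg _) hC (by finiteness) (hu w) z t.coe_nonneg
  · choose c' hc' h using
      norm_integral_inner_le hb' hC hS H.eps_pos hPr.pos hE hL hK hD hKP hΦ hc hR
    exact adjoint_domain_subset_fracDomain hS H.eps_pos hε1 hM hc' h
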